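/- **Notation.** $U(n)$, $O(n)$, $SO(n)$ are the unitary, real orthogonal and special orthogonal matrix groups; $$J_n=\begin{pmatrix}0&-1_n\\1_n&0\end{pmatrix},\qquad I'_{m,n}=\begin{pmatrix}1_m&0\\0&-1_n\end{pmatrix}.$$ For an invertible antisymmetric $B$ of size $2n$ let $USp(B)=\{g\in U(2n): gBg^T=B\}$, and $USp(2n)=USp(J_n)$. For $\lambda\in (S^1)^R$ put $\Lambda=\mathrm{diag}(\lambda_1,\dots,\lambda_R)$ and $$r(\Lambda)=\begin{pmatrix}\mathrm{Re}\,\Lambda&-\mathrm{Im}\,\Lambda\\ \mathrm{Im}\,\Lambda&\mathrm{Re}\,\Lambda\end{pmatrix}.$$ A Hermitian matrix has signature $(p,q)$ if it has $p$ positive and $q$ negative eigenvalues, with multiplicity. A matrix $F\in\mathbb R^{2N\times 2N}$ is called *dexter* if $pFp^{-1}=J_N$ for some $p\in SO(2N)$. **The families.** Consider the following groups $G$, subgroups $K$, maps $\Omega:G\to G$, sets $S$ of matrices, sets $A$ of matrices ($\lambda$ ranging over $(S^1)^R$) and ranks $R$. Here $N,R,L\ge0$ are integers, and $M=L+R$.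 * **A I.** $G=U(N)$, $K=O(N)$, $\Omega(g)=(g^T)^{-1}$, $S=\{H\in U(N): H^T=H\}$, $A=\{\Lambda\}$, $R=N$. * **A II.** $G=U(2N)$, $K=USp(2N)$, $\Omega(g)=(J_Ng^TJ_N^T)^{-1}$, $S=\{H\in U(2N): J_NH^TJ_N^T=H\}$, $A=\{\mathrm{diag}(\Lambda,\Lambda)\}$, $R=N$. * **A III.** $G=U(M+R)$, $K=U(M)\times U(R)$ (block diagonal), $\Omega(g)=I'gI'$ with $I'=I'_{M,R}$, $S=\{FI': F\in U(M+R)\text{ Hermitian of signature }(M,R)\}$, $A=\{\mathrm{diag}(1_L,r(\Lambda))\}$. * **BD I.** $G=O(M+R)$, $K=O(M)\times O(R)$ (block diagonal), $\Omega(g)=I'gI'$ with $I'=I'_{M,R}$, $S=\{FI': F\in O(M+R)\text{ symmetric of signature }(M,R)\}$, $A=\{\mathrm{diag}(1_L,r(\Lambda))\}$. * **D III.** $N=2R+e$ with $e\in\{0,1\}$, $G=SO(2N)$, $K\cong U(N)$ embedded by $g\mapsto\begin{pmatrix}\mathrm{Re}\,g&-\mathrm{Im}\,g\\ \mathrm{Im}\,g&\mathrm{Re}\,g\end{pmatrix}$,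 $\Omega(g)=J_N^TgJ_N$, $S=\{H\in SO(2N): HJ_N\text{ is antisymmetric and dexter}\}$, $A=\{\mathrm{diag}(1_e,r(\Lambda),1_e,r(\Lambda^{-1}))\}$. * **C I.** $G=USp(2N)$, $K\cong U(N)$ embedded by $g\mapsto\mathrm{diag}(g,(g^T)^{-1})$, $\Omega(g)=I'gI'$ with $I'=I'_{N,N}$, $S=\{FI': F\in U(2N)\text{ Hermitian},\ J_NF=-\overline FJ_N\}$, $A=\{r(\Lambda)\}$, $R=N$. * **C II.** Let $I'=\mathrm{diag}(I'_{M,R},I'_{M,R})$ and $\hat J=\begin{pmatrix}0&-I'_{M,R}\\I'_{M,R}&0\end{pmatrix}$. $G=USp(\hat J)\cong USp(2M+2R)$, $K=USp(2M)\times USp(2R)$, the first factor acting on the two groups of $M$ coordinates and the second one on the two groups of $R$ coordinates (the coordinates being grouped as $M,R,M,R$), $\Omega(g)=I'gI'$, $S=\{FI': F\in G\text{ Hermitian of signature }(2M,2R)\}$ (that is, of quaternionic signature $(M,R)$), $A=\{\mathrm{diag}(1_L,r(\Lambda),1_L,r(\Lambda^{-1}))\}$. **Theorem.** In each of these cases: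 1. $\Omega$ is an involutive automorphism of $G$ whose fixed-point set is exactly $K$. 2. $A$ is a torus of dimension $R$: it is a subgroup of $G$ isomorphic to $(S^1)^R$ as a topological group. Moreover $A=\exp(\mathfrak a)$ for an $R$-dimensional maximal abelian subspace $\mathfrak a$ of $\mathfrak p=\{X\in\mathrm{Lie}(G): d\Omega(X)=-X\}$. 3. $gK\mapsto g\,\Omega(g)^{-1}$ is a well-defined bijection (and a homeomorphism) of $G/K$ onto $S$, and $S$ is an embedded smooth submanifold of $G$. 4. Under this bijection $AK/K$ is mapped onto $A$, and left translation of $G/K$ by $k\in K$ becomes the conjugation $H\mapsto kHk^{-1}$ of $S$. 5. Every $H\in S$ is conjugate under $K$ to an element of $A$. 6. Two elements of $A$ are conjugate under $K$ if and only if they have the same eigenvalues, counted with multiplicity. -/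

import Mathlib

open Matrix
open scoped ContDiff

noncomputable section

/-! ### Homomorphisms between unitary groups

`Matrix.unitaryGroup n ℂ` is `U(n)` and `Matrix.unitaryGroup n ℝ` is `O(n)`. -/

/-- `(P, Q) ↦ diag(P, Q)`. -/
def blockDiagHom (m n : Type) [Fintype m] [DecidableEq m] [Fintype n] [DecidableEq n]
    (𝕜 : Type) [RCLike 𝕜] :
    unitaryGroup m 𝕜 × unitaryGroup n 𝕜 →* unitaryGroup (m ⊕ n) 𝕜 where
  toFun p := ⟨fromBlocks p.1.1 0 0 p.2.1, by
    rw [mem_unitaryGroup_iff]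
    have h1 := mem_unitaryGroup_iff.1 p.1.2
    have h2 := mem_unitaryGroup_iff.1 p.2.2
    simp only [star_eq_conjTranspose] at h1 h2
    simp [star_eq_conjTranspose, fromBlocks_conjTranspose, fromBlocks_multiply, h1, h2]⟩
  map_one' := by ext1; simp
  map_mul' p q := by ext1; simp [fromBlocks_multiply]

/-- Simultaneous relabelling of rows and columns. -/
def reindexHom {m n : Type} [Fintype m] [DecidableEq m] [Fintype n] [DecidableEq n]
    (𝕜 : Type) [RCLike 𝕜] (e : m ≃ n) : unitaryGroup m 𝕜 →* unitaryGroup n 𝕜 where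
  toFun g := ⟨reindex e e g.1, by
    rw [mem_unitaryGroup_iff]
    have h := mem_unitaryGroup_iff.1 g.2
    simp only [star_eq_conjTranspose] at h
    simp [star_eq_conjTranspose, conjTranspose_submatrix, submatrix_mul_equiv, h]⟩
  map_one' := by apply Subtype.ext; simp
  map_mul' g h := by apply Subtype.ext; simp [submatrix_mul_equiv]

/-- The inclusion of the real orthogonal group `O(n)` in `U(n)`. -/
def complexifyHom (n : Type) [Fintype n] [DecidableEq n] :
    unitaryGroup n ℝ →* unitaryGroup n ℂ where
  toFun g := ⟨g.1.map Complex.ofRealHom, by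
    rw [mem_unitaryGroup_iff]
    have h := mem_unitaryGroup_iff.1 g.2
    have h2 : star (g.1.map Complex.ofRealHom) = (star g.1).map Complex.ofRealHom := by
      ext i j; simp [star_eq_conjTranspose]
    rw [h2, ← Matrix.map_mul, h]
    simp⟩
  map_one' := by apply Subtype.ext; simp
  map_mul' g h := by apply Subtype.ext; simp [Matrix.map_mul]

/-- The inclusion `g ↦ (Re g, -Im g; Im g, Re g)` of `U(n)` in `O(2n)`. -/
def realifyHom (n : Type) [Fintype n] [DecidableEq n] :
    unitaryGroup n ℂ →* unitaryGroup (n ⊕ n) ℝ where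
  toFun g := ⟨fromBlocks (g.1.map Complex.re) (-(g.1.map Complex.im))
      (g.1.map Complex.im) (g.1.map Complex.re), by
    rw [mem_unitaryGroup_iff]
    have h := mem_unitaryGroup_iff.1 g.2
    have hre : ∀ i j, ∑ k, ((g.1 i k).re * (g.1 j k).re + (g.1 i k).im * (g.1 j k).im)
        = (1 : Matrix n n ℝ) i j := by
      intro i j
      have := congrArg Complex.re (congrFun (congrFun h i) j)
      simp only [mul_apply, star_apply, Complex.re_sum] at this
      rw [show ((1 : Matrix n n ℝ) i j) = ((1 : Matrix n n ℂ) i j).re by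
        by_cases hij : i = j <;> simp [one_apply, hij], ← this]
      refine Finset.sum_congr rfl fun k _ => ?_
      simp
    have him : ∀ i j, ∑ k, ((g.1 i k).im * (g.1 j k).re - (g.1 i k).re * (g.1 j k).im) = 0 := by
      intro i j
      have := congrArg Complex.im (congrFun (congrFun h i) j)
      simp only [mul_apply, star_apply, Complex.im_sum] at this
      rw [show (0 : ℝ) = ((1 : Matrix n n ℂ) i j).im by
        by_cases hij : i = j <;> simp [one_apply, hij], ← this]
      refine Finset.sum_congr rfl fun k _ => ?_
      simp; ring
    rw [star_eq_conjTranspose, fromBlocks_conjTranspose, fromBlocks_multiply,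
      ← fromBlocks_one]
    congr 1 <;> ext i j
    · rw [← hre i j]
      simp [mul_apply, Finset.sum_add_distrib]
    · rw [Matrix.zero_apply, ← him j i]
      simp [mul_apply, Finset.sum_add_distrib, mul_comm, sub_eq_add_neg, add_comm]
    · rw [Matrix.zero_apply, ← him i j]
      simp [mul_apply, Finset.sum_sub_distrib]
      ring
    · rw [← hre i j]
      simp [mul_apply, Finset.sum_add_distrib, add_comm]⟩
  map_one' := by
    ext1
    have h0 : (1 : Matrix n n ℂ).map Complex.re = 1 := by
      ext i j; by_cases hij : i = j <;> simp [one_apply, hij]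
    have h1 : (1 : Matrix n n ℂ).map Complex.im = 0 := by
      ext i j; by_cases hij : i = j <;> simp [one_apply, hij]
    simp [h0, h1]
  map_mul' g h := by
    ext1
    simp only [Submonoid.coe_mul, fromBlocks_multiply]
    congr 1 <;> ext i j <;>
      simp [mul_apply, Finset.sum_add_distrib, sub_eq_add_neg,
        add_comm]

/-- `g ↦ (gᵀ)⁻¹` on `U(n)`. -/
def transposeInvHom (n : Type) [Fintype n] [DecidableEq n] :
    unitaryGroup n ℂ →* unitaryGroup n ℂ where
  toFun g := (UnitaryGroup.transpose g)⁻¹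
  map_one' := by rw [inv_eq_one]; apply Subtype.ext; simp
  map_mul' g h := by
    rw [← _root_.mul_inv_rev]
    congr 1
    apply Subtype.ext
    simp

/-- `g ↦ P g P⁻¹`. -/
def conjByHom {n : Type} [Fintype n] [DecidableEq n] {𝕜 : Type} [RCLike 𝕜]
    (P : unitaryGroup n 𝕜) : unitaryGroup n 𝕜 →* unitaryGroup n 𝕜 :=
  (MulAut.conj P).toMonoidHom

/-! ### The structural matrices -/

/-- `J = (0, -1; 1, 0)` (Mathlib's `Matrix.J`) as an element of the unitary group. -/
def unitaryJ (n : Type) [Fintype n] [DecidableEq n] (𝕜 : Type) [RCLike 𝕜] :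
    unitaryGroup (n ⊕ n) 𝕜 :=
  ⟨J n 𝕜, by
    rw [mem_unitaryGroup_iff]
    simp [J, star_eq_conjTranspose, fromBlocks_conjTranspose, fromBlocks_multiply]⟩

/-- `I' = diag(1_m, -1_n)`. -/
def signMatrix (m n : Type) [Fintype m] [DecidableEq m] [Fintype n] [DecidableEq n]
    (𝕜 : Type) [RCLike 𝕜] : unitaryGroup (m ⊕ n) 𝕜 :=
  ⟨fromBlocks 1 0 0 (-1), by
    rw [mem_unitaryGroup_iff]
    simp [star_eq_conjTranspose, fromBlocks_conjTranspose, fromBlocks_multiply]⟩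

/-- `diag(I', I')` with `I' = diag(1_m, -1_n)`. -/
def doubleSignMatrix (m n : Type) [Fintype m] [DecidableEq m] [Fintype n] [DecidableEq n] :
    unitaryGroup ((m ⊕ n) ⊕ (m ⊕ n)) ℂ :=
  blockDiagHom (m ⊕ n) (m ⊕ n) ℂ (signMatrix m n ℂ, signMatrix m n ℂ)

/-- `(0, -I'; I', 0)` with `I' = diag(1_m, -1_n)`: it is the orthogonal sum of the form `J` on the
two copies of `m` and the form `-J` on the two copies of `n`. -/
def twistedJ (m n : Type) [Fintype m] [DecidableEq m] [Fintype n] [DecidableEq n] :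
    Matrix ((m ⊕ n) ⊕ (m ⊕ n)) ((m ⊕ n) ⊕ (m ⊕ n)) ℂ :=
  fromBlocks 0 (-(signMatrix m n ℂ).1) (signMatrix m n ℂ).1 0

/-! ### The groups -/

/-- The compact symplectic group of the form `B`: all unitary `g` with `g B gᵀ = B`. -/
def compactSymplectic {n : Type} [Fintype n] [DecidableEq n] (B : Matrix n n ℂ) :
    Subgroup (unitaryGroup n ℂ) where
  carrier := {g | g.1 * B * g.1ᵀ = B}
  one_mem' := by simp
  mul_mem' {g h} hg hh := by
    change g.1 * B * g.1ᵀ = B at hg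
    change h.1 * B * h.1ᵀ = B at hh
    change (g.1 * h.1) * B * (g.1 * h.1)ᵀ = B
    calc (g.1 * h.1) * B * (g.1 * h.1)ᵀ = g.1 * (h.1 * B * h.1ᵀ) * g.1ᵀ := by
          simp only [transpose_mul, Matrix.mul_assoc]
      _ = B := by rw [hh, hg]
  inv_mem' {g} hg := by
    change g.1 * B * g.1ᵀ = B at hg
    change (g⁻¹).1 * B * (g⁻¹).1ᵀ = B
    have h1 : (g⁻¹).1 * g.1 = 1 := congrArg Subtype.val (inv_mul_cancel g)
    calc (g⁻¹).1 * B * (g⁻¹).1ᵀ = (g⁻¹).1 * (g.1 * B * g.1ᵀ) * (g⁻¹).1ᵀ := by rw [hg]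
      _ = ((g⁻¹).1 * g.1) * B * ((g⁻¹).1 * g.1)ᵀ := by
          simp only [transpose_mul, Matrix.mul_assoc]
      _ = B := by rw [h1]; simp

/-- `SO(n)` as a subgroup of `O(n)`. -/
def properRotations (n : Type) [Fintype n] [DecidableEq n] : Subgroup (unitaryGroup n ℝ) :=
  (detMonoidHom.comp (unitaryGroup n ℝ).subtype).ker

/-- `USp(2m) × USp(2n)`, the first factor acting on the two copies of `m` and the second one on the
two copies of `n`. -/
def symplecticProduct (m n : Type) [Fintype m] [DecidableEq m] [Fintype n] [DecidableEq n] :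
    Subgroup (unitaryGroup ((m ⊕ n) ⊕ (m ⊕ n)) ℂ) :=
  ((compactSymplectic (J m ℂ)).prod (compactSymplectic (J n ℂ))).map
    ((reindexHom ℂ (Equiv.sumSumSumComm m m n n)).comp (blockDiagHom (m ⊕ m) (n ⊕ n) ℂ))

/-! ### The matrix ensembles -/

/-- The matrix is Hermitian with `p` positive and `q` negative eigenvalues, counted with
multiplicity. -/
def HasSignature {n : Type} [Fintype n] [DecidableEq n] {𝕜 : Type} [RCLike 𝕜]
    (G : Matrix n n 𝕜) (p q : ℕ) : Prop :=
  ∃ h : G.IsHermitian,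
    (Finset.univ.filter fun i => 0 < h.eigenvalues i).card = p ∧
    (Finset.univ.filter fun i => h.eigenvalues i < 0).card = q

/-- Symmetric unitary matrices. -/
def ensembleAI (n : Type) [Fintype n] [DecidableEq n] : Set (Matrix n n ℂ) :=
  {H | H ∈ unitaryGroup n ℂ ∧ Hᵀ = H}

/-- Self-dual unitary matrices; the dual of `H` is `J Hᵀ Jᵀ`. -/
def ensembleAII (n : Type) [Fintype n] [DecidableEq n] : Set (Matrix (n ⊕ n) (n ⊕ n) ℂ) :=
  {H | H ∈ unitaryGroup (n ⊕ n) ℂ ∧ J n ℂ * Hᵀ * (J n ℂ)ᵀ = H}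

/-- Matrices `G I'` with `G` unitary and Hermitian of signature `(|m|, |n|)`; for `𝕜 = ℝ` this says
that `G` is orthogonal and symmetric. -/
def ensembleGrassmann (m n : Type) [Fintype m] [DecidableEq m] [Fintype n] [DecidableEq n]
    (𝕜 : Type) [RCLike 𝕜] : Set (Matrix (m ⊕ n) (m ⊕ n) 𝕜) :=
  {H | ∃ G ∈ unitaryGroup (m ⊕ n) 𝕜,
    HasSignature G (Fintype.card m) (Fintype.card n) ∧ H = G * (signMatrix m n 𝕜).1}

/-- A matrix is dexter if a proper orthogonal change of basis takes it to `+J`. -/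
def IsDexter {n : Type} [Fintype n] [DecidableEq n] (G : Matrix (n ⊕ n) (n ⊕ n) ℝ) : Prop :=
  ∃ p ∈ properRotations (n ⊕ n), p.1 * G * (p⁻¹).1 = J n ℝ

/-- Matrices `H` in `SO(2n)` such that `HJ` is dexter antisymmetric. -/
def ensembleDIII (n : Type) [Fintype n] [DecidableEq n] : Set (Matrix (n ⊕ n) (n ⊕ n) ℝ) :=
  {H | H ∈ specialOrthogonalGroup (n ⊕ n) ℝ ∧ (H * J n ℝ)ᵀ = -(H * J n ℝ) ∧
    IsDexter (H * J n ℝ)}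

/-- Matrices `G I'` with `G` unitary and Hermitian and `J G = -conj(G) J`. -/
def ensembleCI (n : Type) [Fintype n] [DecidableEq n] : Set (Matrix (n ⊕ n) (n ⊕ n) ℂ) :=
  {H | ∃ G ∈ unitaryGroup (n ⊕ n) ℂ,
    G.IsHermitian ∧ J n ℂ * G = -(G.map (starRingEnd ℂ)) * J n ℂ ∧
      H = G * (signMatrix n n ℂ).1}

/-- Matrices `G diag(I', I')` with `G` compact symplectic and Hermitian of quaternionic signature
`(|m|, |n|)`, i.e. of signature `(2|m|, 2|n|)`. -/
def ensembleCII (m n : Type) [Fintype m] [DecidableEq m] [Fintype n] [DecidableEq n] :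
    Set (Matrix ((m ⊕ n) ⊕ (m ⊕ n)) ((m ⊕ n) ⊕ (m ⊕ n)) ℂ) :=
  {H | ∃ G ∈ compactSymplectic (twistedJ m n),
    HasSignature G.1 (2 * Fintype.card m) (2 * Fintype.card n) ∧
      H = G.1 * (doubleSignMatrix m n).1}

/-! ### The tori -/

/-- `(Re Λ, -Im Λ; Im Λ, Re Λ)` for `Λ = diag(l₁, …, l_R)`. -/
def rotationMatrix (𝕜 : Type) [RCLike 𝕜] {R : ℕ} (l : Fin R → Circle) :
    Matrix (Fin R ⊕ Fin R) (Fin R ⊕ Fin R) 𝕜 :=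
  fromBlocks (diagonal fun j => (((l j : ℂ).re : ℝ) : 𝕜))
    (-diagonal fun j => (((l j : ℂ).im : ℝ) : 𝕜))
    (diagonal fun j => (((l j : ℂ).im : ℝ) : 𝕜))
    (diagonal fun j => (((l j : ℂ).re : ℝ) : 𝕜))

/-- `diag(1_L, rotationMatrix Λ)`. -/
def paddedRotation (𝕜 : Type) [RCLike 𝕜] (L : ℕ) {R : ℕ} (l : Fin R → Circle) :
    Matrix (Fin L ⊕ (Fin R ⊕ Fin R)) (Fin L ⊕ (Fin R ⊕ Fin R)) 𝕜 :=
  fromBlocks 1 0 0 (rotationMatrix 𝕜 l)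

/-- `diag(1_L, rotationMatrix Λ)`, the rows and columns grouped as `(L + R) + R`. -/
def groupedRotation (𝕜 : Type) [RCLike 𝕜] (L : ℕ) {R : ℕ} (l : Fin R → Circle) :
    Matrix ((Fin L ⊕ Fin R) ⊕ Fin R) ((Fin L ⊕ Fin R) ⊕ Fin R) 𝕜 :=
  reindex (Equiv.sumAssoc (Fin L) (Fin R) (Fin R)).symm
    (Equiv.sumAssoc (Fin L) (Fin R) (Fin R)).symm (paddedRotation 𝕜 L l)

def torusAI (N : ℕ) : Set (Matrix (Fin N) (Fin N) ℂ) :=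
  Set.range fun l : Fin N → Circle => diagonal fun j => (l j : ℂ)

def torusAII (N : ℕ) : Set (Matrix (Fin N ⊕ Fin N) (Fin N ⊕ Fin N) ℂ) :=
  Set.range fun l : Fin N → Circle =>
    fromBlocks (diagonal fun j => (l j : ℂ)) 0 0 (diagonal fun j => (l j : ℂ))

def torusGrassmann (𝕜 : Type) [RCLike 𝕜] (L R : ℕ) :
    Set (Matrix ((Fin L ⊕ Fin R) ⊕ Fin R) ((Fin L ⊕ Fin R) ⊕ Fin R) 𝕜) :=
  Set.range fun l : Fin R → Circle => groupedRotation 𝕜 L l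

def torusDIII (e R : ℕ) :
    Set (Matrix ((Fin e ⊕ (Fin R ⊕ Fin R)) ⊕ (Fin e ⊕ (Fin R ⊕ Fin R)))
      ((Fin e ⊕ (Fin R ⊕ Fin R)) ⊕ (Fin e ⊕ (Fin R ⊕ Fin R))) ℝ) :=
  Set.range fun l : Fin R → Circle =>
    fromBlocks (paddedRotation ℝ e l) 0 0 (paddedRotation ℝ e l⁻¹)

def torusCI (N : ℕ) : Set (Matrix (Fin N ⊕ Fin N) (Fin N ⊕ Fin N) ℂ) :=
  Set.range fun l : Fin N → Circle => rotationMatrix ℂ l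

def torusCII (L R : ℕ) :
    Set (Matrix (((Fin L ⊕ Fin R) ⊕ Fin R) ⊕ ((Fin L ⊕ Fin R) ⊕ Fin R))
      (((Fin L ⊕ Fin R) ⊕ Fin R) ⊕ ((Fin L ⊕ Fin R) ⊕ Fin R)) ℂ) :=
  Set.range fun l : Fin R → Circle =>
    fromBlocks (groupedRotation ℂ L l) 0 0 (groupedRotation ℂ L l⁻¹)

/-! ### Submanifolds, eigenvalues, the tangent space of the symmetric space -/

/-- `S` is an embedded smooth submanifold of `G`, where `G` is itself a subset of the normed
space `E`: around each point of `S` there is a smooth chart of `E` in which `G` and `S` become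
nested linear subspaces `V ≤ W`, of dimensions that do not depend on the point. -/
def IsSmoothSubmanifoldOf {E : Type} [NormedAddCommGroup E] [NormedSpace ℝ E]
    (S G : Set E) : Prop :=
  S ⊆ G ∧ ∃ V W : Submodule ℝ E, V ≤ W ∧ ∀ x ∈ S, ∃ f : OpenPartialHomeomorph E E,
    x ∈ f.source ∧ ContDiffOn ℝ ∞ f f.source ∧ ContDiffOn ℝ ∞ f.symm f.target ∧
    f '' (f.source ∩ G) = f.target ∩ (W : Set E) ∧
    f '' (f.source ∩ S) = f.target ∩ (V : Set E)

section MatrixNorm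

attribute [local instance] Matrix.linftyOpNormedAddCommGroup Matrix.linftyOpNormedSpace

/-- `IsSmoothSubmanifoldOf` for sets of matrices (the choice of the norm is immaterial). -/
def IsSmoothMatrixSubmanifoldOf {n : Type} [Fintype n] {𝕜 : Type} [RCLike 𝕜]
    (S G : Set (Matrix n n 𝕜)) : Prop :=
  IsSmoothSubmanifoldOf S G

end MatrixNorm

/-- The complex eigenvalues of a square matrix, with multiplicities. -/
def complexEigenvalues {n : Type} [Fintype n] [DecidableEq n] {𝕜 : Type} [RCLike 𝕜]
    [Algebra 𝕜 ℂ] (H : Matrix n n 𝕜) : Multiset ℂ :=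
  H.charpoly.aroots ℂ

/-- The set `𝔭`: the `X` in the Lie algebra of `G` on which the differential of `Ω` is `-1`, i.e.
`exp(tX) ∈ G` and `Ω(exp(tX)) = exp(tX)⁻¹` for all real `t`. -/
def symmetricTangent {n : Type} [Fintype n] [DecidableEq n] {𝕜 : Type} [RCLike 𝕜]
    (G : Subgroup (unitaryGroup n 𝕜)) (Ω : unitaryGroup n 𝕜 →* unitaryGroup n 𝕜) :
    Set (Matrix n n 𝕜) :=
  {X | ∀ t : ℝ, ∃ g ∈ G, g.1 = NormedSpace.exp (t • X) ∧ Ω g = g⁻¹}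

/-- `𝔞` is a maximal abelian subspace of `𝔭`. -/
def IsMaximalAbelianIn {n : Type} [Fintype n] {𝕜 : Type} [RCLike 𝕜]
    (𝔞 : Submodule ℝ (Matrix n n 𝕜)) (𝔭 : Set (Matrix n n 𝕜)) : Prop :=
  (𝔞 : Set (Matrix n n 𝕜)) ⊆ 𝔭 ∧ (∀ X ∈ 𝔞, ∀ Y ∈ 𝔞, Commute X Y) ∧
    ∀ Z ∈ 𝔭, (∀ X ∈ 𝔞, Commute X Z) → Z ∈ 𝔞

/-- The symmetric space `G/K` of the involution `Ω` is realized as the matrix ensemble `S`, with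
torus `A` of dimension `R`, through `g ↦ g Ω(g)⁻¹`. -/
structure IsMatrixRealization {n : Type} [Fintype n] [DecidableEq n] {𝕜 : Type} [RCLike 𝕜]
    [Algebra 𝕜 ℂ] (G K : Subgroup (unitaryGroup n 𝕜))
    (Ω : unitaryGroup n 𝕜 →* unitaryGroup n 𝕜) (S A : Set (Matrix n n 𝕜)) (R : ℕ) : Prop where
  /-- `Ω` restricts to an involutive automorphism of `G`. -/
  map_mem : ∀ g ∈ G, Ω g ∈ G
  involutive : ∀ g ∈ G, Ω (Ω g) = g
  /-- `K` is exactly the fixed-point set of `Ω` in `G`. -/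
  fixed : ∀ g, g ∈ K ↔ g ∈ G ∧ Ω g = g
  /-- `S` is a submanifold of `G`. -/
  submanifold : IsSmoothMatrixSubmanifoldOf S (Subtype.val '' (G : Set (unitaryGroup n 𝕜)))
  /-- `A` is a torus of dimension `R`. -/
  torus : ∃ τ : (Fin R → Circle) →* unitaryGroup n 𝕜,
    Continuous τ ∧ Function.Injective τ ∧ (Set.range fun l => (τ l).1) = A
  /-- `A` is the exponential of a maximal abelian subspace of `𝔭`, of dimension `R`. -/
  maximal_flat : ∃ 𝔞 : Submodule ℝ (Matrix n n 𝕜),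
    IsMaximalAbelianIn 𝔞 (symmetricTangent G Ω) ∧ Module.finrank ℝ 𝔞 = R ∧
      (fun X => NormedSpace.exp X) '' (𝔞 : Set (Matrix n n 𝕜)) = A
  /-- The map `gK ↦ g Ω(g)⁻¹` is a well-defined bijection of `G/K` onto `S`, and
  a homeomorphism (`IsEmbedding` includes injectivity); it maps `AK/K` onto
  `A` and turns left translation by `k ∈ K` into conjugation by `k`. -/
  realization : ∃ φ : G ⧸ K.subgroupOf G → Matrix n n 𝕜,
    (∀ g : G, φ (QuotientGroup.mk g) = (g.1 * (Ω g.1)⁻¹).1) ∧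
    Topology.IsEmbedding φ ∧ Set.range φ = S ∧
    φ '' (QuotientGroup.mk '' {g : G | g.1.1 ∈ A}) = A ∧
    ∀ k : G, k.1 ∈ K → ∀ x, φ (k • x) = k.1.1 * φ x * (k.1⁻¹).1
  /-- Every element of `S` is `K`-conjugate to an element of `A`. -/
  conj_torus : ∀ H ∈ S, ∃ k ∈ K, ∃ a ∈ A, k.1 * H * (k⁻¹).1 = a
  /-- Elements of `A` are `K`-conjugate if and only if they have the same eigenvalues. -/
  conj_iff : ∀ a ∈ A, ∀ b ∈ A,
    (∃ k ∈ K, k.1 * a * (k⁻¹).1 = b) ↔ complexEigenvalues a = complexEigenvalues b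

end

/-! All seven families are instances of one argument, `LinearInvolution.isMatrixRealization`. In
each of them Ω extends to a real *-automorphism θ of the matrix algebra, which preserves a real
*-subalgebra L whose unitary group agrees with G near 1 (`LinearInvolution`). Then 𝔭 is the space
`oddSkew` of skew X in L with θ X = -X. The torus is the image of a *-homomorphism T on which θ is
the adjoint, and some D in its Lie algebra has no centralizer in 𝔭 beyond the flat 𝔞
(`RegularTorus`). This D alone gives maximality of 𝔞.

Conjugacy in 𝔭 (`exists_conj_flat`): for X in 𝔭, maximize Re tr(k X k⁻¹ D) over the compact group K.
At a maximum the commutator W = [k X k⁻¹, D] lies in Lie(K), and the derivative in the direction W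
is Re tr(W²) = -‖W‖², so W = 0 and k X k⁻¹ lies in 𝔞.

Conjugacy in S (`exists_conj_torus`): the Cayley transform is rational, commutes with conjugation
and with θ, and matches 𝔭 with those H that satisfy Ω(H) = H⁻¹ and do not have the eigenvalue -1. It
maps 𝔞 into A, so such H in S are conjugate into A. The set of matrices conjugate into A is closed,
and every H in S with eigenvalue -1 is a limit of elements of S for which -1 has smaller
multiplicity; induction on the multiplicity finishes.

The rest follows formally. A torus element is a square m² = m Ω(m)⁻¹, so g ↦ g Ω(g)⁻¹ is onto S; its
fibres are the cosets of K; a continuous injection from a compact space is an embedding. Near 1 the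
Cayley transform straightens G and S to linear subspaces, and twisted conjugations carry this chart
to every point of S.

What depends on the family is the limit statement, the regular element and the Weyl group. For A I
and A II the limit is e^{is}H. Otherwise H is moved by a rotation whose generator X in 𝔭 satisfies
X³ = -X and H X = -X (`mem_closure_of_generator`). For the ensembles F I' such an X is built from
eigenvectors of I' of both signs inside the -1 eigenspace of F I'; they exist because F and I' are
involutions of equal trace (`exists_eigenvectors_of_involutions`), which is what the signature
condition means. In D III the dexter condition supplies the missing eigenvectors through the sign of
a determinant (`exists_orthogonal_eigenvector_DIII`). Equal eigenvalues force the angles to agree up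
to a permutation (A I, A II) or up to a permutation and signs (`exists_signed_perm`), and monomial
matrices in K realize both. -/

noncomputable section

/-! ### The Cayley transform -/

section Cayley

variable {A : Type*} [Ring A]

/-- `(1 + Z) (1 - Z)⁻¹`. -/
def cayley (Z : A) : A := (1 + Z) * Ring.inverse (1 - Z)

/-- `(Y - 1) (Y + 1)⁻¹`. -/
def cayleyInv (Y : A) : A := (Y - 1) * Ring.inverse (Y + 1)

theorem cayley_mul {Z : A} (h : IsUnit (1 - Z)) : cayley Z * (1 - Z) = 1 + Z := by
  rw [cayley, mul_assoc, Ring.inverse_mul_cancel _ h, mul_one]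

theorem cayleyInv_mul {Y : A} (h : IsUnit (Y + 1)) : cayleyInv Y * (Y + 1) = Y - 1 := by
  rw [cayleyInv, mul_assoc, Ring.inverse_mul_cancel _ h, mul_one]

theorem mul_cayleyInv {Y : A} (h : IsUnit (Y + 1)) : (Y + 1) * cayleyInv Y = Y - 1 := by
  rw [← h.mul_left_inj, mul_assoc, cayleyInv_mul h]
  noncomm_ring

variable [Algebra ℝ A]

variable (A) in
theorem isUnit_two_of_algebra : IsUnit (2 : A) := by
  rw [← map_ofNat (algebraMap ℝ A) 2]
  exact (IsUnit.mk0 (2 : ℝ) two_ne_zero).map _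

theorem isUnit_cayley_add_one {Z : A} (h : IsUnit (1 - Z)) : IsUnit (cayley Z + 1) := by
  have h1 : (cayley Z + 1) * (1 - Z) = 2 := by
    rw [add_mul, cayley_mul h]; noncomm_ring; simp
  obtain ⟨u, hu⟩ := h
  rw [← hu, ← Units.eq_mul_inv_iff_mul_eq] at h1
  rw [h1]
  exact (isUnit_two_of_algebra A).mul (Units.isUnit _)

theorem isUnit_one_sub_cayleyInv {Y : A} (h : IsUnit (Y + 1)) :
    IsUnit (1 - cayleyInv Y) := by
  have h1 : (1 - cayleyInv Y) * (Y + 1) = 2 := by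
    rw [sub_mul, cayleyInv_mul h]; noncomm_ring; simp
  obtain ⟨u, hu⟩ := h
  rw [← hu, ← Units.eq_mul_inv_iff_mul_eq] at h1
  rw [h1]
  exact (isUnit_two_of_algebra A).mul (Units.isUnit _)

-- The denominator-free equation determines the transform. Later identities are checked in this
-- form, so that inverses never have to be expanded.
omit [Algebra ℝ A] in
theorem eq_cayley {Y Z : A} (h : IsUnit (1 - Z)) (hYZ : Y * (1 - Z) = 1 + Z) :
    Y = cayley Z := by
  rw [← h.mul_left_inj, hYZ, cayley_mul h]

omit [Algebra ℝ A] in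
theorem eq_cayleyInv {Y Z : A} (h : IsUnit (Y + 1)) (hYZ : Z * (Y + 1) = Y - 1) :
    Z = cayleyInv Y := by
  rw [← h.mul_left_inj, hYZ, cayleyInv_mul h]

theorem cayley_cayleyInv {Y : A} (h : IsUnit (Y + 1)) : cayley (cayleyInv Y) = Y := by
  refine (eq_cayley (isUnit_one_sub_cayleyInv h) ?_).symm
  have := mul_cayleyInv h
  rw [add_mul, one_mul] at this
  rw [mul_sub, mul_one, ← sub_eq_zero]
  rw [← sub_eq_zero] at this
  rw [← neg_eq_zero, ← this]
  abel

theorem cayleyInv_cayley {Z : A} (h : IsUnit (1 - Z)) : cayleyInv (cayley Z) = Z := by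
  refine (eq_cayleyInv (isUnit_cayley_add_one h) ?_).symm
  have h2 : (cayley Z + 1) * (1 - Z) = 2 := by
    rw [add_mul, cayley_mul h]; noncomm_ring; simp
  rw [← h.mul_left_inj, mul_assoc, h2, sub_mul, cayley_mul h]
  noncomm_ring

variable [StarRing A]

-- After clearing the denominator this rests on (Y* + 1) Y = Y + 1, which is where Y* Y = 1 enters.
omit [Algebra ℝ A] in
theorem star_cayleyInv {Y : A} (hY : star Y * Y = 1) (h : IsUnit (Y + 1)) :
    star (cayleyInv Y) = -cayleyInv Y := by
  have h1 := congrArg star (mul_cayleyInv h)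
  simp only [star_mul, star_add, star_sub, star_one] at h1
  rw [← h.mul_left_inj, neg_mul, cayleyInv_mul h]
  have h2 : (star Y + 1) * Y = Y + 1 := by rw [add_mul, hY, one_mul, add_comm]
  rw [← h2, ← mul_assoc, h1, sub_mul, hY, one_mul, neg_sub]

omit [Algebra ℝ A] in
theorem cayley_star_mul {Z : A} (h : star Z = -Z) (hu : IsUnit (1 - Z)) :
    star (cayley Z) * (1 + Z) = 1 - Z := by
  have hu' : IsUnit (1 + Z) := by
    have := hu.star
    rwa [star_sub, star_one, h, sub_neg_eq_add] at this
  have h1 := congrArg star (cayley_mul hu)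
  simp only [star_mul, star_add, star_sub, star_one, h, sub_neg_eq_add] at h1
  rw [← hu'.mul_right_inj, ← mul_assoc, h1]
  noncomm_ring

omit [Algebra ℝ A] in
theorem star_cayley_mul_cayley {Z : A} (h : star Z = -Z) (hu : IsUnit (1 - Z)) :
    star (cayley Z) * cayley Z = 1 := by
  rw [← hu.mul_left_inj, mul_assoc, cayley_mul hu, cayley_star_mul h hu, one_mul]

variable {n : Type} [Fintype n] [DecidableEq n] {𝕜 : Type} [RCLike 𝕜]

-- (1 + Z)(1 - Z) = 1 + Z* Z is positive definite, so its factor 1 - Z is invertible: skew matrices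
-- always lie in the domain of `cayley`.
open scoped ComplexOrder in
theorem isUnit_one_sub_of_star_eq_neg {Z : Matrix n n 𝕜} (h : star Z = -Z) : IsUnit (1 - Z) := by
  have h1 : (1 + Z) * (1 - Z) = 1 + Zᴴ * Z := by
    rw [← star_eq_conjTranspose, h]; noncomm_ring
  have h2 : (1 + Zᴴ * Z).PosDef :=
    PosDef.one.add_posSemidef (posSemidef_conjTranspose_mul_self Z)
  have h3 := (isUnit_iff_isUnit_det _).1 h2.isUnit
  rw [← h1, det_mul] at h3
  exact (isUnit_iff_isUnit_det _).2 (isUnit_of_mul_isUnit_right h3)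

theorem cayley_mem_unitaryGroup {Z : Matrix n n 𝕜} (h : star Z = -Z) :
    cayley Z ∈ unitaryGroup n 𝕜 :=
  mem_unitaryGroup_iff'.2 (star_cayley_mul_cayley h (isUnit_one_sub_of_star_eq_neg h))

end Cayley

/-! ### Compactness of the unitary groups -/

section Compact

variable {n : Type} [Fintype n] [DecidableEq n] {𝕜 : Type} [RCLike 𝕜]

/-- The set is closed, and the entries of a unitary matrix have norm at most 1. -/
theorem isCompact_coe_unitaryGroup : IsCompact (unitaryGroup n 𝕜 : Set (Matrix n n 𝕜)) := by
  refine IsCompact.of_isClosed_subset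
    (isCompact_univ_pi fun _ : n => isCompact_univ_pi fun _ : n =>
      isCompact_closedBall (0 : 𝕜) 1) ?_ ?_
  · have : (unitaryGroup n 𝕜 : Set (Matrix n n 𝕜)) = {U | U * star U = 1} := by
      ext U; exact mem_unitaryGroup_iff
    rw [this]
    exact isClosed_eq (by fun_prop) continuous_const
  · intro U hU i _ j _
    simpa using entry_norm_bound_of_unitary hU i j

instance compactSpace_unitaryGroup : CompactSpace (unitaryGroup n 𝕜) :=
  isCompact_iff_compactSpace.1 isCompact_coe_unitaryGroup

end Compact
end

noncomputable section

/-! ### Involutions that extend linearly -/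

section LinearInvolution

variable {n : Type} [Fintype n] [DecidableEq n] {𝕜 : Type} [RCLike 𝕜]

/-- `G` is locally the unitary group of the real matrix `*`-algebra `L`, and `Ω` is the restriction
of the involutive real `*`-automorphism `θ`. -/
structure LinearInvolution (G : Subgroup (unitaryGroup n 𝕜))
    (Ω : unitaryGroup n 𝕜 →* unitaryGroup n 𝕜) (L : StarSubalgebra ℝ (Matrix n n 𝕜))
    (θ : Matrix n n 𝕜 →⋆ₐ[ℝ] Matrix n n 𝕜) : Prop where
  coe_map : ∀ g, (Ω g).1 = θ g.1
  involutive : ∀ x, θ (θ x) = x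
  algebra_map_mem : ∀ x ∈ L, θ x ∈ L
  inv_mem : ∀ x ∈ L, x⁻¹ ∈ L
  coe_mem : ∀ g ∈ G, g.1 ∈ L
  isClosed : IsClosed (G : Set (unitaryGroup n 𝕜))
  nhds_one : ∃ U : Set (Matrix n n 𝕜), IsOpen U ∧ 1 ∈ U ∧
    ∀ g : unitaryGroup n 𝕜, g.1 ∈ U → g.1 ∈ L → g ∈ G
  map_mem : ∀ g ∈ G, Ω g ∈ G

/-- The skew elements of `L` on which `θ` is `-1`. -/
def oddSkew (L : StarSubalgebra ℝ (Matrix n n 𝕜)) (θ : Matrix n n 𝕜 →⋆ₐ[ℝ] Matrix n n 𝕜) :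
    Submodule ℝ (Matrix n n 𝕜) where
  carrier := {Z | Z ∈ L ∧ star Z = -Z ∧ θ Z = -Z}
  add_mem' := by
    rintro a b ⟨h1, h2, h3⟩ ⟨h4, h5, h6⟩
    exact ⟨add_mem h1 h4, by rw [star_add, h2, h5, neg_add], by rw [map_add, h3, h6, neg_add]⟩
  zero_mem' := ⟨zero_mem _, by simp, by simp⟩
  smul_mem' := by
    rintro c a ⟨h1, h2, h3⟩
    exact ⟨L.toSubalgebra.smul_mem h1 c, by rw [star_smul, h2, star_trivial, smul_neg],
      by rw [map_smul, h3, smul_neg]⟩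

/-- The skew elements of `L`. -/
def skewPart (L : StarSubalgebra ℝ (Matrix n n 𝕜)) : Submodule ℝ (Matrix n n 𝕜) where
  carrier := {Z | Z ∈ L ∧ star Z = -Z}
  add_mem' := by
    rintro a b ⟨h1, h2⟩ ⟨h4, h5⟩
    exact ⟨add_mem h1 h4, by rw [star_add, h2, h5, neg_add]⟩
  zero_mem' := ⟨zero_mem _, by simp⟩
  smul_mem' := by
    rintro c a ⟨h1, h2⟩
    exact ⟨L.toSubalgebra.smul_mem h1 c, by rw [star_smul, h2, star_trivial, smul_neg]⟩

theorem isClosed_starSubalgebra (L : StarSubalgebra ℝ (Matrix n n 𝕜)) :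
    IsClosed (L : Set (Matrix n n 𝕜)) :=
  haveI : FiniteDimensional ℝ (Matrix n n 𝕜) := FiniteDimensional.trans ℝ 𝕜 (Matrix n n 𝕜)
  Submodule.closed_of_finiteDimensional (Subalgebra.toSubmodule L.toSubalgebra)

omit [DecidableEq n] in
theorem continuous_linearMap_matrix {E : Type*} [AddCommGroup E] [Module ℝ E] [TopologicalSpace E]
    [IsTopologicalAddGroup E] [ContinuousSMul ℝ E] (f : Matrix n n 𝕜 →ₗ[ℝ] E) : Continuous f :=
  haveI : FiniteDimensional ℝ (Matrix n n 𝕜) := FiniteDimensional.trans ℝ 𝕜 (Matrix n n 𝕜)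
  f.continuous_of_finiteDimensional

theorem continuous_starAlgHom_matrix (θ : Matrix n n 𝕜 →⋆ₐ[ℝ] Matrix n n 𝕜) : Continuous θ :=
  continuous_linearMap_matrix θ.toAlgHom.toLinearMap

theorem continuous_exp_smul (W : Matrix n n 𝕜) :
    Continuous (fun t : ℝ => NormedSpace.exp (t • W)) :=
  open scoped Matrix.Norms.Operator in
  continuous_iff_continuousAt.2 fun t => (hasDerivAt_exp_smul_const W t).continuousAt

theorem hasDerivAt_exp_smul_zero {A : Type*} [NormedRing A] [NormedAlgebra ℝ A] [CompleteSpace A]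
    [Algebra ℚ A] (f : A →L[ℝ] ℝ) (W : A) :
    HasDerivAt (fun t : ℝ => f (NormedSpace.exp (t • W))) (f W) 0 := by
  have := f.hasFDerivAt.comp_hasDerivAt (0 : ℝ) (hasDerivAt_exp_smul_const W (0 : ℝ))
  simpa [Function.comp_def] using this

theorem hasDerivAt_exp_conj_zero {A : Type*} [NormedRing A] [NormedAlgebra ℝ A] [CompleteSpace A]
    [Algebra ℚ A] (f : A →L[ℝ] ℝ) (W X : A) :
    HasDerivAt (fun t : ℝ => f (NormedSpace.exp (t • W) * X * NormedSpace.exp (t • (-W))))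
      (f (W * X - X * W)) 0 := by
  have h1 := hasDerivAt_exp_smul_const W (0 : ℝ)
  have h2 := hasDerivAt_exp_smul_const (-W) (0 : ℝ)
  have := f.hasFDerivAt.comp_hasDerivAt (0 : ℝ) ((h1.mul_const X).mul h2)
  simp only [zero_smul, NormedSpace.exp_zero, one_mul, mul_one, mul_neg, ← sub_eq_add_neg] at this
  exact this

theorem hasDerivAt_linearMap_exp_smul (f : Matrix n n 𝕜 →ₗ[ℝ] ℝ) (W : Matrix n n 𝕜) :
    HasDerivAt (fun t : ℝ => f (NormedSpace.exp (t • W))) (f W) 0 :=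
  open scoped Matrix.Norms.Operator in
  hasDerivAt_exp_smul_zero (A := Matrix n n 𝕜) ⟨f, continuous_linearMap_matrix f⟩ W

theorem hasDerivAt_linearMap_exp_conj (f : Matrix n n 𝕜 →ₗ[ℝ] ℝ) (W X : Matrix n n 𝕜) :
    HasDerivAt (fun t : ℝ => f (NormedSpace.exp (t • W) * X * NormedSpace.exp (t • (-W))))
      (f (W * X - X * W)) 0 :=
  open scoped Matrix.Norms.Operator in
  hasDerivAt_exp_conj_zero (A := Matrix n n 𝕜) ⟨f, continuous_linearMap_matrix f⟩ W X

theorem starAlgHom_exp (θ : Matrix n n 𝕜 →⋆ₐ[ℝ] Matrix n n 𝕜) (W : Matrix n n 𝕜) :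
    θ (NormedSpace.exp W) = NormedSpace.exp (θ W) :=
  open scoped Matrix.Norms.Operator in
  NormedSpace.map_exp θ (continuous_starAlgHom_matrix θ) W

theorem star_matrix_exp (W : Matrix n n 𝕜) :
    star (NormedSpace.exp W) = NormedSpace.exp (star W) :=
  (Matrix.exp_conjTranspose W).symm

theorem exp_mem_unitaryGroup {W : Matrix n n 𝕜} (h : star W = -W) :
    NormedSpace.exp W ∈ unitaryGroup n 𝕜 := by
  rw [mem_unitaryGroup_iff, star_matrix_exp, h, Matrix.exp_neg,
    Matrix.mul_nonsing_inv _ ((isUnit_iff_isUnit_det _).1 (Matrix.isUnit_exp W))]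

omit [DecidableEq n] in
theorem eq_of_forall_linearMap_eq {X Y : Matrix n n 𝕜}
    (h : ∀ f : Matrix n n 𝕜 →ₗ[ℝ] ℝ, f X = f Y) : X = Y := by
  rw [← sub_eq_zero, ← Module.forall_dual_apply_eq_zero_iff ℝ]
  intro f
  rw [map_sub, h f, sub_self]

/-- Compare derivatives at 0 through every real linear functional. -/
theorem eq_of_exp_smul_eq {X Y : Matrix n n 𝕜}
    (h : ∀ t : ℝ, NormedSpace.exp (t • X) = NormedSpace.exp (t • Y)) : X = Y := by
  refine eq_of_forall_linearMap_eq fun f => ?_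
  have h1 := hasDerivAt_linearMap_exp_smul f X
  simp only [h] at h1
  exact h1.unique (hasDerivAt_linearMap_exp_smul f Y)

/-- A functional that vanishes on p but not at X would be zero along the curve, while its derivative
at 0 is its value at X. -/
theorem mem_of_exp_smul_mem {p : Submodule ℝ (Matrix n n 𝕜)} {X : Matrix n n 𝕜}
    (h : ∀ t : ℝ, NormedSpace.exp (t • X) ∈ p) : X ∈ p := by
  by_contra hX
  obtain ⟨f, hf, hp⟩ := Submodule.exists_dual_map_eq_bot_of_notMem hX inferInstance
  have h1 := hasDerivAt_linearMap_exp_smul f X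
  have h2 : ∀ t : ℝ, f (NormedSpace.exp (t • X)) = 0 := fun t => by
    have : f (NormedSpace.exp (t • X)) ∈ p.map f := ⟨_, h t, rfl⟩
    rw [hp] at this
    simpa using this
  simp only [h2] at h1
  exact hf (h1.unique (hasDerivAt_const _ _))

namespace LinearInvolution

variable {G : Subgroup (unitaryGroup n 𝕜)} {Ω : unitaryGroup n 𝕜 →* unitaryGroup n 𝕜}
  {L : StarSubalgebra ℝ (Matrix n n 𝕜)} {θ : Matrix n n 𝕜 →⋆ₐ[ℝ] Matrix n n 𝕜}

/-- `nhds_one` detects membership only near 1. For large m the element exp(W/(m+1)) is close enough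
to 1, and its (m+1)-st power is exp W. -/
theorem exp_mem (hL : LinearInvolution G Ω L θ) {W : Matrix n n 𝕜} (hW : W ∈ skewPart L) :
    (⟨NormedSpace.exp W, exp_mem_unitaryGroup hW.2⟩ : unitaryGroup n 𝕜) ∈ G := by
  obtain ⟨U, hU, h1U, hUG⟩ := hL.nhds_one
  have hlim : Filter.Tendsto (fun m : ℕ => NormedSpace.exp ((((m : ℝ) + 1)⁻¹) • W))
      Filter.atTop (nhds 1) := by
    have h0 : Filter.Tendsto (fun m : ℕ => ((m : ℝ) + 1)⁻¹) Filter.atTop (nhds 0) := by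
      simpa using tendsto_one_div_add_atTop_nhds_zero_nat (𝕜 := ℝ)
    have := ((continuous_exp_smul W).tendsto 0).comp h0
    rw [zero_smul, NormedSpace.exp_zero] at this
    exact this
  obtain ⟨m, hm⟩ := (hlim.eventually (hU.mem_nhds h1U)).exists
  have hsk : (((m : ℝ) + 1)⁻¹) • W ∈ skewPart L := (skewPart L).smul_mem _ hW
  have hg := hUG ⟨_, exp_mem_unitaryGroup hsk.2⟩ hm
    (NormedSpace.exp_mem (R := ℝ) (isClosed_starSubalgebra L) hsk.1)
  have hp := G.pow_mem hg (m + 1)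
  convert hp using 1
  apply Subtype.ext
  rw [SubmonoidClass.coe_pow]
  dsimp only
  rw [← Matrix.exp_nsmul, ← Nat.cast_smul_eq_nsmul ℝ, smul_smul]
  push_cast
  rw [mul_inv_cancel₀ (by positivity), one_smul]

/-- Differentiating t ↦ exp(tX) at 0 turns membership in L, unitarity and inversion by Ω into linear
conditions on X; exponentiation goes back. -/
theorem symmetricTangent_eq (hL : LinearInvolution G Ω L θ) :
    symmetricTangent G Ω = oddSkew L θ := by
  ext X
  constructor
  · intro hX
    have h1 : ∀ t : ℝ, NormedSpace.exp (t • (-X)) = star (NormedSpace.exp (t • X)) := fun t => by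
      obtain ⟨g, hg, h2, _⟩ := hX t
      have h4 := mem_unitaryGroup_iff'.1 g.2
      rw [h2] at h4
      rw [smul_neg, Matrix.exp_neg]
      exact Matrix.inv_eq_left_inv h4
    refine ⟨?_, ?_, ?_⟩
    · refine mem_of_exp_smul_mem (p := Subalgebra.toSubmodule L.toSubalgebra) fun t => ?_
      obtain ⟨g, hg, h2, _⟩ := hX t
      rw [← h2]; exact hL.coe_mem g hg
    · refine eq_of_exp_smul_eq fun t => ?_
      rw [h1, star_matrix_exp, star_smul, star_trivial t]
    · refine eq_of_exp_smul_eq fun t => ?_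
      obtain ⟨g, hg, h2, h5⟩ := hX t
      have h6 := hL.coe_map g
      rw [h5, h2, starAlgHom_exp, map_smul] at h6
      rw [← h6, h1, ← h2]
      rfl
  · intro hX t
    have hsk : t • X ∈ skewPart L := (skewPart L).smul_mem _ ⟨hX.1, hX.2.1⟩
    refine ⟨_, hL.exp_mem hsk, rfl, ?_⟩
    apply Subtype.ext
    rw [hL.coe_map]
    change θ (NormedSpace.exp (t • X)) = star (NormedSpace.exp (t • X))
    rw [star_matrix_exp, starAlgHom_exp, map_smul, hX.2.2, star_smul, hX.2.1, star_trivial]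

theorem continuous_map (hL : LinearInvolution G Ω L θ) : Continuous Ω := by
  refine continuous_induced_rng.2 ?_
  have : (Subtype.val ∘ Ω : unitaryGroup n 𝕜 → Matrix n n 𝕜) = fun g => θ g.1 :=
    funext hL.coe_map
  rw [this]
  exact (continuous_starAlgHom_matrix θ).comp continuous_subtype_val

end LinearInvolution
end LinearInvolution
end

noncomputable section

/-! ### A Cayley chart -/

section Chart

variable {A : Type} [NormedRing A] [NormedAlgebra ℝ A] [CompleteSpace A]

theorem contDiffAt_cayley {Z : A} (h : IsUnit (1 - Z)) : ContDiffAt ℝ ∞ (cayley : A → A) Z := by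
  obtain ⟨u, hu⟩ := h
  have h1 : ContDiffAt ℝ ∞ Ring.inverse (1 - Z) := hu ▸ contDiffAt_ringInverse ℝ u
  exact (contDiffAt_const.add contDiffAt_id).mul
    (h1.comp Z (contDiffAt_const.sub contDiffAt_id))

theorem contDiffAt_cayleyInv {Y : A} (h : IsUnit (Y + 1)) :
    ContDiffAt ℝ ∞ (cayleyInv : A → A) Y := by
  obtain ⟨u, hu⟩ := h
  have h1 : ContDiffAt ℝ ∞ Ring.inverse (Y + 1) := hu ▸ contDiffAt_ringInverse ℝ u
  exact (contDiffAt_id.sub contDiffAt_const).mul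
    (h1.comp Y (contDiffAt_id.add contDiffAt_const))

variable (A) in
/-- The Cayley transform as a chart around `1`. -/
def cayleyChart : OpenPartialHomeomorph A A where
  toFun := cayleyInv
  invFun := cayley
  source := {Y | IsUnit (Y + 1)}
  target := {Z | IsUnit (1 - Z)}
  map_source' _ h := isUnit_one_sub_cayleyInv h
  map_target' _ h := isUnit_cayley_add_one h
  left_inv' _ h := cayley_cayleyInv h
  right_inv' _ h := cayleyInv_cayley h
  open_source := Units.isOpen.preimage (continuous_id.add continuous_const)
  open_target := Units.isOpen.preimage (continuous_const.sub continuous_id)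
  continuousOn_toFun _ h := (contDiffAt_cayleyInv h).continuousAt.continuousWithinAt
  continuousOn_invFun _ h := (contDiffAt_cayley h).continuousAt.continuousWithinAt

/-- The homeomorphism `y ↦ p y q`. -/
def mulMulHomeomorph (p q : Aˣ) : A ≃ₜ A where
  toFun y := p * y * q
  invFun y := ↑p⁻¹ * y * ↑q⁻¹
  left_inv y := by simp [mul_assoc]
  right_inv y := by simp [mul_assoc]
  continuous_toFun := by fun_prop
  continuous_invFun := by fun_prop

/-- Sets that the Cayley transform straightens near `1`, and that are homogeneous under two-sided
multiplications, are nested submanifolds. -/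
theorem isSmoothSubmanifoldOf_of_cayley {S G : Set A} {V W : Submodule ℝ A} (hVW : V ≤ W)
    {U : Set A} (hU : IsOpen U) (h1 : 1 ∈ U)
    (hG : ∀ Y ∈ U, IsUnit (Y + 1) → (Y ∈ G ↔ cayleyInv Y ∈ W))
    (hS : ∀ Y ∈ U, IsUnit (Y + 1) → (Y ∈ S ↔ cayleyInv Y ∈ V)) (hSG : S ⊆ G)
    (hom : ∀ x ∈ S, ∃ p q : Aˣ, p * x * q = 1 ∧ (∀ y : A, p * y * q ∈ G ↔ y ∈ G) ∧
      ∀ y : A, p * y * q ∈ S ↔ y ∈ S) : IsSmoothSubmanifoldOf S G := by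
  refine ⟨hSG, V, W, hVW, fun x hx => ?_⟩
  obtain ⟨p, q, hpq, hpG, hpS⟩ := hom x hx
  -- The chart at x first moves x to 1 by the two-sided multiplication, then applies the Cayley
  -- transform restricted to U.
  let f := (mulMulHomeomorph p q).toOpenPartialHomeomorph.trans ((cayleyChart A).restrOpen U hU)
  have hfs : f.source = {y | IsUnit ((p * y * q : A) + 1) ∧ (p * y * q : A) ∈ U} := by
    ext y; simp [f, cayleyChart, mulMulHomeomorph]
  have hft : ∀ z, z ∈ f.target → IsUnit (1 - z) := fun z hz => by
    have : z ∈ ((cayleyChart A).restrOpen U hU).target := hz.1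
    exact this.1
  have hf : ∀ y, f y = cayleyInv (p * y * q : A) := fun y => rfl
  have hfsymm : ∀ z, f.symm z = (↑p⁻¹ * cayley z * ↑q⁻¹ : A) := fun z => rfl
  have himage : ∀ (P : Set A) (Q : Submodule ℝ A), (∀ y : A, p * y * q ∈ P ↔ y ∈ P) →
      (∀ Y ∈ U, IsUnit (Y + 1) → (Y ∈ P ↔ cayleyInv Y ∈ Q)) →
      f '' (f.source ∩ P) = f.target ∩ (Q : Set A) := by
    intro P Q hP hPQ
    ext z
    constructor
    · rintro ⟨y, ⟨hy, hyP⟩, rfl⟩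
      refine ⟨f.map_source hy, ?_⟩
      rw [hfs] at hy
      rw [hf]
      exact (hPQ _ hy.2 hy.1).1 ((hP y).2 hyP)
    · rintro ⟨hz, hzQ⟩
      refine ⟨f.symm z, ⟨f.map_target hz, ?_⟩, f.right_inv hz⟩
      have h2 := f.map_target hz
      rw [hfs] at h2
      rw [← hP]
      refine (hPQ _ h2.2 h2.1).2 ?_
      rw [← hf, f.right_inv hz]
      exact hzQ
  refine ⟨f, ?_, ?_, ?_, himage G W hpG hG, himage S V hpS hS⟩
  · rw [hfs]
    refine ⟨?_, ?_⟩
    · rw [hpq, one_add_one_eq_two]; exact isUnit_two_of_algebra A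
    · rw [hpq]; exact h1
  · intro y hy
    rw [hfs] at hy
    have h3 : ContDiffAt ℝ ∞ (fun y : A => (p * y * q : A)) y :=
      (contDiffAt_const.mul contDiffAt_id).mul contDiffAt_const
    exact (ContDiffAt.comp y (contDiffAt_cayleyInv hy.1) h3).contDiffWithinAt
  · intro z hz
    exact ((contDiffAt_const.mul (contDiffAt_cayley (hft z hz))).mul
      contDiffAt_const).contDiffWithinAt

end Chart
end

noncomputable section

/-! ### Symmetric ensembles and their tori -/

section SymmetricEnsemble

variable {n : Type} [Fintype n] [DecidableEq n] {𝕜 : Type} [RCLike 𝕜]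

/-- The point `i s` of the Lie algebra of the torus. -/
def imagPoint {R : ℕ} (s : Fin R → ℝ) : ℝ × (Fin R → ℂ) := (0, fun j => (s j : ℂ) * Complex.I)

/-- The point `l` of the torus. -/
def circlePoint {R : ℕ} (l : Fin R → Circle) : ℝ × (Fin R → ℂ) := (1, fun j => (l j : ℂ))

/-- `T` parametrizes a torus on which `θ` is inversion and which has a regular element. -/
structure RegularTorus (L : StarSubalgebra ℝ (Matrix n n 𝕜))
    (θ : Matrix n n 𝕜 →⋆ₐ[ℝ] Matrix n n 𝕜) {R : ℕ}
    (T : (ℝ × (Fin R → ℂ)) →⋆ₐ[ℝ] Matrix n n 𝕜) : Prop where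
  mem : ∀ x, T x ∈ L
  map_star : ∀ x, θ (T x) = T (star x)
  eq_zero : ∀ z, T (0, z) = 0 → z = 0
  regular : ∃ t : Fin R → ℝ, ∀ Z ∈ oddSkew L θ, Commute Z (T (imagPoint t)) →
    ∃ s : Fin R → ℝ, Z = T (imagPoint s)

/-- `S` is stable under the twisted conjugations, and its elements with eigenvalue `-1` are
limits of elements for which this eigenvalue has smaller multiplicity. -/
structure SymmetricEnsemble (G : Subgroup (unitaryGroup n 𝕜))
    (Ω : unitaryGroup n 𝕜 →* unitaryGroup n 𝕜) (S : Set (Matrix n n 𝕜)) : Prop where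
  one_mem : 1 ∈ S
  exists_eq : ∀ H ∈ S, ∃ h ∈ G, h.1 = H ∧ Ω h = h⁻¹
  twisted_mem : ∀ g ∈ G, ∀ H ∈ S, g.1 * H * ((Ω g)⁻¹).1 ∈ S
  mem_closure : ∀ H ∈ S, ¬ IsUnit (H + 1) → H ∈ closure {H' ∈ S |
    Module.finrank 𝕜 (LinearMap.ker (H' + 1).mulVecLin) <
      Module.finrank 𝕜 (LinearMap.ker (H + 1).mulVecLin)}

/-- The real coordinate carries the identity block of the padded tori: it is 0 in the Lie algebra
and exp 0 = 1 in the group. -/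
theorem exp_imagPoint {R : ℕ} (s : Fin R → ℝ) :
    NormedSpace.exp (imagPoint s) = circlePoint fun j => Circle.exp (s j) := by
  ext j
  · simp [imagPoint, circlePoint]
  · simp [imagPoint, circlePoint, Circle.coe_exp, Pi.coe_exp, Complex.exp_eq_exp_ℂ]

theorem continuous_torus {R : ℕ} (T : (ℝ × (Fin R → ℂ)) →⋆ₐ[ℝ] Matrix n n 𝕜) : Continuous T :=
  T.toAlgHom.toLinearMap.continuous_of_finiteDimensional

theorem torus_exp {R : ℕ} (T : (ℝ × (Fin R → ℂ)) →⋆ₐ[ℝ] Matrix n n 𝕜) (x : ℝ × (Fin R → ℂ)) :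
    T (NormedSpace.exp x) = NormedSpace.exp (T x) :=
  open scoped Matrix.Norms.Operator in
  NormedSpace.map_exp T (continuous_torus T) x

theorem star_imagPoint {R : ℕ} (s : Fin R → ℝ) : star (imagPoint s) = -imagPoint s := by
  ext j <;> simp [imagPoint]

theorem star_circlePoint_mul {R : ℕ} (l : Fin R → Circle) :
    star (circlePoint l) * circlePoint l = 1 := by
  ext j
  · simp [circlePoint]
  · simp [circlePoint, ← Circle.coe_inv_eq_conj]

theorem continuous_circlePoint {R : ℕ} :
    Continuous (circlePoint : (Fin R → Circle) → ℝ × (Fin R → ℂ)) :=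
  continuous_const.prodMk (continuous_pi fun j =>
    continuous_subtype_val.comp (continuous_apply j))

theorem exists_circle_exp {R : ℕ} (l : Fin R → Circle) :
    ∃ s : Fin R → ℝ, l = fun j => Circle.exp (s j) :=
  ⟨fun j => Complex.arg (l j), funext fun j => (Circle.exp_arg (l j)).symm⟩

/-- A one-parameter family of subtorus parametrizations as a linear map. -/
def flatMap {R : ℕ} (T : (ℝ × (Fin R → ℂ)) →⋆ₐ[ℝ] Matrix n n 𝕜) :
    (Fin R → ℝ) →ₗ[ℝ] Matrix n n 𝕜 where
  toFun s := T (imagPoint s)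
  map_add' s t := by
    rw [← map_add]; congr 1; ext j <;> simp [imagPoint, add_mul]
  map_smul' c t := by
    rw [RingHom.id_apply, ← map_smul]; congr 1; ext j <;> simp [imagPoint, mul_assoc]

/-- Equivariance of the Cayley transform under unitary conjugation: multiplied by the denominator,
it becomes a polynomial identity that uses only k* k = 1 and k k* = 1. -/
theorem isUnit_one_sub_mulStar {Z k : Matrix n n 𝕜} (hk : star k * k = 1) (hZ : star Z = -Z) :
    k * cayley Z * star k = cayley (k * Z * star k) := by
  have hk' := mul_eq_one_comm.1 hk
  have h1 : star (k * Z * star k) = -(k * Z * star k) := by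
    simp only [star_mul, star_star, hZ, mul_neg, neg_mul, mul_assoc]
  refine eq_cayley (isUnit_one_sub_of_star_eq_neg h1) ?_
  have h2 := cayley_mul (isUnit_one_sub_of_star_eq_neg hZ)
  calc k * cayley Z * star k * (1 - k * Z * star k)
      = k * cayley Z * (star k - (star k * k) * Z * star k) := by noncomm_ring
    _ = k * (cayley Z * (1 - Z)) * star k := by rw [hk]; noncomm_ring
    _ = 1 + k * Z * star k := by rw [h2, mul_add, add_mul, mul_one, hk']

namespace LinearInvolution

variable {G : Subgroup (unitaryGroup n 𝕜)} {Ω : unitaryGroup n 𝕜 →* unitaryGroup n 𝕜}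
  {L : StarSubalgebra ℝ (Matrix n n 𝕜)} {θ : Matrix n n 𝕜 →⋆ₐ[ℝ] Matrix n n 𝕜}
  {R : ℕ} {T : (ℝ × (Fin R → ℂ)) →⋆ₐ[ℝ] Matrix n n 𝕜}

theorem isCompact_fixed (hL : LinearInvolution G Ω L θ) :
    IsCompact {k : unitaryGroup n 𝕜 | k ∈ G ∧ Ω k = k} :=
  (hL.isClosed.inter (isClosed_eq hL.continuous_map continuous_id)).isCompact

theorem conj_mem_oddSkew (hL : LinearInvolution G Ω L θ) {k : unitaryGroup n 𝕜} (hk : k ∈ G)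
    (hΩ : Ω k = k) {X : Matrix n n 𝕜} (hX : X ∈ oddSkew L θ) : k.1 * X * star k.1 ∈ oddSkew L θ := by
  have h1 : θ k.1 = k.1 := by rw [← hL.coe_map, hΩ]
  refine ⟨mul_mem (mul_mem (hL.coe_mem k hk) hX.1) (star_mem (hL.coe_mem k hk)), ?_, ?_⟩
  · simp only [star_mul, star_star, hX.2.1, mul_neg, neg_mul, mul_assoc]
  · simp only [map_mul, StarHomClass.map_star, h1, hX.2.2, mul_neg, neg_mul]

theorem imag_mem (hT : RegularTorus L θ T) (s : Fin R → ℝ) : T (imagPoint s) ∈ oddSkew L θ :=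
  ⟨hT.mem _, by rw [← StarHomClass.map_star, star_imagPoint, map_neg],
    by rw [hT.map_star, star_imagPoint, map_neg]⟩

/-- Every element of the tangent space is conjugate under the fixed group to an element of the
flat. -/
theorem exists_conj_flat (hL : LinearInvolution G Ω L θ) (hT : RegularTorus L θ T)
    {X : Matrix n n 𝕜} (hX : X ∈ oddSkew L θ) :
    ∃ k ∈ G, Ω k = k ∧ ∃ s : Fin R → ℝ, k.1 * X * star k.1 = T (imagPoint s) := by
  obtain ⟨t, ht⟩ := hT.regular
  set D := T (imagPoint t) with hD
  have hDm : D ∈ oddSkew L θ := imag_mem hT t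
  -- The function to be maximized over the K-orbit of X is the real trace form against the regular
  -- element D.
  let ℓ : Matrix n n 𝕜 →ₗ[ℝ] ℝ :=
    { toFun := fun Y => RCLike.re (trace (Y * D))
      map_add' := fun a b => by rw [add_mul, trace_add, map_add]
      map_smul' := fun c a => by
        rw [smul_mul_assoc, trace_smul, RCLike.smul_re, RingHom.id_apply, smul_eq_mul] }
  have hcont : Continuous fun k : unitaryGroup n 𝕜 => ℓ (k.1 * X * star k.1) :=
    (continuous_linearMap_matrix ℓ).comp (by fun_prop)
  obtain ⟨k, ⟨hkG, hkΩ⟩, hmax⟩ := hL.isCompact_fixed.exists_isMaxOn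
    ⟨1, G.one_mem, map_one Ω⟩ hcont.continuousOn
  refine ⟨k, hkG, hkΩ, ht _ (hL.conj_mem_oddSkew hkG hkΩ hX) ?_⟩
  have hX'm := hL.conj_mem_oddSkew hkG hkΩ hX
  obtain ⟨X', hX'⟩ : ∃ Y, Y = k.1 * X * star k.1 := ⟨_, rfl⟩
  rw [← hX'] at hX'm ⊢
  -- The commutator of two odd elements is skew and fixed by θ, so exp(uW) lies in K and gives an
  -- admissible variation of the maximum point.
  obtain ⟨W, hW⟩ : ∃ W, W = X' * D - D * X' := ⟨_, rfl⟩
  have hWL : W ∈ skewPart L := by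
    refine ⟨hW ▸ sub_mem (mul_mem hX'm.1 hDm.1) (mul_mem hDm.1 hX'm.1), ?_⟩
    rw [hW, star_sub, star_mul, star_mul, hX'm.2.1, hDm.2.1]
    noncomm_ring
  have hWθ : θ W = W := by
    rw [hW, map_sub, map_mul, map_mul, hX'm.2.2, hDm.2.2]
    noncomm_ring
  have hder := hasDerivAt_linearMap_exp_conj ℓ W X'
  have hloc : IsLocalMax (fun t : ℝ => ℓ (NormedSpace.exp (t • W) * X' *
      NormedSpace.exp (t • (-W)))) 0 := by
    refine Filter.Eventually.of_forall fun u => ?_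
    have hu : u • W ∈ skewPart L := (skewPart L).smul_mem u hWL
    let e : unitaryGroup n 𝕜 := ⟨NormedSpace.exp (u • W), exp_mem_unitaryGroup hu.2⟩
    have heG : e ∈ G := hL.exp_mem hu
    have heΩ : Ω e = e := by
      apply Subtype.ext
      rw [hL.coe_map]
      change θ (NormedSpace.exp (u • W)) = NormedSpace.exp (u • W)
      rw [starAlgHom_exp, map_smul, hWθ]
    have h1 : ℓ ((e * k).1 * X * star (e * k).1) ≤ ℓ (k.1 * X * star k.1) :=
      hmax ⟨G.mul_mem heG hkG, by rw [map_mul, heΩ, hkΩ]⟩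
    have h2 : (e * k).1 * X * star (e * k).1 =
        NormedSpace.exp (u • W) * X' * NormedSpace.exp (u • (-W)) := by
      have h3 : NormedSpace.exp (u • (-W)) = star e.1 := by
        change _ = star (NormedSpace.exp (u • W))
        rw [star_matrix_exp, star_smul, star_trivial u, hWL.2]
      rw [h3, Submonoid.coe_mul, star_mul, hX']
      simp only [mul_assoc]
      rfl
    rw [h2, ← hX'] at h1
    simpa using h1
  have h0 := hloc.hasDerivAt_eq_zero hder
  -- The derivative of the variation is the real part of tr(W²) = -tr(W* W), by cyclicity of the
  -- trace. Since it vanishes at the maximum, W = 0.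
  have h4 : trace ((W * X' - X' * W) * D) = trace (W * W) := by
    have : trace (X' * W * D) = trace (W * (D * X')) := by
      rw [mul_assoc, trace_mul_comm, mul_assoc]
    rw [sub_mul, trace_sub, this, mul_assoc, ← trace_sub, ← mul_sub, ← hW]
  have h5 : RCLike.re (trace (Wᴴ * W)) = 0 := by
    rw [← star_eq_conjTranspose, hWL.2, neg_mul, trace_neg, map_neg, ← h4]
    rw [show RCLike.re (trace ((W * X' - X' * W) * D)) = 0 from h0, neg_zero]
  have h6 : W = 0 := by
    open scoped ComplexOrder in
    have h7 := (posSemidef_conjTranspose_mul_self W).trace_nonneg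
    rw [RCLike.nonneg_iff] at h7
    exact trace_conjTranspose_mul_self_eq_zero_iff.1 (RCLike.ext (by simpa using h5)
      (by simpa using h7.2))
  exact sub_eq_zero.1 (hW ▸ h6)

end LinearInvolution
end SymmetricEnsemble
end

noncomputable section
-- From the infinitesimal data to the torus, the conjugacy theorem, the submanifold and the quotient
section Realization

variable {n : Type} [Fintype n] [DecidableEq n] {𝕜 : Type} [RCLike 𝕜]

variable {G K : Subgroup (unitaryGroup n 𝕜)} {Ω : unitaryGroup n 𝕜 →* unitaryGroup n 𝕜}
  {L : StarSubalgebra ℝ (Matrix n n 𝕜)} {θ : Matrix n n 𝕜 →⋆ₐ[ℝ] Matrix n n 𝕜}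
  {R : ℕ} {T : (ℝ × (Fin R → ℂ)) →⋆ₐ[ℝ] Matrix n n 𝕜} {S A : Set (Matrix n n 𝕜)}

theorem circlePoint_mul (l m : Fin R → Circle) :
    circlePoint (l * m) = circlePoint l * circlePoint m := by
  ext j <;> simp [circlePoint]

theorem circlePoint_one : circlePoint (1 : Fin R → Circle) = 1 := by
  ext j <;> simp [circlePoint]

/-- The torus parametrized by `T`. -/
def torusHom (T : (ℝ × (Fin R → ℂ)) →⋆ₐ[ℝ] Matrix n n 𝕜) :
    (Fin R → Circle) →* unitaryGroup n 𝕜 where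
  toFun l := ⟨T (circlePoint l), mem_unitaryGroup_iff'.2 (by
    rw [← StarHomClass.map_star, ← map_mul, star_circlePoint_mul, map_one])⟩
  map_one' := Subtype.ext ((congrArg T circlePoint_one).trans (map_one T))
  map_mul' l m := Subtype.ext ((congrArg T (circlePoint_mul l m)).trans (map_mul T _ _))

theorem continuous_torusHom (T : (ℝ × (Fin R → ℂ)) →⋆ₐ[ℝ] Matrix n n 𝕜) :
    Continuous (torusHom T) :=
  continuous_induced_rng.2 ((continuous_torus T).comp continuous_circlePoint)

theorem exists_sqrt_circle (l : Fin R → Circle) : ∃ m : Fin R → Circle, m * m = l := by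
  obtain ⟨s, rfl⟩ := exists_circle_exp l
  refine ⟨fun j => Circle.exp (s j / 2), funext fun j => ?_⟩
  rw [Pi.mul_apply, ← Circle.exp_add, add_halves]

namespace LinearInvolution

theorem torusHom_injective (hT : RegularTorus L θ T) : Function.Injective (torusHom T) := by
  intro l m h
  have h1 : T (circlePoint l - circlePoint m) = 0 := by
    rw [map_sub, sub_eq_zero]; exact congrArg Subtype.val h
  have h2 : circlePoint l - circlePoint m = (0, fun j => (l j : ℂ) - m j) := by
    ext j <;> simp [circlePoint]
  rw [h2] at h1
  have h3 := hT.eq_zero _ h1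
  funext j
  exact Subtype.ext (sub_eq_zero.1 (congrFun h3 j))

theorem torusHom_mem (hL : LinearInvolution G Ω L θ) (hT : RegularTorus L θ T)
    (l : Fin R → Circle) : torusHom T l ∈ G := by
  obtain ⟨s, rfl⟩ := exists_circle_exp l
  have h := imag_mem hT s
  have h1 := hL.exp_mem (W := T (imagPoint s)) ⟨h.1, h.2.1⟩
  convert h1 using 1
  apply Subtype.ext
  change T (circlePoint fun j => Circle.exp (s j)) = _
  rw [← exp_imagPoint, torus_exp]

theorem map_torusHom (hL : LinearInvolution G Ω L θ) (hT : RegularTorus L θ T)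
    (l : Fin R → Circle) : Ω (torusHom T l) = (torusHom T l)⁻¹ := by
  apply Subtype.ext
  rw [hL.coe_map]
  change θ (T (circlePoint l)) = star (T (circlePoint l))
  rw [hT.map_star, StarHomClass.map_star]

/-- With l = m², twisting 1 by τ(m) gives τ(m) Ω(τ(m))⁻¹ = τ(m)² = τ(l), because Ω inverts the
torus. -/
theorem torusHom_mem_ensemble (hL : LinearInvolution G Ω L θ) (hT : RegularTorus L θ T)
    (hS : SymmetricEnsemble G Ω S) (l : Fin R → Circle) : (torusHom T l).1 ∈ S := by
  obtain ⟨m, rfl⟩ := exists_sqrt_circle l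
  have h := hS.twisted_mem _ (hL.torusHom_mem hT m) 1 hS.one_mem
  rw [hL.map_torusHom hT, inv_inv, mul_one] at h
  rw [map_mul]
  exact h

theorem conj_mem_ensemble (hS : SymmetricEnsemble G Ω S) {k : unitaryGroup n 𝕜} (hk : k ∈ G)
    (hΩ : Ω k = k) {H : Matrix n n 𝕜} (hH : H ∈ S) : k.1 * H * star k.1 ∈ S := by
  have := hS.twisted_mem k hk H hH
  rwa [hΩ] at this

theorem cayley_imagPoint (T : (ℝ × (Fin R → ℂ)) →⋆ₐ[ℝ] Matrix n n 𝕜) (s : Fin R → ℝ) :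
    ∃ l, cayley (T (imagPoint s)) = (torusHom T l).1 := by
  have hne : ∀ j, (1 - (s j : ℂ) * Complex.I) ≠ 0 := fun j h => by
    have := congrArg Complex.re h
    simp at this
  -- On each coordinate the Cayley transform of is is (1 + is)/(1 - is), the quotient of the
  -- conjugate of 1 - is by 1 - is.
  refine ⟨fun j => Circle.ofConjDivSelf (1 - (s j : ℂ) * Complex.I) (hne j), ?_⟩
  have hsk : star (T (imagPoint s)) = -T (imagPoint s) := by
    rw [← StarHomClass.map_star, star_imagPoint, map_neg]
  refine (eq_cayley (isUnit_one_sub_of_star_eq_neg hsk) ?_).symm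
  change T (circlePoint _) * _ = _
  rw [← map_one T, ← map_sub, ← map_mul, ← map_add]
  congr 1
  ext j
  · simp [circlePoint, imagPoint]
  · simp [circlePoint, imagPoint, Circle.ofConjDivSelf, div_mul_cancel₀ _ (hne j)]

theorem cayley_conj_torus (hL : LinearInvolution G Ω L θ) (hT : RegularTorus L θ T)
    {Z : Matrix n n 𝕜} (hZ : Z ∈ oddSkew L θ) :
    ∃ k ∈ G, Ω k = k ∧ ∃ l, k.1 * cayley Z * star k.1 = (torusHom T l).1 := by
  obtain ⟨k, hkG, hkΩ, s, hs⟩ := hL.exists_conj_flat hT hZ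
  obtain ⟨l, hl⟩ := cayley_imagPoint T s
  exact ⟨k, hkG, hkΩ, l, by
    rw [isUnit_one_sub_mulStar (mem_unitaryGroup_iff'.1 k.2) hZ.2.1, hs, hl]⟩

theorem cayleyInv_mem (hL : LinearInvolution G Ω L θ) {Y : Matrix n n 𝕜} (hYL : Y ∈ L)
    (hY : star Y * Y = 1) (hu : IsUnit (Y + 1)) : cayleyInv Y ∈ skewPart L := by
  refine ⟨mul_mem (sub_mem hYL (one_mem _)) ?_, star_cayleyInv hY hu⟩
  rw [← nonsing_inv_eq_ringInverse]
  exact hL.inv_mem _ (add_mem hYL (one_mem _))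

/-- θ Y = Y* lets θ play the part of the adjoint in the computation of `star_cayleyInv`. -/
theorem cayleyInv_mem_oddSkew (hL : LinearInvolution G Ω L θ) {Y : Matrix n n 𝕜} (hYL : Y ∈ L)
    (hY : star Y * Y = 1) (hθ : θ Y = star Y) (hu : IsUnit (Y + 1)) :
    cayleyInv Y ∈ oddSkew L θ := by
  obtain ⟨h1, h2⟩ := hL.cayleyInv_mem hYL hY hu
  refine ⟨h1, h2, ?_⟩
  have h3 := congrArg θ (cayleyInv_mul hu)
  rw [map_mul, map_add, map_sub, map_one, hθ] at h3
  have h4 : (star Y + 1) * Y = Y + 1 := by rw [add_mul, hY, one_mul, add_comm]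
  rw [← hu.mul_left_inj, neg_mul, cayleyInv_mul hu, ← h4, ← mul_assoc, h3, sub_mul, hY, one_mul,
    neg_sub]

theorem cayley_mem (hL : LinearInvolution G Ω L θ) {Z : Matrix n n 𝕜} (hZ : Z ∈ skewPart L) :
    cayley Z ∈ L := by
  refine mul_mem (add_mem (one_mem _) hZ.1) ?_
  rw [← nonsing_inv_eq_ringInverse]
  exact hL.inv_mem _ (sub_mem (one_mem _) hZ.1)

/-- Without the eigenvalue -1 this is the conjugacy theorem in the tangent space read through the
Cayley transform. The general case is a limit, by strong induction on the dimension of the -1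
eigenspace. -/
theorem exists_conj_torus (hL : LinearInvolution G Ω L θ) (hT : RegularTorus L θ T)
    (hS : SymmetricEnsemble G Ω S) {H : Matrix n n 𝕜} (hH : H ∈ S) :
    ∃ k ∈ G, Ω k = k ∧ ∃ l, k.1 * H * star k.1 = (torusHom T l).1 := by
  -- The set is the image of the compact space K × (S¹)^R under (k, l) ↦ k* τ(l) k.
  have hclosed : IsClosed {H : Matrix n n 𝕜 |
      ∃ k ∈ G, Ω k = k ∧ ∃ l, k.1 * H * star k.1 = (torusHom T l).1} := by
    have hc := (hL.isCompact_fixed.prod (isCompact_univ (X := Fin R → Circle))).image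
      (f := fun p : unitaryGroup n 𝕜 × (Fin R → Circle) =>
        star p.1.1 * (torusHom T p.2).1 * p.1.1)
      (((continuous_star.comp (continuous_subtype_val.comp continuous_fst)).mul
        (continuous_subtype_val.comp ((continuous_torusHom T).comp continuous_snd))).mul
        (continuous_subtype_val.comp continuous_fst))
    convert hc.isClosed using 1
    ext H
    constructor
    · rintro ⟨k, hk, hΩ, l, hl⟩
      refine ⟨(k, l), ⟨⟨hk, hΩ⟩, trivial⟩, ?_⟩
      have h1 := mem_unitaryGroup_iff'.1 k.2
      dsimp only
      rw [← hl]
      simp only [mul_assoc, h1, mul_one]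
      rw [← mul_assoc, h1, one_mul]
    · rintro ⟨⟨k, l⟩, ⟨⟨hk, hΩ⟩, -⟩, rfl⟩
      refine ⟨k, hk, hΩ, l, ?_⟩
      have h1 := mem_unitaryGroup_iff.1 k.2
      simp only [mul_assoc, h1, mul_one]
      rw [← mul_assoc, h1, one_mul]
  suffices h : ∀ m : ℕ, ∀ H ∈ S,
      Module.finrank 𝕜 (LinearMap.ker (H + 1).mulVecLin) = m →
      ∃ k ∈ G, Ω k = k ∧ ∃ l, k.1 * H * star k.1 = (torusHom T l).1 from h _ H hH rfl
  intro m
  induction m using Nat.strong_induction_on with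
  | _ m ih =>
    intro H hH hm
    by_cases hu : IsUnit (H + 1)
    · obtain ⟨h, hhG, rfl, hΩ⟩ := hS.exists_eq H hH
      have hθ : θ h.1 = star h.1 := by rw [← hL.coe_map, hΩ]; rfl
      have := hL.cayley_conj_torus hT (hL.cayleyInv_mem_oddSkew (hL.coe_mem h hhG)
        (mem_unitaryGroup_iff'.1 h.2) hθ hu)
      rwa [cayley_cayleyInv hu] at this
    · refine closure_minimal ?_ hclosed (hS.mem_closure H hH hu)
      rintro H' ⟨hH', hlt⟩
      exact ih _ (hm ▸ hlt) H' hH' rfl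

/-- Solving Ω(h) = h⁻¹ does not by itself give membership in S. Here it holds because Z is conjugate
into the flat, whose Cayley transforms lie in the torus and hence in S. This is the converse
inclusion needed for the chart of S at 1. -/
theorem cayley_mem_ensemble (hL : LinearInvolution G Ω L θ) (hT : RegularTorus L θ T)
    (hS : SymmetricEnsemble G Ω S) {Z : Matrix n n 𝕜} (hZ : Z ∈ oddSkew L θ) : cayley Z ∈ S := by
  obtain ⟨k, hk, hΩ, l, hl⟩ := hL.cayley_conj_torus hT hZ
  have h := conj_mem_ensemble hS (G.inv_mem hk) (by rw [map_inv, hΩ])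
    (hL.torusHom_mem_ensemble hT hS l)
  rw [← hl] at h
  have h1 : (k⁻¹).1 = star k.1 := rfl
  rw [h1, star_star] at h
  have h2 := mem_unitaryGroup_iff'.1 k.2
  convert h using 1
  simp only [mul_assoc, h2, mul_one]
  rw [← mul_assoc, h2, one_mul]

theorem isSmoothMatrixSubmanifoldOf (hL : LinearInvolution G Ω L θ) (hT : RegularTorus L θ T)
    (hS : SymmetricEnsemble G Ω S) :
    IsSmoothMatrixSubmanifoldOf S (Subtype.val '' (G : Set (unitaryGroup n 𝕜))) := by
  obtain ⟨U, hU, h1U, hUG⟩ := hL.nhds_one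
  have hSG : S ⊆ Subtype.val '' (G : Set (unitaryGroup n 𝕜)) := fun H hH => by
    obtain ⟨h, hG, rfl, -⟩ := hS.exists_eq H hH
    exact ⟨h, hG, rfl⟩
  have hG' : ∀ Y ∈ U, IsUnit (Y + 1) →
      (Y ∈ Subtype.val '' (G : Set (unitaryGroup n 𝕜)) ↔ cayleyInv Y ∈ skewPart L) := by
    intro Y hYU hu
    constructor
    · rintro ⟨g, hg, rfl⟩
      exact hL.cayleyInv_mem (hL.coe_mem g hg) (mem_unitaryGroup_iff'.1 g.2) hu
    · intro h
      have h1 := cayley_mem_unitaryGroup h.2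
      have h2 := hL.cayley_mem h
      rw [cayley_cayleyInv hu] at h1 h2
      exact ⟨⟨Y, h1⟩, hUG ⟨Y, h1⟩ hYU h2, rfl⟩
  have hS' : ∀ Y ∈ U, IsUnit (Y + 1) → (Y ∈ S ↔ cayleyInv Y ∈ oddSkew L θ) := by
    intro Y _ hu
    constructor
    · intro h
      obtain ⟨g, hG, rfl, hΩ⟩ := hS.exists_eq Y h
      have hθ : θ g.1 = star g.1 := by rw [← hL.coe_map, hΩ]; rfl
      exact hL.cayleyInv_mem_oddSkew (hL.coe_mem g hG) (mem_unitaryGroup_iff'.1 g.2) hθ hu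
    · intro h
      have := hL.cayley_mem_ensemble hT hS h
      rwa [cayley_cayleyInv hu] at this
  have hom : ∀ x ∈ S, ∃ p q : (Matrix n n 𝕜)ˣ, (p : Matrix n n 𝕜) * x * q = 1 ∧
      (∀ y : Matrix n n 𝕜, (p : Matrix n n 𝕜) * y * q ∈ Subtype.val '' (G : Set (unitaryGroup n 𝕜))
        ↔ y ∈ Subtype.val '' (G : Set (unitaryGroup n 𝕜))) ∧
      ∀ y : Matrix n n 𝕜, (p : Matrix n n 𝕜) * y * q ∈ S ↔ y ∈ S := by
    intro x hx
    obtain ⟨k, hk, hΩ, l, hl⟩ := hL.exists_conj_torus hT hS hx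
    obtain ⟨m, rfl⟩ := exists_sqrt_circle l
    -- If k x k⁻¹ = τ(m)², the twisted conjugation by τ(m)⁻¹ k sends x to 1, since Ω(g)⁻¹ = k⁻¹
    -- τ(m)⁻¹.
    let g : unitaryGroup n 𝕜 := (torusHom T m)⁻¹ * k
    have hgG : g ∈ G := G.mul_mem (G.inv_mem (hL.torusHom_mem hT m)) hk
    have hinv : ∀ y : Matrix n n 𝕜, y = (g⁻¹).1 * (g.1 * y * ((Ω g)⁻¹).1) * (Ω g).1 := fun y => by
      have h1 : (g⁻¹).1 * g.1 = 1 := mem_unitaryGroup_iff'.1 g.2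
      have h2 : ((Ω g)⁻¹).1 * (Ω g).1 = 1 := mem_unitaryGroup_iff'.1 (Ω g).2
      simp only [mul_assoc, h2, mul_one]
      rw [← mul_assoc, h1, one_mul]
    refine ⟨Unitary.toUnits g, Unitary.toUnits (Ω g)⁻¹, ?_, fun y => ⟨?_, ?_⟩, fun y => ⟨?_, ?_⟩⟩
    · have h3 : (Ω g)⁻¹ = k⁻¹ * (torusHom T m)⁻¹ := by
        simp only [g, map_mul, map_inv, hΩ, hL.map_torusHom hT, inv_inv, _root_.mul_inv_rev]
      have h4 : ((torusHom T m)⁻¹).1 * (k.1 * x * star k.1) * ((torusHom T m)⁻¹).1 = 1 := by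
        rw [hl, ← Submonoid.coe_mul, ← Submonoid.coe_mul, map_mul]
        simp
      rw [h3, ← h4]
      change ((torusHom T m)⁻¹).1 * k.1 * x * (star k.1 * ((torusHom T m)⁻¹).1) = _
      simp only [mul_assoc]
    · rintro ⟨h, hh, hy⟩
      refine ⟨g⁻¹ * h * Ω g, G.mul_mem (G.mul_mem (G.inv_mem hgG) hh) (hL.map_mem _ hgG), ?_⟩
      rw [hinv y, Submonoid.coe_mul, Submonoid.coe_mul, hy]
      rfl
    · rintro ⟨h, hh, rfl⟩
      exact ⟨g * h * (Ω g)⁻¹, G.mul_mem (G.mul_mem hgG hh) (G.inv_mem (hL.map_mem _ hgG)), rfl⟩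
    · intro hy
      have h5 := hS.twisted_mem _ (G.inv_mem hgG) _ hy
      have h6 : (Ω g⁻¹)⁻¹ = Ω g := by rw [map_inv, inv_inv]
      rw [h6] at h5
      rw [hinv y]
      exact h5
    · exact hS.twisted_mem g hgG y
  have hVW : oddSkew L θ ≤ skewPart L := fun x h => ⟨h.1, h.2.1⟩
  open scoped Matrix.Norms.Operator in
  exact isSmoothSubmanifoldOf_of_cayley (A := Matrix n n 𝕜) hVW hU h1U
    hG' hS' hSG hom

/-- The fibres of g ↦ g Ω(g)⁻¹ are the left cosets of the fixed group, which gives well-definedness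
and injectivity on the quotient together. -/
theorem twisted_eq_iff (g h : unitaryGroup n 𝕜) :
    g * (Ω g)⁻¹ = h * (Ω h)⁻¹ ↔ Ω (g⁻¹ * h) = g⁻¹ * h := by
  rw [map_mul, map_inv, eq_mul_inv_iff_mul_eq, eq_inv_mul_iff_mul_eq, mul_assoc]

/-- The realization of a symmetric space from its infinitesimal data. -/
theorem isMatrixRealization [Algebra 𝕜 ℂ] (hL : LinearInvolution G Ω L θ)
    (hT : RegularTorus L θ T) (hS : SymmetricEnsemble G Ω S)
    (hK : ∀ g, g ∈ K ↔ g ∈ G ∧ Ω g = g) (hA : A = Set.range fun l => T (circlePoint l))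
    (hW : ∀ l m, complexEigenvalues (T (circlePoint l)) = complexEigenvalues (T (circlePoint m)) →
      ∃ k ∈ K, k.1 * T (circlePoint l) * star k.1 = T (circlePoint m)) :
    IsMatrixRealization G K Ω S A R where
  map_mem := hL.map_mem
  involutive g _ := Subtype.ext (by rw [hL.coe_map, hL.coe_map, hL.involutive])
  fixed := hK
  submanifold := hL.isSmoothMatrixSubmanifoldOf hT hS
  torus := ⟨torusHom T, continuous_torusHom T, torusHom_injective hT, hA.symm⟩
  maximal_flat := by
    refine ⟨LinearMap.range (flatMap T), ⟨?_, ?_, ?_⟩, ?_, ?_⟩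
    · rw [hL.symmetricTangent_eq]
      rintro _ ⟨s, rfl⟩
      exact imag_mem hT s
    · rintro _ ⟨s, rfl⟩ _ ⟨t, rfl⟩
      exact (Commute.all (imagPoint s) (imagPoint t)).map T
    · rw [hL.symmetricTangent_eq]
      intro Z hZ hcomm
      -- Commuting with the regular element alone already forces Z into the flat.
      obtain ⟨t, ht⟩ := hT.regular
      obtain ⟨s, rfl⟩ := ht Z hZ (hcomm _ ⟨t, rfl⟩).symm
      exact ⟨s, rfl⟩
    · rw [LinearMap.finrank_range_of_inj, Module.finrank_fin_fun]
      rw [injective_iff_map_eq_zero]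
      intro s hs
      have h := hT.eq_zero _ hs
      funext j
      simpa using congrFun h j
    · rw [hA]
      ext H
      constructor
      · rintro ⟨_, ⟨s, rfl⟩, rfl⟩
        refine ⟨fun j => Circle.exp (s j), ?_⟩
        change T (circlePoint _) = NormedSpace.exp (T (imagPoint s))
        rw [← exp_imagPoint, torus_exp]
      · rintro ⟨l, rfl⟩
        obtain ⟨s, rfl⟩ := exists_circle_exp l
        refine ⟨_, ⟨s, rfl⟩, ?_⟩
        change NormedSpace.exp (T (imagPoint s)) = T (circlePoint _)
        rw [← exp_imagPoint, torus_exp]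
  realization := by
    have hcompact : CompactSpace G := isCompact_iff_compactSpace.1 hL.isClosed.isCompact
    let ψ : G → Matrix n n 𝕜 := fun g => (g.1 * (Ω g.1)⁻¹).1
    have hψ : Continuous ψ := by
      have h1 := hL.continuous_map
      exact continuous_subtype_val.comp (continuous_subtype_val.mul
        (h1.comp continuous_subtype_val).inv)
    have hψ_iff : ∀ g h : G, ψ g = ψ h ↔ g⁻¹ * h ∈ K.subgroupOf G := fun g h => by
      rw [Subgroup.mem_subgroupOf, hK]
      have h1 : ψ g = ψ h ↔ g.1 * (Ω g.1)⁻¹ = h.1 * (Ω h.1)⁻¹ := Subtype.ext_iff.symm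
      rw [h1, twisted_eq_iff]
      exact ⟨fun h2 => ⟨(g⁻¹ * h).2, h2⟩, fun h2 => h2.2⟩
    let φ : G ⧸ K.subgroupOf G → Matrix n n 𝕜 := fun x => Quotient.liftOn' x ψ fun g h hgh =>
      (hψ_iff g h).2 (QuotientGroup.leftRel_apply.1 hgh)
    have hφ : ∀ g : G, φ (QuotientGroup.mk g) = ψ g := fun g => rfl
    have hφc : Continuous φ := hψ.quotient_liftOn' _
    have hφinj : Function.Injective φ := by
      intro x y
      refine Quotient.inductionOn₂' x y fun g h hgh => ?_
      exact Quotient.sound' (QuotientGroup.leftRel_apply.2 ((hψ_iff g h).1 hgh))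
    have hsq : ∀ m : Fin R → Circle, ψ ⟨torusHom T m, hL.torusHom_mem hT m⟩ =
        T (circlePoint (m * m)) := fun m => by
      change ((torusHom T m) * (Ω (torusHom T m))⁻¹).1 = _
      rw [hL.map_torusHom hT, inv_inv, ← map_mul]
      rfl
    -- G/K is compact, so a continuous injection into a Hausdorff space is a closed embedding.
    refine ⟨φ, hφ, (hφc.isClosedEmbedding hφinj).isEmbedding, ?_, ?_, ?_⟩
    · ext H
      constructor
      · rintro ⟨x, rfl⟩
        induction x using QuotientGroup.induction_on with
        | H g =>
          have := hS.twisted_mem g.1 g.2 1 hS.one_mem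
          rwa [mul_one] at this
      · intro hH
        obtain ⟨k, hk, hΩ, l, hl⟩ := hL.exists_conj_torus hT hS hH
        obtain ⟨m, rfl⟩ := exists_sqrt_circle l
        -- If k H k⁻¹ = τ(m)², then k⁻¹ τ(m) is mapped to k⁻¹ τ(m)² k = H.
        refine ⟨QuotientGroup.mk ⟨k⁻¹ * torusHom T m,
          G.mul_mem (G.inv_mem hk) (hL.torusHom_mem hT m)⟩, ?_⟩
        rw [hφ]
        have h1 : k⁻¹ * torusHom T m * (Ω (k⁻¹ * torusHom T m))⁻¹ =
            k⁻¹ * torusHom T (m * m) * k := by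
          rw [map_mul, map_inv, hΩ, hL.map_torusHom hT, map_mul]
          group
        have h2 := mem_unitaryGroup_iff'.1 k.2
        change (k⁻¹ * torusHom T m * (Ω (k⁻¹ * torusHom T m))⁻¹).1 = H
        rw [h1, Submonoid.coe_mul, Submonoid.coe_mul, ← hl]
        change star k.1 * (k.1 * H * star k.1) * k.1 = H
        simp only [mul_assoc, h2, mul_one]
        rw [← mul_assoc, h2, one_mul]
    · ext H
      constructor
      · rintro ⟨_, ⟨g, hg, rfl⟩, rfl⟩
        change g.1.1 ∈ A at hg
        rw [hA] at hg
        obtain ⟨m, hm⟩ := hg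
        have : g = ⟨torusHom T m, hL.torusHom_mem hT m⟩ := Subtype.ext (Subtype.ext hm.symm)
        rw [hφ, this, hsq, hA]
        exact ⟨_, rfl⟩
      · intro hH
        rw [hA] at hH
        obtain ⟨l, rfl⟩ := hH
        obtain ⟨m, rfl⟩ := exists_sqrt_circle l
        exact ⟨_, ⟨⟨torusHom T m, hL.torusHom_mem hT m⟩, hA ▸ ⟨m, rfl⟩, rfl⟩, hsq m⟩
    · intro k hk x
      induction x using QuotientGroup.induction_on with
      | H g =>
        change ((k.1 * g.1) * (Ω (k.1 * g.1))⁻¹).1 = (k.1 * (g.1 * (Ω g.1)⁻¹) * k.1⁻¹).1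
        rw [map_mul, ((hK _).1 hk).2]
        congr 1
        group
  conj_torus H hH := by
    obtain ⟨k, hk, hΩ, l, hl⟩ := hL.exists_conj_torus hT hS hH
    exact ⟨k, (hK k).2 ⟨hk, hΩ⟩, _, hA ▸ ⟨l, rfl⟩, hl⟩
  conj_iff a ha b hb := by
    rw [hA] at ha hb
    obtain ⟨l, rfl⟩ := ha
    obtain ⟨m, rfl⟩ := hb
    refine ⟨?_, fun h => hW l m h⟩
    rintro ⟨k, -, h⟩
    have h1 := charpoly_units_conj (Unitary.toUnits k) (T (circlePoint l))
    have h2 : (Unitary.toUnits k : Matrix n n 𝕜)⁻¹ = star k.1 :=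
      Matrix.inv_eq_left_inv (mem_unitaryGroup_iff'.1 k.2)
    have h3 : (Unitary.toUnits k : Matrix n n 𝕜) * T (circlePoint l) * star k.1 =
      T (circlePoint m) := h
    rw [h2, h3] at h1
    unfold complexEigenvalues
    exact congrArg (fun p => p.aroots ℂ) h1.symm

end LinearInvolution
end Realization
end

noncomputable section

/-! ### Removing the eigenvalue `-1` -/

section Closure

variable {n : Type} [Fintype n] [DecidableEq n] {𝕜 : Type} [RCLike 𝕜]
variable {G : Subgroup (unitaryGroup n 𝕜)} {Ω : unitaryGroup n 𝕜 →* unitaryGroup n 𝕜}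
  {L : StarSubalgebra ℝ (Matrix n n 𝕜)} {θ : Matrix n n 𝕜 →⋆ₐ[ℝ] Matrix n n 𝕜}
  {S : Set (Matrix n n 𝕜)}

/-- The rotation by the angle `s` generated by `X` with `X³ = -X`. -/
def rodrigues (X : Matrix n n 𝕜) (s : ℝ) : Matrix n n 𝕜 :=
  1 + Real.sin s • X + (1 - Real.cos s) • (X * X)

theorem star_rodrigues {X : Matrix n n 𝕜} (h : star X = -X) (s : ℝ) :
    star (rodrigues X s) = rodrigues X (-s) := by
  simp only [rodrigues, star_add, star_one, star_smul, star_mul, h, Real.sin_neg, Real.cos_neg,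
    star_trivial (Real.sin s), star_trivial (1 - Real.cos s), smul_neg, neg_smul, neg_mul, mul_neg,
    neg_neg]

/-- The matrix is exp(sX) in closed form; X³ = -X reduces the product to a combination of 1, X and
X², where sin² + cos² = 1 decides. -/
theorem rodrigues_neg_mul {X : Matrix n n 𝕜} (h : X * (X * X) = -X) (s : ℝ) :
    rodrigues X (-s) * rodrigues X s = 1 := by
  have hs := Real.sin_sq_add_cos_sq s
  simp only [rodrigues, Real.sin_neg, Real.cos_neg, add_mul, mul_add, one_mul, mul_one,
    mul_assoc, h, smul_mul_assoc, mul_smul_comm, mul_neg, smul_neg]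
  match_scalars
  · ring
  · ring
  · linear_combination (-1 : ℝ) * hs

/-- A double angle formula: the right side is cos(2s) X + sin(2s) X², with 1 - cos(2s) kept as 2(1 -
cos s)(1 + cos s) so that its positivity is visible. -/
theorem mulVec_rodrigues {X : Matrix n n 𝕜} (h : X * (X * X) = -X) (s : ℝ) :
    X * (rodrigues X s * rodrigues X s) = X + (2 * Real.sin s * Real.cos s) • (X * X) -
      (2 * (1 - Real.cos s) * (1 + Real.cos s)) • X := by
  have hs := Real.sin_sq_add_cos_sq s
  simp only [rodrigues, add_mul, mul_add, one_mul, mul_one, mul_assoc, h,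
    smul_mul_assoc, mul_smul_comm, mul_neg, neg_neg, smul_neg]
  match_scalars
  · linear_combination (-1 : ℝ) * hs
  · ring

/-- A rotation generator supported on the eigenspace of `-1` makes this eigenspace smaller. -/
theorem LinearInvolution.mem_closure_of_generator (hL : LinearInvolution G Ω L θ)
    (hS1 : ∀ H ∈ S, ∃ h ∈ G, h.1 = H ∧ Ω h = h⁻¹)
    (hS2 : ∀ g ∈ G, ∀ H ∈ S, g.1 * H * ((Ω g)⁻¹).1 ∈ S) {H X : Matrix n n 𝕜} (hH : H ∈ S)
    (hX : X ∈ oddSkew L θ) (hX0 : X ≠ 0) (hX3 : X * (X * X) = -X) (hHX : H * X = -X) :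
    H ∈ closure {H' ∈ S | Module.finrank 𝕜 (LinearMap.ker (H' + 1).mulVecLin) <
      Module.finrank 𝕜 (LinearMap.ker (H + 1).mulVecLin)} := by
  have hXH : X * H = -X := by
    obtain ⟨h, -, rfl, -⟩ := hS1 H hH
    have h1 := congrArg star hHX
    rw [star_mul, star_neg, hX.2.1, neg_neg, neg_mul, neg_eq_iff_eq_neg] at h1
    calc X * h.1 = -(X * star h.1) * h.1 := by rw [h1, neg_neg]
      _ = -X := by rw [neg_mul, mul_assoc, mem_unitaryGroup_iff'.1 h.2, mul_one]
  have hcont : Continuous (rodrigues X) := by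
    unfold rodrigues
    fun_prop
  have h0 : rodrigues X 0 = 1 := by simp [rodrigues]
  -- Since X is odd, Ω inverts the rotation R(s), so R(s) H R(s) is the twisted conjugate of H by
  -- R(s). It tends to H as s → 0.
  have hlim : Filter.Tendsto (fun s : ℝ => rodrigues X s * H * rodrigues X s)
      (nhdsWithin 0 (Set.Ioi 0)) (nhds H) := by
    have h1 : Continuous fun s : ℝ => rodrigues X s * H * rodrigues X s :=
      (hcont.mul continuous_const).mul hcont
    have h2 := h1.tendsto 0
    rw [h0, one_mul, mul_one] at h2
    exact h2.mono_left nhdsWithin_le_nhds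
  refine mem_closure_of_tendsto hlim ?_
  obtain ⟨U, hU, h1U, hUG⟩ := hL.nhds_one
  have hev : ∀ᶠ s in nhdsWithin (0 : ℝ) (Set.Ioi 0), rodrigues X s ∈ U :=
    (hcont.continuousAt.eventually (by rw [h0]; exact hU.mem_nhds h1U)).filter_mono
      nhdsWithin_le_nhds
  have hev2 : ∀ᶠ s in nhdsWithin (0 : ℝ) (Set.Ioi 0), s ∈ Set.Ioo (0 : ℝ) 1 :=
    Ioo_mem_nhdsGT one_pos
  filter_upwards [hev, hev2] with s hsU hs
  have hmem : rodrigues X s ∈ unitaryGroup n 𝕜 := mem_unitaryGroup_iff'.2 (by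
    rw [star_rodrigues hX.2.1, rodrigues_neg_mul hX3])
  have hLmem : rodrigues X s ∈ L :=
    add_mem (add_mem (one_mem _) (L.toSubalgebra.smul_mem hX.1 _))
      (L.toSubalgebra.smul_mem (mul_mem hX.1 hX.1) _)
  let r : unitaryGroup n 𝕜 := ⟨rodrigues X s, hmem⟩
  have hrG : r ∈ G := hUG r hsU hLmem
  have hΩ : ((Ω r)⁻¹).1 = rodrigues X s := by
    have h1 : Ω r = r⁻¹ := by
      apply Subtype.ext
      rw [hL.coe_map]
      change θ (rodrigues X s) = star (rodrigues X s)
      rw [star_rodrigues hX.2.1]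
      simp only [rodrigues, map_add, map_one, map_smul, map_mul, hX.2.2, Real.sin_neg,
        Real.cos_neg, smul_neg, neg_smul, neg_mul, mul_neg, neg_neg]
    rw [h1, inv_inv]
  refine ⟨?_, ?_⟩
  · have := hS2 r hrG H hH
    rwa [hΩ] at this
  -- A vector in the -1 eigenspace of R H R is shown to be killed by X. Then R fixes it, and as R
  -- commutes with H it lies in the -1 eigenspace of H.
  have hker : ∀ x : n → 𝕜, (rodrigues X s * H * rodrigues X s + 1) *ᵥ x = 0 →
      X *ᵥ x = 0 ∧ (H + 1) *ᵥ x = 0 := by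
    intro x hx
    have hRX : X * rodrigues X s = rodrigues X s * X := by
      simp [rodrigues, mul_add, add_mul, mul_assoc]
    have h1 : X * (rodrigues X s * H * rodrigues X s + 1) =
        (2 * (1 - Real.cos s) * (1 + Real.cos s)) • X -
          (2 * Real.sin s * Real.cos s) • (X * X) := by
      have h2 : X * (rodrigues X s * H * rodrigues X s) =
          -(X * (rodrigues X s * rodrigues X s)) := by
        rw [mul_assoc, ← mul_assoc X, hRX, mul_assoc, ← mul_assoc X, hXH, neg_mul, mul_neg,
          ← mul_assoc X, ← mul_assoc (rodrigues X s), hRX]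
      rw [mul_add, h2, mulVec_rodrigues hX3, mul_one]
      abel
    have h3 : (2 * (1 - Real.cos s) * (1 + Real.cos s)) • (X *ᵥ x) -
        (2 * Real.sin s * Real.cos s) • (X *ᵥ (X *ᵥ x)) = 0 := by
      have := congrArg (X *ᵥ ·) hx
      rw [mulVec_mulVec, h1, mulVec_zero, sub_mulVec, smul_mulVec, smul_mulVec] at this
      rw [mulVec_mulVec]
      exact this
    have h4 : (2 * (1 - Real.cos s) * (1 + Real.cos s)) • (X *ᵥ (X *ᵥ x)) +
        (2 * Real.sin s * Real.cos s) • (X *ᵥ x) = 0 := by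
      have := congrArg (X *ᵥ ·) h3
      rw [mulVec_zero, mulVec_sub, mulVec_smul, mulVec_smul, mulVec_mulVec (M := X) (N := X),
        mulVec_mulVec (M := X) (N := X * X), hX3, neg_mulVec, smul_neg, sub_neg_eq_add] at this
      rw [mulVec_mulVec (M := X) (N := X)]
      exact this
    -- With u = X x, a = 1 - cos(2s) and b = sin(2s), the two relations read a u = b X u and a X u =
    -- -b u. Together they give (a² + b²) u = 0, and a > 0.
    have h5 : ((2 * (1 - Real.cos s) * (1 + Real.cos s)) ^ 2 + (2 * Real.sin s * Real.cos s) ^ 2) •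
        (X *ᵥ x) = 0 := by
      have h6 := congrArg ((2 * (1 - Real.cos s) * (1 + Real.cos s)) • ·) h3
      have h7 := congrArg ((2 * Real.sin s * Real.cos s) • ·) h4
      rw [smul_zero] at h6 h7
      have h8 := congrArg₂ (· + ·) h6 h7
      rw [add_zero] at h8
      rw [← h8]
      module
    have hc1 : Real.cos s < 1 := by
      have := Real.cos_lt_cos_of_nonneg_of_le_pi le_rfl (by linarith [Real.pi_gt_three, hs.2]) hs.1
      rwa [Real.cos_zero] at this
    have hc0 : 0 < Real.cos s := Real.cos_pos_of_mem_Ioo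
      ⟨by linarith [Real.pi_gt_three, hs.1], by linarith [Real.pi_gt_three, hs.2]⟩
    have hq : 0 < 2 * (1 - Real.cos s) * (1 + Real.cos s) :=
      mul_pos (mul_pos two_pos (sub_pos.2 hc1)) (by linarith)
    have hXx : X *ᵥ x = 0 := (smul_eq_zero.1 h5).resolve_left (by positivity)
    have hRx : rodrigues X s *ᵥ x = x := by
      rw [rodrigues, add_mulVec, add_mulVec, smul_mulVec, smul_mulVec, ← mulVec_mulVec, hXx]
      simp
    have hRH : rodrigues X s * H = H * rodrigues X s := by
      simp only [rodrigues, add_mul, mul_add, one_mul, mul_one, smul_mul_assoc, mul_smul_comm,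
        mul_assoc, hXH]
      rw [← mul_assoc, hHX]
      simp
    refine ⟨hXx, ?_⟩
    rw [hRH, mul_assoc, add_mulVec, one_mulVec, ← mulVec_mulVec, ← mulVec_mulVec, hRx, hRx] at hx
    rw [add_mulVec, one_mulVec]
    exact hx
  refine Submodule.finrank_lt_finrank_of_lt (lt_of_le_of_ne ?_ ?_)
  · intro x hx
    exact (hker x hx).2
  -- The inclusion is strict because H X = -X puts the range of X² into ker(H + 1). If the kernels
  -- agreed, X would kill that range, so X³ = -X would vanish.
  · intro heq
    apply hX0
    rw [← neg_eq_zero, ← hX3]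
    ext i j
    have h1 : (X * X) *ᵥ Pi.single j 1 ∈ LinearMap.ker (H + 1).mulVecLin := by
      change (H + 1) *ᵥ ((X * X) *ᵥ Pi.single j 1) = 0
      rw [mulVec_mulVec, add_mul, ← mul_assoc, hHX, one_mul, neg_mul, neg_add_cancel, zero_mulVec]
    rw [← heq] at h1
    have h2 := (hker _ h1).1
    rw [mulVec_mulVec] at h2
    have h3 := congrFun h2 i
    simpa [mulVec_single_one] using h3

end Closure

/-! ### Removing the eigenvalue -1 by a phase -/

section Scalar

variable {n : Type} [Fintype n] [DecidableEq n]

theorem finrank_ker_pos_of_not_isUnit {𝕜 : Type} [RCLike 𝕜] {M : Matrix n n 𝕜} (h : ¬ IsUnit M) :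
    0 < Module.finrank 𝕜 (LinearMap.ker M.mulVecLin) := by
  rw [Module.finrank_pos_iff, Submodule.nontrivial_iff_ne_bot]
  intro h0
  exact h (mulVec_injective_iff_isUnit.1 (LinearMap.ker_eq_bot.1 h0))

theorem finrank_ker_of_isUnit {𝕜 : Type} [RCLike 𝕜] {M : Matrix n n 𝕜} (h : IsUnit M) :
    Module.finrank 𝕜 (LinearMap.ker M.mulVecLin) = 0 := by
  rw [LinearMap.ker_eq_bot.2 (mulVec_injective_iff_isUnit.2 h), finrank_bot]

/-- If `S` is stable under phases then the eigenvalue `-1` can be removed. -/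
theorem mem_closure_of_phases {S : Set (Matrix n n ℂ)} {H : Matrix n n ℂ}
    (hS : ∀ z : Circle, (z : ℂ) • H ∈ S) (hu : ¬ IsUnit (H + 1)) :
    H ∈ closure {H' ∈ S | Module.finrank ℂ (LinearMap.ker (H' + 1).mulVecLin) <
      Module.finrank ℂ (LinearMap.ker (H + 1).mulVecLin)} := by
  have hc : Continuous fun s : ℝ => ((Circle.exp s : Circle) : ℂ) := by fun_prop
  have hlim : Filter.Tendsto (fun s : ℝ => ((Circle.exp s : Circle) : ℂ) • H)
      (nhdsWithin 0 (Set.Ioi 0)) (nhds H) := by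
    have h2 : Filter.Tendsto (fun s : ℝ => ((Circle.exp s : Circle) : ℂ) • H) (nhds 0) _ :=
      (hc.smul (continuous_const (y := H))).tendsto 0
    simp only [Pi.smul_apply'] at h2
    rw [Circle.exp_zero, Circle.coe_one, one_smul] at h2
    exact h2.mono_left nhdsWithin_le_nhds
  refine mem_closure_of_tendsto hlim ?_
  -- e^{is} H has the eigenvalue -1 exactly when -e^{-is} is an eigenvalue of H. For small s > 0
  -- this number avoids the finitely many eigenvalues other than -1, and it differs from -1 itself.
  have hfin : ((H.charpoly.roots.toFinset.erase (-1) : Finset ℂ) : Set ℂ).Finite :=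
    Finset.finite_toSet _
  have hev : ∀ᶠ s in nhdsWithin (0 : ℝ) (Set.Ioi 0),
      -((Circle.exp (-s) : Circle) : ℂ) ∈ ((H.charpoly.roots.toFinset.erase (-1) : Finset ℂ) : Set ℂ)ᶜ := by
    have h1 : Continuous fun s : ℝ => -((Circle.exp (-s) : Circle) : ℂ) := by fun_prop
    refine (h1.continuousAt.eventually (hfin.isClosed.isOpen_compl.mem_nhds ?_)).filter_mono
      nhdsWithin_le_nhds
    simp
  have hev2 : ∀ᶠ s in nhdsWithin (0 : ℝ) (Set.Ioi 0), s ∈ Set.Ioo (0 : ℝ) 1 :=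
    Ioo_mem_nhdsGT one_pos
  filter_upwards [hev, hev2] with s hs1 hs2
  refine ⟨hS _, ?_⟩
  have hne : ((Circle.exp (-s) : Circle) : ℂ) ≠ 1 := by
    intro h
    have h1 := congrArg Complex.re h
    rw [Circle.coe_exp, Complex.exp_ofReal_mul_I_re, Real.cos_neg, Complex.one_re] at h1
    have := Real.cos_lt_cos_of_nonneg_of_le_pi le_rfl (by linarith [Real.pi_gt_three, hs2.2]) hs2.1
    rw [Real.cos_zero] at this
    linarith
  have hunit : IsUnit (((Circle.exp s : Circle) : ℂ) • H + 1) := by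
    rw [isUnit_iff_isUnit_det, isUnit_iff_ne_zero]
    intro hdet
    apply hs1
    simp only [Finset.coe_erase, Set.mem_sdiff, Finset.mem_coe, Multiset.mem_toFinset,
      Set.mem_singleton_iff, neg_inj]
    refine ⟨?_, hne⟩
    rw [Polynomial.mem_roots H.charpoly_monic.ne_zero, Polynomial.IsRoot, eval_charpoly]
    have h1 : scalar n (-((Circle.exp (-s) : Circle) : ℂ)) - H =
        -((Circle.exp (-s) : Circle) : ℂ) • (((Circle.exp s : Circle) : ℂ) • H + 1) := by
      have h2 : ((Circle.exp (-s) : Circle) : ℂ) * ((Circle.exp s : Circle) : ℂ) = 1 := by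
        rw [← Circle.coe_mul, ← Circle.exp_add, neg_add_cancel, Circle.exp_zero, Circle.coe_one]
      rw [smul_add, smul_smul, neg_mul, h2, smul_one_eq_diagonal, neg_smul, one_smul, scalar_apply]
      abel
    rw [h1, det_smul, hdet, mul_zero]
  rw [finrank_ker_of_isUnit hunit]
  exact finrank_ker_pos_of_not_isUnit hu

end Scalar
end

noncomputable section

/-! ### Star homomorphisms between matrix algebras -/

section StarHoms

variable {n m : Type} [Fintype n] [DecidableEq n] [Fintype m] [DecidableEq m]
  {𝕜 : Type} [RCLike 𝕜]

variable (m n 𝕜) in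
/-- `(X, Y) ↦ diag(X, Y)`. -/
def blockDiagStarHom : (Matrix m m 𝕜 × Matrix n n 𝕜) →⋆ₐ[ℝ] Matrix (m ⊕ n) (m ⊕ n) 𝕜 where
  toFun p := fromBlocks p.1 0 0 p.2
  map_one' := fromBlocks_one
  map_mul' p q := by simp [fromBlocks_multiply]
  map_zero' := fromBlocks_zero
  map_add' p q := by simp [fromBlocks_add]
  commutes' r := by
    rw [Algebra.algebraMap_eq_smul_one, Algebra.algebraMap_eq_smul_one, ← fromBlocks_one,
      fromBlocks_smul]
    simp
  map_star' p := by simp [star_eq_conjTranspose, fromBlocks_conjTranspose]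

variable (𝕜) in
/-- Relabelling of rows and columns. -/
def reindexStarHom (e : m ≃ n) : Matrix m m 𝕜 →⋆ₐ[ℝ] Matrix n n 𝕜 where
  toFun := reindex e e
  map_one' := by simp
  map_mul' p q := by simp [submatrix_mul_equiv]
  map_zero' := by simp
  map_add' p q := by simp [submatrix_add]
  commutes' r := by
    rw [Algebra.algebraMap_eq_smul_one, Algebra.algebraMap_eq_smul_one]
    simp [submatrix_smul]
  map_star' p := by simp [star_eq_conjTranspose, conjTranspose_submatrix]

variable (n) in
/-- Diagonal matrices. -/
def diagonalStarHom : (n → ℂ) →⋆ₐ[ℝ] Matrix n n ℂ where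
  toFun := diagonal
  map_one' := diagonal_one
  map_mul' p q := by rw [diagonal_mul_diagonal]; rfl
  map_zero' := diagonal_zero
  map_add' p q := by rw [diagonal_add]; rfl
  commutes' r := by
    rw [Algebra.algebraMap_eq_smul_one, Algebra.algebraMap_eq_smul_one, ← diagonal_one,
      ← diagonal_smul]
    rfl
  map_star' p := by rw [star_eq_conjTranspose, diagonal_conjTranspose]

variable (n 𝕜) in
/-- `z ↦ (Re z, -Im z; Im z, Re z)`. -/
def rotationStarHom : (n → ℂ) →⋆ₐ[ℝ] Matrix (n ⊕ n) (n ⊕ n) 𝕜 where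
  toFun z := fromBlocks (diagonal fun j => ((z j).re : 𝕜)) (-diagonal fun j => ((z j).im : 𝕜))
    (diagonal fun j => ((z j).im : 𝕜)) (diagonal fun j => ((z j).re : 𝕜))
  map_one' := by simp
  map_mul' p q := by
    rw [fromBlocks_multiply]
    congr 1 <;> ext i j <;> by_cases h : i = j <;>
      simp [diagonal_mul_diagonal, h, sub_eq_add_neg, add_comm]
  map_zero' := by simp
  map_add' p q := by
    rw [fromBlocks_add]
    simp [diagonal_add, add_comm]
  commutes' r := by
    rw [Algebra.algebraMap_eq_smul_one, Algebra.algebraMap_eq_smul_one, ← fromBlocks_one,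
      fromBlocks_smul, ← diagonal_one, ← diagonal_smul]
    congr 1 <;> ext i j <;> simp [diagonal_apply, RCLike.real_smul_eq_coe_mul]
  map_star' p := by
    rw [star_eq_conjTranspose, fromBlocks_conjTranspose]
    simp [diagonal_conjTranspose, Pi.star_def]

/-- Conjugation as a homomorphism of a commutative algebra. -/
def conjStarHom {B : Type*} [CommSemiring B] [StarRing B] [Algebra ℝ B] [StarModule ℝ B] :
    B →⋆ₐ[ℝ] B where
  toFun := star
  map_one' := star_one _
  map_mul' p q := by rw [star_mul, mul_comm]
  map_zero' := star_zero _
  map_add' := star_add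
  commutes' r := by
    rw [Algebra.algebraMap_eq_smul_one, star_smul, star_one, star_trivial r]
  map_star' _ := rfl

variable (n) in
/-- Entrywise complex conjugation. -/
def mapConjStarHom : Matrix n n ℂ →⋆ₐ[ℝ] Matrix n n ℂ where
  toFun X := X.map (starRingEnd ℂ)
  map_one' := by simp
  map_mul' p q := by simp [Matrix.map_mul]
  map_zero' := by simp
  map_add' p q := by ext; simp
  commutes' r := by
    rw [Algebra.algebraMap_eq_smul_one]
    ext i j
    simp [one_apply, apply_ite (starRingEnd ℂ)]
  map_star' p := by ext; simp [star_eq_conjTranspose]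

/-- `X ↦ P X P⁻¹` for unitary `P`. -/
def unitaryConjStarHom (P : unitaryGroup n 𝕜) : Matrix n n 𝕜 →⋆ₐ[ℝ] Matrix n n 𝕜 where
  toFun X := P.1 * X * star P.1
  map_one' := by rw [mul_one, mem_unitaryGroup_iff.1 P.2]
  map_mul' X Y := by
    have h := mem_unitaryGroup_iff'.1 P.2
    calc P.1 * (X * Y) * star P.1 = P.1 * X * 1 * Y * star P.1 := by simp only [mul_assoc, one_mul]
      _ = _ := by rw [← h]; simp only [mul_assoc]
  map_zero' := by simp
  map_add' X Y := by noncomm_ring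
  commutes' r := by
    rw [Algebra.algebraMap_eq_smul_one, mul_smul_comm, smul_mul_assoc, mul_one,
      mem_unitaryGroup_iff.1 P.2]
  map_star' X := by simp only [star_mul, star_star, mul_assoc]

end StarHoms

/-! ### Parametrizations of the tori -/

section Tori

variable (𝕜 : Type) [RCLike 𝕜] (L R : ℕ)

/-- Diagonal torus. -/
def diagTorus : (ℝ × (Fin R → ℂ)) →⋆ₐ[ℝ] Matrix (Fin R) (Fin R) ℂ :=
  (diagonalStarHom (Fin R)).comp (StarAlgHom.snd ℝ ℝ (Fin R → ℂ))

/-- Doubled diagonal torus. -/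
def doubleDiagTorus : (ℝ × (Fin R → ℂ)) →⋆ₐ[ℝ] Matrix (Fin R ⊕ Fin R) (Fin R ⊕ Fin R) ℂ :=
  (blockDiagStarHom _ _ ℂ).comp ((diagTorus R).prod (diagTorus R))

/-- Rotations. -/
def rotationTorus : (ℝ × (Fin R → ℂ)) →⋆ₐ[ℝ] Matrix (Fin R ⊕ Fin R) (Fin R ⊕ Fin R) 𝕜 :=
  (rotationStarHom (Fin R) 𝕜).comp (StarAlgHom.snd ℝ ℝ (Fin R → ℂ))

/-- Rotations with a scalar block. -/
def paddedTorus : (ℝ × (Fin R → ℂ)) →⋆ₐ[ℝ]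
    Matrix (Fin L ⊕ (Fin R ⊕ Fin R)) (Fin L ⊕ (Fin R ⊕ Fin R)) 𝕜 :=
  (blockDiagStarHom _ _ 𝕜).comp
    (((StarAlgHom.ofId ℝ (Matrix (Fin L) (Fin L) 𝕜)).comp (StarAlgHom.fst ℝ ℝ (Fin R → ℂ))).prod
      (rotationTorus 𝕜 R))

/-- Rotations with a scalar block, regrouped. -/
def groupedTorus : (ℝ × (Fin R → ℂ)) →⋆ₐ[ℝ]
    Matrix ((Fin L ⊕ Fin R) ⊕ Fin R) ((Fin L ⊕ Fin R) ⊕ Fin R) 𝕜 :=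
  (reindexStarHom 𝕜 (Equiv.sumAssoc (Fin L) (Fin R) (Fin R)).symm).comp (paddedTorus 𝕜 L R)

variable {𝕜 R} in
/-- `diag(T(z), T(conj z))`. -/
def doubleTorus {n : Type} [Fintype n] [DecidableEq n]
    (T : (ℝ × (Fin R → ℂ)) →⋆ₐ[ℝ] Matrix n n 𝕜) :
    (ℝ × (Fin R → ℂ)) →⋆ₐ[ℝ] Matrix (n ⊕ n) (n ⊕ n) 𝕜 :=
  (blockDiagStarHom _ _ 𝕜).comp (T.prod (T.comp conjStarHom))

variable {𝕜 R} in
theorem doubleTorus_apply {n : Type} [Fintype n] [DecidableEq n]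
    (T : (ℝ × (Fin R → ℂ)) →⋆ₐ[ℝ] Matrix n n 𝕜) (x : ℝ × (Fin R → ℂ)) :
    doubleTorus T x = fromBlocks (T x) 0 0 (T (star x)) := rfl

theorem star_circlePoint {R : ℕ} (l : Fin R → Circle) :
    star (circlePoint l) = circlePoint l⁻¹ := by
  ext j
  · simp [circlePoint]
  · exact (Circle.coe_inv_eq_conj (l j)).symm

theorem diagTorus_apply (x : ℝ × (Fin R → ℂ)) : diagTorus R x = diagonal x.2 := rfl

theorem doubleDiagTorus_apply (x : ℝ × (Fin R → ℂ)) :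
    doubleDiagTorus R x = fromBlocks (diagonal x.2) 0 0 (diagonal x.2) := rfl

theorem rotationTorus_apply (x : ℝ × (Fin R → ℂ)) :
    rotationTorus 𝕜 R x = fromBlocks (diagonal fun j => ((x.2 j).re : 𝕜))
      (-diagonal fun j => ((x.2 j).im : 𝕜))
      (diagonal fun j => ((x.2 j).im : 𝕜)) (diagonal fun j => ((x.2 j).re : 𝕜)) := rfl

theorem paddedTorus_apply (x : ℝ × (Fin R → ℂ)) :
    paddedTorus 𝕜 L R x = fromBlocks (diagonal fun _ => (x.1 : 𝕜)) 0 0 (rotationTorus 𝕜 R x) := by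
  change fromBlocks (algebraMap ℝ (Matrix (Fin L) (Fin L) 𝕜) x.1) 0 0 _ = _
  congr 1

theorem rotationTorus_circlePoint (l : Fin R → Circle) :
    rotationTorus 𝕜 R (circlePoint l) = rotationMatrix 𝕜 l := rfl

theorem paddedTorus_circlePoint (l : Fin R → Circle) :
    paddedTorus 𝕜 L R (circlePoint l) = paddedRotation 𝕜 L l := by
  rw [paddedTorus_apply, rotationTorus_circlePoint]
  simp [circlePoint, paddedRotation]

theorem groupedTorus_circlePoint (l : Fin R → Circle) :
    groupedTorus 𝕜 L R (circlePoint l) = groupedRotation 𝕜 L l := by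
  change reindex _ _ (paddedTorus 𝕜 L R (circlePoint l)) = _
  rw [paddedTorus_circlePoint]
  rfl

/-- The off-diagonal part of a rotation. -/
def imagColumn (z : Fin R → ℂ) : Matrix (Fin L ⊕ Fin R) (Fin R) 𝕜 :=
  fromRows 0 (diagonal fun j => ((z j).im : 𝕜))

theorem groupedTorus_apply (x : ℝ × (Fin R → ℂ)) :
    groupedTorus 𝕜 L R x = fromBlocks
      (fromBlocks (diagonal fun _ => (x.1 : 𝕜)) 0 0 (diagonal fun j => ((x.2 j).re : 𝕜)))
      (-imagColumn 𝕜 L R x.2) (imagColumn 𝕜 L R x.2)ᵀ (diagonal fun j => ((x.2 j).re : 𝕜)) := by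
  change reindex _ _ (paddedTorus 𝕜 L R x) = _
  rw [paddedTorus_apply, rotationTorus_apply]
  ext ((i | i) | i) ((j | j) | j) <;> simp [imagColumn, diagonal_apply, eq_comm]
  grind

end Tori
end

noncomputable section

/-! ### Eigenvalues of the tori -/

section Eigenvalues

variable {n m : Type} [Fintype n] [DecidableEq n] [Fintype m] [DecidableEq m]
  {𝕜 : Type} [RCLike 𝕜] [Algebra 𝕜 ℂ]

/-- The fibres of f and g over each value have the same cardinality; bijections between fibres glue
to a permutation. -/
theorem exists_perm_of_map_eq {ι α : Type*} [Fintype ι] {f g : ι → α}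
    (h : Finset.univ.val.map f = Finset.univ.val.map g) : ∃ σ : Equiv.Perm ι, f ∘ σ = g := by
  classical
  have hc : ∀ c, Nonempty ({i // g i = c} ≃ {i // f i = c}) := fun c => by
    have h1 := congrArg (Multiset.count c) h
    rw [Multiset.count_map, Multiset.count_map] at h1
    rw [← Fintype.card_eq, Fintype.card_subtype, Fintype.card_subtype]
    simp only [eq_comm (a := c)] at h1
    exact h1.symm
  refine ⟨Equiv.ofFiberEquiv fun c => (hc c).some, funext fun i => ?_⟩
  exact Equiv.ofFiberEquiv_map _ i

/-- Here s stands for the constant eigenvalues of a padded torus and k for the common multiplicity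
of the others. -/
theorem eq_of_add_nsmul_eq {α : Type*} {s u v : Multiset α} {k : ℕ} (hk : k ≠ 0)
    (h : s + k • u = s + k • v) : u = v := by
  classical
  have h1 := add_left_cancel h
  ext a
  have h2 := congrArg (Multiset.count a) h1
  rw [Multiset.count_nsmul, Multiset.count_nsmul] at h2
  exact Nat.eq_of_mul_eq_mul_left (Nat.pos_of_ne_zero hk) h2

theorem complexEigenvalues_fromBlocks (X : Matrix m m 𝕜) (Y : Matrix n n 𝕜) :
    complexEigenvalues (fromBlocks X 0 0 Y) = complexEigenvalues X + complexEigenvalues Y := by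
  unfold complexEigenvalues
  rw [charpoly_fromBlocks_zero₁₂, Polynomial.aroots_def, Polynomial.map_mul, Polynomial.roots_mul]
  · exact mul_ne_zero ((charpoly_monic X).map _).ne_zero ((charpoly_monic Y).map _).ne_zero

theorem complexEigenvalues_reindex (e : m ≃ n) (X : Matrix m m 𝕜) :
    complexEigenvalues (reindex e e X) = complexEigenvalues X := by
  unfold complexEigenvalues
  rw [charpoly_reindex]

theorem complexEigenvalues_eq_roots (X : Matrix n n 𝕜) :
    complexEigenvalues X = (X.map (algebraMap 𝕜 ℂ)).charpoly.roots := by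
  unfold complexEigenvalues
  rw [Polynomial.aroots_def, ← charpoly_map]

theorem roots_charpoly_diagonal (d : n → ℂ) :
    (diagonal d).charpoly.roots = Finset.univ.val.map d := by
  rw [charpoly_diagonal, Polynomial.roots_prod _ _
    (Finset.prod_ne_zero_iff.2 fun i _ => Polynomial.X_sub_C_ne_zero _)]
  simp [Polynomial.roots_X_sub_C, Multiset.bind_singleton]

theorem complexEigenvalues_eq_charpoly_roots (X : Matrix n n ℂ) :
    complexEigenvalues X = X.charpoly.roots := by
  rw [complexEigenvalues_eq_roots]
  congr 2

theorem complexEigenvalues_diagonal (d : n → ℂ) :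
    complexEigenvalues (diagonal d) = Finset.univ.val.map d :=
  (complexEigenvalues_eq_charpoly_roots _).trans (roots_charpoly_diagonal d)

theorem complexEigenvalues_one :
    complexEigenvalues (1 : Matrix n n 𝕜) = Multiset.replicate (Fintype.card n) 1 := by
  rw [complexEigenvalues_eq_roots, Matrix.map_one _ (map_zero _) (map_one _), ← diagonal_one,
    roots_charpoly_diagonal, Multiset.map_const']
  rfl

/-- Over ℂ the rotation is diagonalized with eigenvalues λ_j and their conjugates. Passing to real
parts merges the two halves and loses nothing, since a point of the circle is determined by its real
part up to conjugation. -/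
theorem re_complexEigenvalues_rotation (h𝕜 : ∀ r : ℝ, algebraMap 𝕜 ℂ (r : 𝕜) = r) {R : ℕ}
    (l : Fin R → Circle) :
    (complexEigenvalues (rotationMatrix 𝕜 l)).map Complex.re =
      2 • Finset.univ.val.map fun j => (l j : ℂ).re := by
  let D : Matrix (Fin R ⊕ Fin R) (Fin R ⊕ Fin R) ℂ := fromBlocks (diagonal fun j => (l j : ℂ)) 0 0
    (diagonal fun j => (starRingEnd ℂ) (l j))
  let P : Matrix (Fin R ⊕ Fin R) (Fin R ⊕ Fin R) ℂ :=
    fromBlocks 1 1 (-diagonal fun _ => Complex.I) (diagonal fun _ => Complex.I)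
  let Q : Matrix (Fin R ⊕ Fin R) (Fin R ⊕ Fin R) ℂ :=
    fromBlocks (diagonal fun _ => 1 / 2) (diagonal fun _ => Complex.I / 2)
      (diagonal fun _ => 1 / 2) (-diagonal fun _ => Complex.I / 2)
  have hQP : Q * P = 1 := by
    rw [fromBlocks_multiply, ← fromBlocks_one]
    congr 1 <;> ext i j <;> rcases eq_or_ne i j with rfl | h <;>
      simp [diagonal_mul_diagonal, *, div_mul_eq_mul_div] <;> norm_num
  have hPD : (rotationMatrix 𝕜 l).map (algebraMap 𝕜 ℂ) = P * (D * Q) := by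
    rw [fromBlocks_multiply, fromBlocks_multiply, rotationMatrix, fromBlocks_map]
    congr 1 <;> ext i j <;> by_cases h : i = j <;>
      simp [diagonal_mul_diagonal, h, h𝕜, Complex.ext_iff] <;> ring_nf
  -- The characteristic polynomials of P (D Q) and (D Q) P agree, and Q P = 1.
  rw [complexEigenvalues_eq_roots, hPD, Matrix.charpoly_mul_comm, mul_assoc, hQP, mul_one]
  rw [← complexEigenvalues_eq_charpoly_roots, complexEigenvalues_fromBlocks,
    complexEigenvalues_diagonal, complexEigenvalues_diagonal, Multiset.map_add,
    Multiset.map_map, Multiset.map_map, two_nsmul]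
  rfl

theorem re_complexEigenvalues_padded (h𝕜 : ∀ r : ℝ, algebraMap 𝕜 ℂ (r : 𝕜) = r) (L : ℕ) {R : ℕ}
    (l : Fin R → Circle) :
    (complexEigenvalues (paddedRotation 𝕜 L l)).map Complex.re =
      Multiset.replicate L 1 + 2 • Finset.univ.val.map fun j => (l j : ℂ).re := by
  rw [paddedRotation, complexEigenvalues_fromBlocks, Multiset.map_add,
    re_complexEigenvalues_rotation h𝕜, complexEigenvalues_one]
  simp

theorem re_complexEigenvalues_grouped (h𝕜 : ∀ r : ℝ, algebraMap 𝕜 ℂ (r : 𝕜) = r) (L : ℕ) {R : ℕ}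
    (l : Fin R → Circle) :
    (complexEigenvalues (groupedRotation 𝕜 L l)).map Complex.re =
      Multiset.replicate L 1 + 2 • Finset.univ.val.map fun j => (l j : ℂ).re := by
  rw [groupedRotation, complexEigenvalues_reindex, re_complexEigenvalues_padded h𝕜]

/-- Angles with the same cosines agree up to a permutation and signs. -/
theorem exists_signed_perm {R : ℕ} {l m : Fin R → Circle}
    (h : (Finset.univ.val.map fun j => (l j : ℂ).re) = Finset.univ.val.map fun j => (m j : ℂ).re) :
    ∃ (σ : Equiv.Perm (Fin R)) (ε : Fin R → ℝ), (∀ j, ε j = 1 ∨ ε j = -1) ∧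
      (∀ j, (l (σ j) : ℂ).re = (m j : ℂ).re) ∧ ∀ j, (m j : ℂ).im = ε j * (l (σ j) : ℂ).im := by
  obtain ⟨σ, hσ⟩ := exists_perm_of_map_eq h
  have hre : ∀ j, (l (σ j) : ℂ).re = (m j : ℂ).re := fun j => congrFun hσ j
  have hsq : ∀ z : Circle, (z : ℂ).re * (z : ℂ).re + (z : ℂ).im * (z : ℂ).im = 1 := fun z => by
    have := Circle.normSq_coe z
    rwa [Complex.normSq_apply] at this
  have him : ∀ j, ∃ e : ℝ, (e = 1 ∨ e = -1) ∧ (m j : ℂ).im = e * (l (σ j) : ℂ).im := fun j => by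
    have h1 := hsq (l (σ j))
    have h2 := hsq (m j)
    rw [hre j] at h1
    rcases mul_self_eq_mul_self_iff.1 
        (show (m j : ℂ).im * (m j : ℂ).im = (l (σ j) : ℂ).im * (l (σ j) : ℂ).im by linarith) with
      h3 | h3
    · exact ⟨1, Or.inl rfl, by rw [one_mul]; exact h3⟩
    · exact ⟨-1, Or.inr rfl, by rw [neg_one_mul]; exact h3⟩
  choose ε hε using him
  exact ⟨σ, ε, fun j => (hε j).1, hre, fun j => (hε j).2⟩

end Eigenvalues

/-! ### Monomial matrices -/

section Monomial

variable {n : Type} [Fintype n] [DecidableEq n] {𝕜 : Type} [RCLike 𝕜]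

/-- The matrix with entries `c i` at `(i, σ i)`. -/
def monomialMatrix (σ : Equiv.Perm n) (c : n → 𝕜) : Matrix n n 𝕜 :=
  of fun i j => if j = σ i then c i else 0

/-- The weights on the two sides may differ: the off-diagonal blocks of a rotation meet different
monomial matrices on the left and on the right. -/
theorem monomial_conj_diagonal (σ : Equiv.Perm n) (c d x : n → 𝕜) :
    monomialMatrix σ c * diagonal x * (monomialMatrix σ d)ᴴ =
      diagonal fun i => c i * x (σ i) * star (d i) := by
  ext i j
  rw [mul_apply]
  simp only [mul_diagonal, monomialMatrix, of_apply, conjTranspose_apply, ite_mul, zero_mul,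
    Finset.sum_ite_eq', Finset.mem_univ, if_true, diagonal_apply, EmbeddingLike.apply_eq_iff_eq]
  by_cases h : i = j
  · subst h; simp
  · simp [h]

theorem monomialMatrix_mem (σ : Equiv.Perm n) {c : n → 𝕜} (hc : ∀ i, c i * star (c i) = 1) :
    monomialMatrix σ c ∈ unitaryGroup n 𝕜 := by
  rw [mem_unitaryGroup_iff, star_eq_conjTranspose]
  have := monomial_conj_diagonal σ c c (fun _ => 1)
  rw [diagonal_one, mul_one] at this
  rw [this, ← diagonal_one]
  congr 1
  funext i
  rw [mul_one, hc]

theorem monomial_conj_neg_diagonal (σ : Equiv.Perm n) (c d x : n → 𝕜) :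
    monomialMatrix σ c * (-diagonal x) * (monomialMatrix σ d)ᴴ =
      -diagonal fun i => c i * x (σ i) * star (d i) := by
  rw [mul_neg, neg_mul, monomial_conj_diagonal]

end Monomial
end

noncomputable section

/-! ### The ambient algebras -/

section Ambient

variable {n : Type} [Fintype n]

theorem map_conj_mul (X Y : Matrix n n ℂ) :
    (X * Y).map (starRingEnd ℂ) = X.map (starRingEnd ℂ) * Y.map (starRingEnd ℂ) :=
  Matrix.map_mul

omit [Fintype n] in
theorem star_map_conj (X : Matrix n n ℂ) : (star X).map (starRingEnd ℂ) = Xᵀ := by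
  ext i j; simp [star_eq_conjTranspose]

omit [Fintype n] in
theorem star_transpose_eq_map_conj (X : Matrix n n ℂ) : star Xᵀ = X.map (starRingEnd ℂ) := by
  ext i j; simp

omit [Fintype n] in
theorem map_conj_map_conj (X : Matrix n n ℂ) :
    (X.map (starRingEnd ℂ)).map (starRingEnd ℂ) = X := by
  ext i j; simp

variable [DecidableEq n] {𝕜 : Type} [RCLike 𝕜]

theorem linearInvolution_top {Ω : unitaryGroup n 𝕜 →* unitaryGroup n 𝕜}
    {θ : Matrix n n 𝕜 →⋆ₐ[ℝ] Matrix n n 𝕜} (h1 : ∀ g, (Ω g).1 = θ g.1)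
    (h2 : ∀ x, θ (θ x) = x) : LinearInvolution ⊤ Ω ⊤ θ where
  coe_map := h1
  involutive := h2
  algebra_map_mem _ _ := StarSubalgebra.mem_top
  inv_mem _ _ := StarSubalgebra.mem_top
  coe_mem _ _ := StarSubalgebra.mem_top
  isClosed := isClosed_univ
  nhds_one := ⟨Set.univ, isOpen_univ, trivial, fun _ _ _ => Subgroup.mem_top _⟩
  map_mem _ _ := Subgroup.mem_top _

/-- The matrices `X` with `X B = B conj(X)`. -/
def symplecticAlgebra (B : unitaryGroup n ℂ) : StarSubalgebra ℝ (Matrix n n ℂ) where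
  carrier := {X | X * B.1 = B.1 * X.map (starRingEnd ℂ)}
  mul_mem' {X Y} hX hY := by
    change X * Y * B.1 = B.1 * (X * Y).map (starRingEnd ℂ)
    change X * B.1 = _ at hX
    change Y * B.1 = _ at hY
    rw [map_conj_mul, mul_assoc, hY, ← mul_assoc, hX, mul_assoc]
  add_mem' {X Y} hX hY := by
    change (X + Y) * B.1 = B.1 * (mapConjStarHom n (X + Y))
    rw [map_add, add_mul, mul_add]
    exact congrArg₂ _ hX hY
  algebraMap_mem' r := by
    change _ * B.1 = B.1 * (mapConjStarHom n _)
    rw [AlgHomClass.commutes, Algebra.commutes]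
  star_mem' {X} hX := by
    change X * B.1 = _ at hX
    change star X * B.1 = B.1 * (star X).map (starRingEnd ℂ)
    rw [star_map_conj]
    have h1 := congrArg star hX
    rw [star_mul, star_mul] at h1
    have h2 : star (X.map (starRingEnd ℂ)) = Xᵀ := by
      rw [← star_transpose_eq_map_conj, star_star]
    rw [h2] at h1
    have h3 := mem_unitaryGroup_iff.1 B.2
    have h4 := mem_unitaryGroup_iff'.1 B.2
    calc star X * B.1 = B.1 * (star B.1 * star X) * B.1 := by rw [← mul_assoc, h3, one_mul]
      _ = B.1 * Xᵀ := by rw [h1, mul_assoc, mul_assoc, h4, mul_one]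

theorem mem_symplecticAlgebra {B : unitaryGroup n ℂ} {X : Matrix n n ℂ} :
    X ∈ symplecticAlgebra B ↔ X * B.1 = B.1 * X.map (starRingEnd ℂ) := Iff.rfl

/-- For unitary g the conjugate of g inverts gᵀ, so the quadratic condition g B gᵀ = B becomes
real-linear in g. This is what places the group inside a real *-algebra. -/
theorem mem_compactSymplectic {B : Matrix n n ℂ} {g : unitaryGroup n ℂ} :
    g ∈ compactSymplectic B ↔ g.1 * B = B * g.1.map (starRingEnd ℂ) := by
  have h1 : g.1ᵀ * g.1.map (starRingEnd ℂ) = 1 := by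
    have := congrArg (fun X : Matrix n n ℂ => X.map (starRingEnd ℂ)) (mem_unitaryGroup_iff'.1 g.2)
    rw [map_conj_mul, star_map_conj] at this
    rw [this]; simp
  have h2 := mul_eq_one_comm.1 h1
  change g.1 * B * g.1ᵀ = B ↔ _
  constructor
  · intro h
    calc g.1 * B = g.1 * B * g.1ᵀ * g.1.map (starRingEnd ℂ) := by rw [mul_assoc _ g.1ᵀ, h1, mul_one]
      _ = _ := by rw [h]
  · intro h
    rw [h, mul_assoc, h2, mul_one]

theorem linearInvolution_symplectic {B : unitaryGroup n ℂ}
    {Ω : unitaryGroup n ℂ →* unitaryGroup n ℂ} {θ : Matrix n n ℂ →⋆ₐ[ℝ] Matrix n n ℂ}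
    (h1 : ∀ g, (Ω g).1 = θ g.1) (h2 : ∀ x, θ (θ x) = x)
    (h3 : ∀ x ∈ symplecticAlgebra B, θ x ∈ symplecticAlgebra B) :
    LinearInvolution (compactSymplectic B.1) Ω (symplecticAlgebra B) θ where
  coe_map := h1
  involutive := h2
  algebra_map_mem := h3
  inv_mem X hX := by
    by_cases hu : IsUnit X
    · have hd := (isUnit_iff_isUnit_det _).1 hu
      rw [mem_symplecticAlgebra] at hX ⊢
      have h4 : (X⁻¹).map (starRingEnd ℂ) * X.map (starRingEnd ℂ) = 1 := by
        rw [← map_conj_mul, nonsing_inv_mul _ hd]; simp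
      have h5 := mul_eq_one_comm.1 h4
      calc X⁻¹ * B.1 = X⁻¹ * (B.1 * (X.map (starRingEnd ℂ) * (X⁻¹).map (starRingEnd ℂ))) := by
            rw [h5, mul_one]
        _ = X⁻¹ * X * B.1 * (X⁻¹).map (starRingEnd ℂ) := by
            rw [← mul_assoc B.1, ← hX]; simp only [mul_assoc]
        _ = _ := by rw [nonsing_inv_mul _ hd, one_mul]
    -- The inverse of a singular matrix is 0 by convention, which lies in the algebra.
    · rw [nonsing_inv_apply_not_isUnit _ (fun h => hu ((isUnit_iff_isUnit_det _).2 h))]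
      exact zero_mem _
  coe_mem g hg := mem_symplecticAlgebra.2 (mem_compactSymplectic.1 hg)
  isClosed := by
    have : (compactSymplectic B.1 : Set (unitaryGroup n ℂ)) =
        {g | g.1 * B.1 * g.1ᵀ = B.1} := rfl
    rw [this]
    exact isClosed_eq (by fun_prop) continuous_const
  nhds_one := ⟨Set.univ, isOpen_univ, trivial, fun g _ h => mem_compactSymplectic.2 h⟩
  map_mem g hg := by
    rw [mem_compactSymplectic, h1]
    exact h3 _ (mem_compactSymplectic.1 hg)

/-- On unitary matrices inverse transposition is entrywise conjugation, which extends to the whole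
matrix algebra. -/
theorem coe_transposeInvHom (g : unitaryGroup n ℂ) :
    (transposeInvHom n g).1 = mapConjStarHom n g.1 :=
  star_transpose_eq_map_conj g.1

theorem mapConj_involutive (X : Matrix n n ℂ) :
    mapConjStarHom n (mapConjStarHom n X) = X := map_conj_map_conj X

/-- Distinct positive parameters. -/
def regularParam {R : ℕ} (j : Fin R) : ℝ := (j : ℝ) + 1

theorem regularParam_pos {R : ℕ} (j : Fin R) : 0 < regularParam j := by
  unfold regularParam; positivity

theorem regularParam_injective {R : ℕ} : Function.Injective (regularParam : Fin R → ℝ) := by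
  intro i j h
  unfold regularParam at h
  exact Fin.ext (by exact_mod_cast add_right_cancel h)

end Ambient

theorem circle_mem_unitary (z : Circle) : (z : ℂ) ∈ unitary ℂ := by
  rw [Unitary.mem_iff, RCLike.star_def, ← Circle.coe_inv_eq_conj, ← Circle.coe_mul,
    ← Circle.coe_mul, inv_mul_cancel, mul_inv_cancel, Circle.coe_one]
  exact ⟨rfl, rfl⟩

/-! ### Symmetric unitary matrices -/

section AI

variable (N : ℕ)

theorem linearInvolution_AI : LinearInvolution (⊤ : Subgroup (unitaryGroup (Fin N) ℂ))
    (transposeInvHom (Fin N)) ⊤ (mapConjStarHom (Fin N)) :=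
  linearInvolution_top coe_transposeInvHom mapConj_involutive

/-- The commutator multiplies the entry (i, j) by i(t_j - t_i), which is nonzero off the diagonal.
-/
theorem commute_diagonal_entry {ι : Type} [Fintype ι] [DecidableEq ι] {Z : Matrix ι ι ℂ}
    {t : ι → ℝ} (ht : Function.Injective t)
    (hc : Z * (diagonal fun j => (t j : ℂ) * Complex.I) =
      (diagonal fun j => (t j : ℂ) * Complex.I) * Z) {i j : ι} (h : i ≠ j) : Z i j = 0 := by
  have h1 := congrFun (congrFun hc i) j
  rw [mul_diagonal, diagonal_mul] at h1
  have h2 : Z i j * (((t j - t i : ℝ) : ℂ) * Complex.I) = 0 := by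
    push_cast; linear_combination h1
  refine (mul_eq_zero.1 h2).resolve_right (mul_ne_zero ?_ Complex.I_ne_zero)
  exact_mod_cast sub_ne_zero.2 fun h3 => h (ht h3).symm

theorem regularTorus_AI : RegularTorus ⊤ (mapConjStarHom (Fin N)) (diagTorus N) where
  mem _ := StarSubalgebra.mem_top
  map_star x := by
    rw [diagTorus_apply, diagTorus_apply]
    ext i j
    by_cases h : i = j <;> simp [mapConjStarHom, h]
  eq_zero z h := diagonal_eq_zero.1 h
  regular := by
    refine ⟨regularParam, fun Z hZ hc => ⟨fun j => (Z j j).im, ?_⟩⟩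
    rw [diagTorus_apply]
    ext i j
    by_cases h : i = j
    · subst h
      -- Oddness says that the conjugate of Z is -Z, so the diagonal entries are imaginary.
      have h1 := congrArg Complex.re (congrFun (congrFun hZ.2.2 i) i)
      simp [mapConjStarHom] at h1
      apply Complex.ext
      · simp [imagPoint]; linarith
      · simp [imagPoint]
    · rw [diagonal_apply_ne _ h]
      exact commute_diagonal_entry regularParam_injective hc h

theorem symmetricEnsemble_AI : SymmetricEnsemble (⊤ : Subgroup (unitaryGroup (Fin N) ℂ))
    (transposeInvHom (Fin N)) (ensembleAI (Fin N)) where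
  one_mem := ⟨one_mem _, transpose_one⟩
  exists_eq H hH := by
    refine ⟨⟨H, hH.1⟩, Subgroup.mem_top _, rfl, ?_⟩
    apply Subtype.ext
    change star Hᵀ = star H
    rw [hH.2]
  twisted_mem g _ H hH := by
    change g.1 * H * star (star g.1ᵀ) ∈ _
    have h : g.1ᵀ ∈ unitaryGroup (Fin N) ℂ := (UnitaryGroup.transpose g).2
    rw [star_star]
    refine ⟨mul_mem (mul_mem g.2 hH.1) h, ?_⟩
    rw [transpose_mul, transpose_mul, transpose_transpose, hH.2, mul_assoc]
  mem_closure H hH hu := by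
    refine mem_closure_of_phases (fun z => ⟨?_, ?_⟩) hu
    · exact Unitary.smul_mem_of_mem (circle_mem_unitary z) hH.1
    · rw [transpose_smul, hH.2]

theorem mem_range_complexifyHom {n : Type} [Fintype n] [DecidableEq n] (g : unitaryGroup n ℂ) :
    g ∈ (complexifyHom n).range ↔ g.1.map (starRingEnd ℂ) = g.1 := by
  constructor
  · rintro ⟨h, rfl⟩
    ext i j
    simp [complexifyHom]
  · intro h
    have h1 : (g.1.map Complex.re).map Complex.ofRealHom = g.1 := by
      ext i j
      exact Complex.conj_eq_iff_re.1 (congrFun (congrFun h i) j)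
    have h2 : g.1.map Complex.re ∈ unitaryGroup n ℝ := by
      rw [mem_unitaryGroup_iff]
      apply Matrix.map_injective Complex.ofReal_injective
      have h3 : star (g.1.map Complex.re) = (g.1.map Complex.re)ᵀ := by
        ext i j; simp
      have h4 := mem_unitaryGroup_iff.1 g.2
      have h5 : star g.1 = g.1ᵀ := by
        rw [← star_transpose_eq_map_conj] at h
        rw [← congrArg transpose h]
        ext i j; simp
      change ((g.1.map Complex.re) * star (g.1.map Complex.re)).map Complex.ofRealHom =
        (1 : Matrix n n ℝ).map Complex.ofRealHom
      have h6 : ((g.1.map Complex.re)ᵀ).map Complex.ofRealHom = g.1ᵀ := congrArg transpose h1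
      rw [Matrix.map_mul, h1, h3, h6, ← h5, h4]
      simp
    exact ⟨⟨_, h2⟩, Subtype.ext h1⟩

theorem isMatrixRealization_AI : IsMatrixRealization (⊤ : Subgroup (unitaryGroup (Fin N) ℂ))
    (complexifyHom (Fin N)).range (transposeInvHom (Fin N))
    (ensembleAI (Fin N)) (torusAI N) N := by
  refine (linearInvolution_AI N).isMatrixRealization (regularTorus_AI N) (symmetricEnsemble_AI N)
    (fun g => ?_) rfl (fun l m h => ?_)
  · rw [mem_range_complexifyHom, Subtype.ext_iff, coe_transposeInvHom]
    exact ⟨fun h => ⟨Subgroup.mem_top _, h⟩, fun h => h.2⟩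
  · rw [diagTorus_apply, diagTorus_apply, complexEigenvalues_diagonal,
      complexEigenvalues_diagonal] at h
    obtain ⟨σ, hσ⟩ := exists_perm_of_map_eq h
    have hk : monomialMatrix σ (fun _ => (1 : ℂ)) ∈ unitaryGroup (Fin N) ℂ :=
      monomialMatrix_mem σ (by simp)
    refine ⟨⟨_, hk⟩, (mem_range_complexifyHom _).2 ?_, ?_⟩
    · ext i j
      simp [monomialMatrix, apply_ite (starRingEnd ℂ)]
    · rw [diagTorus_apply, diagTorus_apply]
      change _ * _ * (monomialMatrix σ _)ᴴ = _
      rw [monomial_conj_diagonal, ← hσ]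
      simp [Function.comp_def]

end AI
end

noncomputable section

/-! ### Self-dual unitary matrices -/

section AII

theorem J_eq (n : Type) [DecidableEq n] (𝕜 : Type) [RCLike 𝕜] :
    J n 𝕜 = fromBlocks 0 (-1) 1 0 := rfl

theorem star_J (n : Type) [DecidableEq n] (𝕜 : Type) [RCLike 𝕜] : star (J n 𝕜) = -J n 𝕜 := by
  rw [J_eq, star_eq_conjTranspose, fromBlocks_conjTranspose, fromBlocks_neg]
  simp

theorem map_conj_J (n : Type) [DecidableEq n] : (J n ℂ).map (starRingEnd ℂ) = J n ℂ := by
  rw [J_eq, fromBlocks_map]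
  congr 1 <;> ext i j <;> simp [one_apply, apply_ite (starRingEnd ℂ)]

variable {n : Type} [Fintype n] [DecidableEq n]

variable (n) in
/-- `X ↦ J conj(X) J⁻¹`. -/
def dualConjStarHom : Matrix (n ⊕ n) (n ⊕ n) ℂ →⋆ₐ[ℝ] Matrix (n ⊕ n) (n ⊕ n) ℂ :=
  (unitaryConjStarHom (unitaryJ n ℂ)).comp (mapConjStarHom (n ⊕ n))

theorem dualConj_apply (X : Matrix (n ⊕ n) (n ⊕ n) ℂ) :
    dualConjStarHom n X = J n ℂ * X.map (starRingEnd ℂ) * -J n ℂ := by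
  rw [← star_J]; rfl

theorem dualConj_fromBlocks (a b c d : Matrix n n ℂ) :
    dualConjStarHom n (fromBlocks a b c d) = fromBlocks (d.map (starRingEnd ℂ))
      (-c.map (starRingEnd ℂ)) (-b.map (starRingEnd ℂ)) (a.map (starRingEnd ℂ)) := by
  rw [dualConj_apply, fromBlocks_map, J_eq, fromBlocks_neg, fromBlocks_multiply,
    fromBlocks_multiply]
  simp

theorem dualConj_involutive (X : Matrix (n ⊕ n) (n ⊕ n) ℂ) :
    dualConjStarHom n (dualConjStarHom n X) = X := by
  conv_rhs => rw [← fromBlocks_toBlocks X]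
  rw [← fromBlocks_toBlocks X, dualConj_fromBlocks, dualConj_fromBlocks]
  congr 1 <;> ext i j <;> simp

theorem linearInvolution_AII (N : ℕ) :
    LinearInvolution (⊤ : Subgroup (unitaryGroup (Fin N ⊕ Fin N) ℂ))
    ((conjByHom (unitaryJ (Fin N) ℂ)).comp (transposeInvHom (Fin N ⊕ Fin N))) ⊤
    (dualConjStarHom (Fin N)) := by
  refine linearInvolution_top (fun g => ?_) dualConj_involutive
  change (unitaryJ (Fin N) ℂ).1 * (transposeInvHom _ g).1 * star (unitaryJ (Fin N) ℂ).1 = _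
  rw [coe_transposeInvHom]
  rfl

theorem regularTorus_AII (N : ℕ) :
    RegularTorus ⊤ (dualConjStarHom (Fin N)) (doubleDiagTorus N) where
  mem _ := StarSubalgebra.mem_top
  map_star x := by
    rw [doubleDiagTorus_apply, doubleDiagTorus_apply, dualConj_fromBlocks]
    congr 1 <;> ext i j <;> by_cases h : i = j <;> simp [h]
  eq_zero z h := by
    rw [doubleDiagTorus_apply, ← fromBlocks_zero, fromBlocks_inj] at h
    exact diagonal_eq_zero.1 h.1
  regular := by
    refine ⟨regularParam, fun Z hZ hc => ?_⟩
    obtain ⟨a, b, c, d, rfl⟩ : ∃ a b c d, Z = fromBlocks a b c d :=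
      ⟨_, _, _, _, (fromBlocks_toBlocks Z).symm⟩
    obtain ⟨-, h1, h2⟩ := hZ
    rw [star_eq_conjTranspose, fromBlocks_conjTranspose, fromBlocks_neg, fromBlocks_inj] at h1
    rw [dualConj_fromBlocks, fromBlocks_neg, fromBlocks_inj] at h2
    rw [doubleDiagTorus_apply] at hc
    have hc' : _ * _ = _ * _ := hc
    rw [fromBlocks_multiply, fromBlocks_multiply, fromBlocks_inj] at hc'
    simp only [Matrix.mul_zero, Matrix.zero_mul, add_zero, zero_add] at hc'
    refine ⟨fun j => (a j j).im, ?_⟩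
    have hz : ∀ {Y : Matrix (Fin N) (Fin N) ℂ}, Y * (diagonal (imagPoint regularParam).2) =
        (diagonal (imagPoint regularParam).2) * Y → ∀ {i j}, i ≠ j → Y i j = 0 :=
      fun hY _ _ => commute_diagonal_entry regularParam_injective hY
    have ha : ∀ i, (a i i).re = 0 := fun i => by
      have := congrArg Complex.re (congrFun (congrFun h1.1 i) i)
      simp at this; linarith
    -- Oddness makes the conjugate of d i i equal to -a i i, and skewness makes it -d i i.
    have hd : ∀ i, d i i = a i i := fun i => by
      have h3 := congrFun (congrFun h2.1 i) i
      have h4 := congrFun (congrFun h1.2.2.2 i) i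
      have h5 := ha i
      simp only [map_apply, conjTranspose_apply, Matrix.neg_apply, RCLike.star_def] at h3 h4
      rw [h4, neg_inj] at h3
      exact h3
    -- The conjugate of c i i equals -b i i by skewness and b i i by oddness, so both entries
    -- vanish.
    have hbc : ∀ i, b i i = 0 ∧ c i i = 0 := fun i => by
      have h3 := congrFun (congrFun h1.2.1 i) i
      have h4 := congrFun (congrFun h2.2.1 i) i
      simp only [map_apply, conjTranspose_apply, Matrix.neg_apply, RCLike.star_def] at h3 h4
      have h5 : c i i = 0 := by
        have h6 : (starRingEnd ℂ) (c i i) = 0 := by linear_combination (1 / 2 : ℂ) * (h3 - h4)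
        simpa using h6
      rw [h5] at h3
      refine ⟨?_, h5⟩
      rw [map_zero] at h3
      exact neg_eq_zero.1 h3.symm
    rw [doubleDiagTorus_apply]
    congr 1 <;> ext i j <;> by_cases h : i = j
    · subst h
      apply Complex.ext
      · simp [imagPoint, ha]
      · simp [imagPoint]
    · rw [diagonal_apply_ne _ h, hz hc'.1 h]
    · subst h
      exact (hbc i).1
    · exact hz hc'.2.1 h
    · subst h
      exact (hbc i).2
    · exact hz hc'.2.2.1 h
    · subst h
      rw [hd]
      apply Complex.ext
      · simp [imagPoint, ha]
      · simp [imagPoint]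
    · rw [diagonal_apply_ne _ h, hz hc'.2.2.2 h]

theorem unitary_J_mul_J_transpose : J n ℂ * (J n ℂ)ᵀ = 1 := by
  rw [J_transpose, mul_neg, J_squared, neg_neg]

theorem J_transpose_mul_J : (J n ℂ)ᵀ * J n ℂ = 1 := by
  rw [J_transpose, neg_mul, J_squared, neg_neg]

theorem symmetricEnsemble_AII (N : ℕ) :
    SymmetricEnsemble (⊤ : Subgroup (unitaryGroup (Fin N ⊕ Fin N) ℂ))
    ((conjByHom (unitaryJ (Fin N) ℂ)).comp (transposeInvHom (Fin N ⊕ Fin N)))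
    (ensembleAII (Fin N)) where
  one_mem := ⟨one_mem _, by rw [transpose_one, mul_one, unitary_J_mul_J_transpose]⟩
  exists_eq H hH := by
    refine ⟨⟨H, hH.1⟩, Subgroup.mem_top _, rfl, ?_⟩
    apply Subtype.ext
    rw [(linearInvolution_AII N).coe_map, dualConj_apply, ← star_J, ← star_transpose_eq_map_conj]
    change _ = star H
    have h1 := congrArg star hH.2
    rw [star_mul, star_mul, J_transpose, star_neg, star_J, neg_neg] at h1
    rw [star_J, ← h1]
    noncomm_ring
  twisted_mem g _ H hH := by
    have h1 : (((conjByHom (unitaryJ (Fin N) ℂ)).comp (transposeInvHom (Fin N ⊕ Fin N)) g)⁻¹).1 =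
        J (Fin N) ℂ * g.1ᵀ * (J (Fin N) ℂ)ᵀ := by
      rw [← map_inv]
      change (unitaryJ (Fin N) ℂ).1 * (transposeInvHom _ g⁻¹).1 * star (unitaryJ (Fin N) ℂ).1 = _
      rw [coe_transposeInvHom, J_transpose, ← star_J]
      change _ * (star g.1).map (starRingEnd ℂ) * _ = _
      rw [star_map_conj]
      rfl
    refine ⟨mul_mem (mul_mem g.2 hH.1) (Subtype.property _), ?_⟩
    rw [h1]
    simp only [transpose_mul, transpose_transpose]
    calc J (Fin N) ℂ * (J (Fin N) ℂ * (g.1 * (J (Fin N) ℂ)ᵀ) * (Hᵀ * g.1ᵀ)) * (J (Fin N) ℂ)ᵀ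
        = (J (Fin N) ℂ * J (Fin N) ℂ) * (g.1 * (J (Fin N) ℂ)ᵀ) * Hᵀ *
            ((J (Fin N) ℂ)ᵀ * J (Fin N) ℂ) * g.1ᵀ * (J (Fin N) ℂ)ᵀ := by
          rw [J_transpose_mul_J]; simp only [mul_assoc, one_mul]
      _ = g.1 * (J (Fin N) ℂ * Hᵀ * (J (Fin N) ℂ)ᵀ) * (J (Fin N) ℂ * g.1ᵀ * (J (Fin N) ℂ)ᵀ) := by
          rw [J_squared, J_transpose]; noncomm_ring
      _ = _ := by rw [hH.2]
  mem_closure H hH hu := by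
    refine mem_closure_of_phases (fun z => ⟨?_, ?_⟩) hu
    · exact Unitary.smul_mem_of_mem (circle_mem_unitary z) hH.1
    · rw [transpose_smul, mul_smul_comm, smul_mul_assoc, hH.2]

theorem isMatrixRealization_AII (N : ℕ) :
    IsMatrixRealization (⊤ : Subgroup (unitaryGroup (Fin N ⊕ Fin N) ℂ))
    (compactSymplectic (J (Fin N) ℂ))
    ((conjByHom (unitaryJ (Fin N) ℂ)).comp (transposeInvHom (Fin N ⊕ Fin N)))
    (ensembleAII (Fin N)) (torusAII N) N := by
  refine (linearInvolution_AII N).isMatrixRealization (regularTorus_AII N)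
    (symmetricEnsemble_AII N) (fun g => ?_) rfl (fun l m h => ?_)
  · rw [mem_compactSymplectic, Subtype.ext_iff, (linearInvolution_AII N).coe_map, dualConj_apply]
    constructor
    · intro h
      refine ⟨Subgroup.mem_top _, ?_⟩
      rw [← h, mul_assoc, mul_neg, J_squared, neg_neg, mul_one]
    · rintro ⟨-, h⟩
      conv_lhs => rw [← h]
      rw [mul_assoc, neg_mul, J_squared, neg_neg, mul_one]
  · rw [doubleDiagTorus_apply, doubleDiagTorus_apply, complexEigenvalues_fromBlocks,
      complexEigenvalues_fromBlocks, complexEigenvalues_diagonal,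
      complexEigenvalues_diagonal, ← two_nsmul, ← two_nsmul] at h
    -- This torus has no constant eigenvalues, hence the summand 0; every λ_j is counted twice.
    obtain ⟨σ, hσ⟩ := exists_perm_of_map_eq (eq_of_add_nsmul_eq two_ne_zero
      (congrArg (0 + ·) h))
    have hk : monomialMatrix σ (fun _ => (1 : ℂ)) ∈ unitaryGroup (Fin N) ℂ :=
      monomialMatrix_mem σ (by simp)
    refine ⟨blockDiagHom _ _ ℂ (⟨_, hk⟩, ⟨_, hk⟩), mem_compactSymplectic.2 ?_, ?_⟩
    · have h1 : (monomialMatrix σ fun _ => (1 : ℂ)).map (starRingEnd ℂ) =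
          monomialMatrix σ fun _ => (1 : ℂ) := by
        ext i j
        simp [monomialMatrix, apply_ite (starRingEnd ℂ)]
      simp [blockDiagHom, J_eq, fromBlocks_multiply, fromBlocks_map, h1]
    · rw [doubleDiagTorus_apply, doubleDiagTorus_apply]
      simp only [blockDiagHom, MonoidHom.coe_mk, OneHom.coe_mk, star_eq_conjTranspose,
        fromBlocks_conjTranspose, fromBlocks_multiply, conjTranspose_zero, Matrix.mul_zero,
        Matrix.zero_mul, add_zero, zero_add, monomial_conj_diagonal, ← hσ]
      simp [Function.comp_def]

end AII
end

noncomputable section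

/-! ### Hermitian involutions -/

section Involutions

variable {n : Type} [Fintype n] [DecidableEq n] {𝕜 : Type} [RCLike 𝕜]

/-- A unitary Hermitian matrix has only the eigenvalues 1 and -1, so its trace is the difference of
the two counts while their sum is the size. The signature is thereby replaced by a
conjugation-invariant linear quantity. -/
theorem hasSignature_iff {G : Matrix n n 𝕜} (hG : G ∈ unitaryGroup n 𝕜) {p q : ℕ}
    (hpq : p + q = Fintype.card n) :
    HasSignature G p q ↔ G.IsHermitian ∧ G.trace = (p : 𝕜) - q := by
  have key : ∀ h : G.IsHermitian,
      (Finset.univ.filter fun i => 0 < h.eigenvalues i).card +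
        (Finset.univ.filter fun i => h.eigenvalues i < 0).card = Fintype.card n ∧
      G.trace = ((Finset.univ.filter fun i => 0 < h.eigenvalues i).card : 𝕜) -
        (Finset.univ.filter fun i => h.eigenvalues i < 0).card := by
    intro h
    have hGG : G * G = 1 := by
      have := mem_unitaryGroup_iff.1 hG
      rwa [star_eq_conjTranspose, h.eq] at this
    have hev : ∀ i, h.eigenvalues i = 1 ∨ h.eigenvalues i = -1 := fun i => by
      have h1 := h.mulVec_eigenvectorBasis i
      have h2 : (h.eigenvectorBasis i).ofLp =
          (h.eigenvalues i * h.eigenvalues i) • (h.eigenvectorBasis i).ofLp := by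
        conv_lhs => rw [← one_mulVec (h.eigenvectorBasis i).ofLp, ← hGG, ← mulVec_mulVec, h1,
          mulVec_smul, h1, smul_smul]
      have h3 : (h.eigenvalues i * h.eigenvalues i - 1) • (h.eigenvectorBasis i).ofLp = 0 := by
        rw [sub_smul, one_smul, ← h2, sub_self]
      have h4 : (h.eigenvectorBasis i).ofLp ≠ 0 := fun h5 =>
        h.eigenvectorBasis.orthonormal.ne_zero i (WithLp.ofLp_injective 2 h5)
      exact mul_self_eq_one_iff.1 (sub_eq_zero.1 ((smul_eq_zero.1 h3).resolve_right h4))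
    have hneg : (Finset.univ.filter fun i => h.eigenvalues i < 0) =
        Finset.univ.filter fun i => ¬ 0 < h.eigenvalues i := by
      ext i
      rcases hev i with h1 | h1 <;> simp [h1] <;> norm_num
    have hcard := Finset.card_filter_add_card_filter_not (s := (Finset.univ : Finset n))
      (fun i => 0 < h.eigenvalues i)
    refine ⟨by rw [hneg, hcard, Finset.card_univ], ?_⟩
    rw [h.trace_eq_sum_eigenvalues, hneg, ← Finset.sum_filter_add_sum_filter_not Finset.univ
      (fun i => 0 < h.eigenvalues i), sub_eq_add_neg]
    congr 1
    · rw [Finset.sum_congr rfl (g := fun _ => (1 : 𝕜)), Finset.sum_const, nsmul_eq_mul, mul_one]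
      intro i hi
      rcases hev i with h1 | h1
      · simp [h1]
      · have := (Finset.mem_filter.1 hi).2
        rw [h1] at this; norm_num at this
    · rw [Finset.sum_congr rfl (g := fun _ => (-1 : 𝕜)), Finset.sum_const, nsmul_eq_mul,
        mul_neg_one]
      intro i hi
      rcases hev i with h1 | h1
      · have := (Finset.mem_filter.1 hi).2
        rw [h1] at this; norm_num at this
      · simp [h1]
  constructor
  · rintro ⟨h, h1, h2⟩
    refine ⟨h, ?_⟩
    rw [(key h).2, h1, h2]
  · rintro ⟨h, h1⟩
    obtain ⟨h2, h3⟩ := key h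
    rw [h1] at h3
    have h4 : (Finset.univ.filter fun i => 0 < h.eigenvalues i).card + q =
        p + (Finset.univ.filter fun i => h.eigenvalues i < 0).card := by
      have : (((Finset.univ.filter fun i => 0 < h.eigenvalues i).card + q : ℕ) : 𝕜) =
          (p + (Finset.univ.filter fun i => h.eigenvalues i < 0).card : ℕ) := by
        push_cast
        linear_combination -h3
      exact_mod_cast this
    exact ⟨h, by omega, by omega⟩

/-- (1 - A)/2 is a projection onto ker(A + 1), and the rank of a projection is its trace. -/
theorem finrank_ker_add_one_of_involution {A : Matrix n n 𝕜} (hA : A * A = 1) :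
    (Module.finrank 𝕜 (LinearMap.ker (A + 1).mulVecLin) : 𝕜) =
      (1 / 2 : 𝕜) * (Fintype.card n - A.trace) := by
  have hp : LinearMap.IsProj (LinearMap.ker (A + 1).mulVecLin)
      (((1 / 2 : 𝕜) • (1 - A)).mulVecLin) := by
    constructor
    · intro x
      change (A + 1) *ᵥ (((1 / 2 : 𝕜) • (1 - A)) *ᵥ x) = 0
      rw [mulVec_mulVec, mul_smul_comm, add_mul, mul_sub, hA]
      simp
    · intro x hx
      have hx' : (A + 1) *ᵥ x = 0 := hx
      rw [add_mulVec, one_mulVec] at hx'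
      change ((1 / 2 : 𝕜) • (1 - A)) *ᵥ x = x
      rw [smul_mulVec, sub_mulVec, one_mulVec, eq_neg_of_add_eq_zero_left hx']
      module
  rw [← hp.trace, ← toLin'_apply', trace_toLin'_eq, trace_smul, trace_sub, trace_one, smul_eq_mul]

theorem dotProduct_star_self_eq_zero' {x : n → 𝕜} (h : star x ⬝ᵥ x = 0) : x = 0 := by
  open scoped ComplexOrder in exact dotProduct_star_self_eq_zero.1 h

theorem star_dotProduct_mulVec {A : Matrix n n 𝕜} (hA : star A = A) (x y : n → 𝕜) :
    star x ⬝ᵥ (A *ᵥ y) = star (A *ᵥ x) ⬝ᵥ y := by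
  rw [star_mulVec, ← star_eq_conjTranspose, hA, dotProduct_mulVec]

/-- Two Hermitian involutions of the same trace that are opposite on some vector are also
opposite the other way round on another vector. -/
theorem exists_opposite_vector {A B : Matrix n n 𝕜} (hA : A * A = 1) (hB : B * B = 1)
    (hA' : star A = A) (hB' : star B = B) (htr : A.trace = B.trace) {x : n → 𝕜} (hx : x ≠ 0)
    (hAx : A *ᵥ x = -x) (hBx : B *ᵥ x = x) : ∃ y, y ≠ 0 ∧ A *ᵥ y = y ∧ B *ᵥ y = -y := by
  by_contra! hno
  -- A + B intertwines: (A + 1)(A + B) = (A + B)(B + 1). A kernel vector y of A + B with B y = -y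
  -- satisfies A y = y, which is what is sought, so in its absence A + B is injective on ker(B + 1).
  have hmaps : ∀ y ∈ LinearMap.ker (B + 1).mulVecLin,
      (A + B).mulVecLin y ∈ LinearMap.ker (A + 1).mulVecLin := by
    intro y hy
    have hy' : (B + 1) *ᵥ y = 0 := hy
    change (A + 1) *ᵥ ((A + B) *ᵥ y) = 0
    have : (A + 1) * (A + B) = (A + B) * (B + 1) := by
      simp only [add_mul, mul_add, hA, hB, mul_one, one_mul]; abel
    rw [mulVec_mulVec, this, ← mulVec_mulVec, hy', mulVec_zero]
  have hfin : Module.finrank 𝕜 (LinearMap.ker (B + 1).mulVecLin) =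
      Module.finrank 𝕜 (LinearMap.ker (A + 1).mulVecLin) := by
    have : (Module.finrank 𝕜 (LinearMap.ker (B + 1).mulVecLin) : 𝕜) =
        Module.finrank 𝕜 (LinearMap.ker (A + 1).mulVecLin) := by
      rw [finrank_ker_add_one_of_involution hA, finrank_ker_add_one_of_involution hB, htr]
    exact_mod_cast this
  have hinj : Function.Injective ((A + B).mulVecLin.restrict hmaps) := by
    rw [← LinearMap.ker_eq_bot, LinearMap.ker_eq_bot']
    rintro ⟨y, hy⟩ h
    have hy' : (B + 1) *ᵥ y = 0 := hy
    have h1 : (A + B) *ᵥ y = 0 := congrArg Subtype.val h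
    rw [add_mulVec, one_mulVec] at hy'
    have h2 := eq_neg_of_add_eq_zero_left hy'
    rw [add_mulVec, h2] at h1
    by_contra hne
    exact hno y (fun h3 => hne (Subtype.ext h3)) (eq_of_sub_eq_zero ((sub_eq_add_neg _ _).trans h1)) h2
  -- Equal traces give equal dimensions, so x = (A + B) y for some y. But (A + B) x = 0 and A + B is
  -- Hermitian, hence x is orthogonal to itself.
  obtain ⟨⟨y, hy⟩, hyx⟩ := (LinearMap.injective_iff_surjective_of_finrank_eq_finrank hfin).1 hinj
    ⟨x, by change (A + 1) *ᵥ x = 0; rw [add_mulVec, one_mulVec, hAx, neg_add_cancel]⟩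
  have h1 : (A + B) *ᵥ y = x := congrArg Subtype.val hyx
  apply hx
  apply dotProduct_star_self_eq_zero'
  have h2 := star_dotProduct_mulVec (A := A + B) (by rw [star_add, hA', hB']) x y
  rw [h1, add_mulVec, hAx, hBx, neg_add_cancel, star_zero, zero_dotProduct] at h2
  exact h2

/-- If `A B + 1` is singular for Hermitian involutions `A`, `B` of the same trace, then the
eigenspace of `A B` for `-1` contains eigenvectors of `B` of both signs. -/
theorem exists_eigenvectors_of_involutions {A B : Matrix n n 𝕜} (hA : A * A = 1) (hB : B * B = 1)
    (hA' : star A = A) (hB' : star B = B) (htr : A.trace = B.trace) (hu : ¬ IsUnit (A * B + 1)) :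
    ∃ v w, v ≠ 0 ∧ w ≠ 0 ∧ B *ᵥ v = v ∧ B *ᵥ w = -w ∧ (A * B) *ᵥ v = -v ∧ (A * B) *ᵥ w = -w := by
  have h0 : ∃ x, x ≠ 0 ∧ (A *ᵥ x = -x ∧ B *ᵥ x = x ∨ A *ᵥ x = x ∧ B *ᵥ x = -x) := by
    obtain ⟨x, hx, hx0⟩ : ∃ x, (A * B + 1) *ᵥ x = 0 ∧ x ≠ 0 := by
      by_contra! hno
      apply hu
      rw [← mulVec_injective_iff_isUnit]
      have hker : LinearMap.ker (A * B + 1).mulVecLin = ⊥ := LinearMap.ker_eq_bot'.2 hno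
      exact LinearMap.ker_eq_bot.1 hker
    rw [add_mulVec, one_mulVec] at hx
    have h1 := eq_neg_of_add_eq_zero_left hx
    have h2 : A *ᵥ x = -(B *ᵥ x) := by
      have h3 := congrArg (A *ᵥ ·) h1
      simp only [mulVec_mulVec, ← mul_assoc, hA, one_mul, mulVec_neg] at h3
      rw [h3, neg_neg]
    rw [← mulVec_mulVec] at h1
    -- Either B x = -x, or x + B x is a nonzero eigenvector of B for 1. In the second case A negates
    -- it, since A x = -B x and A B x = -x.
    by_cases hs : x + B *ᵥ x = 0
    · refine ⟨x, hx0, Or.inr ?_⟩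
      have h3 := eq_neg_of_add_eq_zero_right hs
      exact ⟨by rw [h2, h3, neg_neg], h3⟩
    · refine ⟨x + B *ᵥ x, hs, Or.inl ⟨?_, ?_⟩⟩
      · rw [mulVec_add, h1, h2]; abel
      · rw [mulVec_add, mulVec_mulVec, hB, one_mulVec, add_comm]
  have hv : ∃ v w, v ≠ 0 ∧ w ≠ 0 ∧ B *ᵥ v = v ∧ B *ᵥ w = -w ∧ A *ᵥ v = -v ∧ A *ᵥ w = w := by
    obtain ⟨x, hx0, ⟨h1, h2⟩ | ⟨h1, h2⟩⟩ := h0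
    · obtain ⟨y, hy0, h3, h4⟩ := exists_opposite_vector hA hB hA' hB' htr hx0 h1 h2
      exact ⟨x, y, hx0, hy0, h2, h4, h1, h3⟩
    -- The mirrored case is the same statement for -A and -B.
    · obtain ⟨y, hy0, h3, h4⟩ := exists_opposite_vector (A := -A) (B := -B)
        (by rw [neg_mul_neg, hA]) (by rw [neg_mul_neg, hB]) (by rw [star_neg, hA'])
        (by rw [star_neg, hB']) (by rw [trace_neg, trace_neg, htr]) hx0
        (by rw [neg_mulVec, h1]) (by rw [neg_mulVec, h2, neg_neg])
      rw [neg_mulVec] at h3 h4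
      exact ⟨y, x, hy0, hx0, neg_inj.1 h4, h2, neg_eq_iff_eq_neg.1 h3, h1⟩
  obtain ⟨v, w, hv0, hw0, h1, h2, h3, h4⟩ := hv
  refine ⟨v, w, hv0, hw0, h1, h2, ?_, ?_⟩
  · rw [← mulVec_mulVec, h1, h3]
  · rw [← mulVec_mulVec, h2, mulVec_neg, h4]

/-! ### Skew matrices of rank two -/

/-- The skew-Hermitian matrix that rotates `v` to `w`. -/
def skewPair (v w : n → 𝕜) : Matrix n n 𝕜 := vecMulVec w (star v) - vecMulVec v (star w)

theorem star_skewPair (v w : n → 𝕜) : star (skewPair v w) = -skewPair v w := by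
  rw [skewPair, star_sub, star_eq_conjTranspose, star_eq_conjTranspose, conjTranspose_vecMulVec,
    conjTranspose_vecMulVec, star_star, star_star, neg_sub]

theorem mul_skewPair_mul_star (P : Matrix n n 𝕜) (v w : n → 𝕜) :
    P * skewPair v w * star P = skewPair (P *ᵥ v) (P *ᵥ w) := by
  rw [skewPair, mul_sub, sub_mul, mul_vecMulVec, mul_vecMulVec, vecMulVec_mul, vecMulVec_mul,
    skewPair, star_mulVec, star_mulVec, star_eq_conjTranspose]

theorem mul_skewPair {H : Matrix n n 𝕜} {v w : n → 𝕜} (hv : H *ᵥ v = -v) (hw : H *ᵥ w = -w) :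
    H * skewPair v w = -skewPair v w := by
  rw [skewPair, mul_sub, mul_vecMulVec, mul_vecMulVec, hv, hw, neg_vecMulVec, neg_vecMulVec]
  abel

theorem skewPair_neg_right (v w : n → 𝕜) : skewPair v (-w) = -skewPair v w := by
  rw [skewPair, star_neg, neg_vecMulVec, vecMulVec_neg, skewPair]
  abel

theorem skewPair_neg_left (v w : n → 𝕜) : skewPair (-v) w = -skewPair v w := by
  rw [skewPair, star_neg, neg_vecMulVec, vecMulVec_neg, skewPair]
  abel

theorem skewPair_mulVec_left {v w : n → 𝕜} (hv : star v ⬝ᵥ v = 1) (hwv : star w ⬝ᵥ v = 0) :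
    skewPair v w *ᵥ v = w := by
  rw [skewPair, sub_mulVec, vecMulVec_mulVec, vecMulVec_mulVec, hv, hwv]
  simp

theorem skewPair_mulVec_right {v w : n → 𝕜} (hw : star w ⬝ᵥ w = 1) (hvw : star v ⬝ᵥ w = 0) :
    skewPair v w *ᵥ w = -v := by
  rw [skewPair, sub_mulVec, vecMulVec_mulVec, vecMulVec_mulVec, hw, hvw]
  simp

theorem skewPair_mulVec_of_orthogonal {v w x : n → 𝕜} (hv : star v ⬝ᵥ x = 0)
    (hw : star w ⬝ᵥ x = 0) : skewPair v w *ᵥ x = 0 := by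
  rw [skewPair, sub_mulVec, vecMulVec_mulVec, vecMulVec_mulVec, hv, hw]
  simp

theorem mul_skewPair' (A : Matrix n n 𝕜) (v w : n → 𝕜) :
    A * skewPair v w = vecMulVec (A *ᵥ w) (star v) - vecMulVec (A *ᵥ v) (star w) := by
  rw [skewPair, mul_sub, mul_vecMulVec, mul_vecMulVec]

/-- For orthonormal v and w this is a quarter turn of their plane and zero on the orthogonal
complement. -/
theorem skewPair_cube {v w : n → 𝕜} (hv : star v ⬝ᵥ v = 1) (hw : star w ⬝ᵥ w = 1)
    (hvw : star v ⬝ᵥ w = 0) (hwv : star w ⬝ᵥ v = 0) :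
    skewPair v w * (skewPair v w * skewPair v w) = -skewPair v w := by
  rw [← mul_assoc, mul_skewPair', ← mulVec_mulVec, ← mulVec_mulVec, skewPair_mulVec_left hv hwv,
    skewPair_mulVec_right hw hvw, mulVec_neg, skewPair_mulVec_left hv hwv, skewPair,
    neg_vecMulVec, neg_vecMulVec]
  abel

theorem skewPair_mul_eq_zero {v w x y : n → 𝕜} (hvx : star v ⬝ᵥ x = 0) (hwx : star w ⬝ᵥ x = 0)
    (hvy : star v ⬝ᵥ y = 0) (hwy : star w ⬝ᵥ y = 0) : skewPair v w * skewPair x y = 0 := by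
  rw [mul_skewPair', skewPair_mulVec_of_orthogonal hvx hwx, skewPair_mulVec_of_orthogonal hvy hwy]
  simp

theorem skewPair_ne_zero {v w : n → 𝕜} (hv : star v ⬝ᵥ v = 1) (hw : star w ⬝ᵥ w = 1)
    (hwv : star w ⬝ᵥ v = 0) : skewPair v w ≠ 0 := by
  intro h
  have h1 := skewPair_mulVec_left hv hwv
  rw [h, zero_mulVec] at h1
  rw [← h1] at hw
  simp at hw

/-- Sums of two orthogonal elementary rotations. -/
theorem add_cube_of_mul_eq_zero {X Y : Matrix n n 𝕜} (hX : X * (X * X) = -X)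
    (hY : Y * (Y * Y) = -Y) (hXY : X * Y = 0) (hYX : Y * X = 0) :
    (X + Y) * ((X + Y) * (X + Y)) = -(X + Y) := by
  have h1 : (X + Y) * (X + Y) = X * X + Y * Y := by
    rw [add_mul, mul_add, mul_add, hXY, hYX]; abel
  rw [h1, add_mul, mul_add, mul_add, hX, hY, ← mul_assoc X Y Y, hXY, ← mul_assoc Y X X, hYX]
  simp [add_comm]

theorem exists_unit_smul {y : n → 𝕜} (hy : y ≠ 0) :
    ∃ c : 𝕜, star (c • y) ⬝ᵥ (c • y) = 1 := by
  have h1 : star y ⬝ᵥ y = ((∑ i, ‖y i‖ ^ 2 : ℝ) : 𝕜) := by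
    rw [dotProduct]
    push_cast
    exact Finset.sum_congr rfl fun i _ => RCLike.conj_mul (y i)
  have h2 : 0 < ∑ i, ‖y i‖ ^ 2 := by
    refine lt_of_le_of_ne (Finset.sum_nonneg fun i _ => sq_nonneg _) fun h => hy ?_
    rw [← h, RCLike.ofReal_zero] at h1
    exact dotProduct_star_self_eq_zero' h1
  refine ⟨((Real.sqrt (∑ i, ‖y i‖ ^ 2))⁻¹ : ℝ), ?_⟩
  rw [star_smul, smul_dotProduct, dotProduct_smul, h1, RCLike.star_def, RCLike.conj_ofReal,
    smul_eq_mul, smul_eq_mul, ← RCLike.ofReal_mul, ← RCLike.ofReal_mul]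
  rw [← mul_assoc, ← mul_inv, Real.mul_self_sqrt h2.le, inv_mul_cancel₀ h2.ne', RCLike.ofReal_one]

/-- Eigenvectors of a Hermitian matrix for the eigenvalues `1` and `-1` are orthogonal. -/
theorem star_dotProduct_eq_zero_of_eigen {B : Matrix n n 𝕜} (hB : star B = B) {v w : n → 𝕜}
    (hv : B *ᵥ v = v) (hw : B *ᵥ w = -w) : star v ⬝ᵥ w = 0 ∧ star w ⬝ᵥ v = 0 := by
  have h1 : star v ⬝ᵥ w = 0 := by
    have := star_dotProduct_mulVec hB v w
    rw [hw, hv, dotProduct_neg] at this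
    exact self_eq_neg.1 this.symm
  refine ⟨h1, ?_⟩
  have := congrArg star h1
  rwa [star_dotProduct, star_star, star_zero] at this

end Involutions
end

noncomputable section

/-! ### Ensembles defined by an inner involution -/

section InnerInvolution

variable {n : Type} [Fintype n] [DecidableEq n] {𝕜 : Type} [RCLike 𝕜]

omit [Fintype n] [DecidableEq n] in
theorem eq_zero_of_eq_neg {m : Type} {X : Matrix m n 𝕜} (h : X = -X) : X = 0 := by
  ext i j
  exact self_eq_neg.1 (congrFun (congrFun h i) j)

theorem involution_mul_self {P : Matrix n n 𝕜} (hP : P ∈ unitaryGroup n 𝕜) (h : star P = P) :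
    P * P = 1 := by
  have := mem_unitaryGroup_iff.1 hP
  rwa [h] at this

theorem unitaryConj_involutive {P : unitaryGroup n 𝕜} (hP : star P.1 = P.1) (X : Matrix n n 𝕜) :
    unitaryConjStarHom P (unitaryConjStarHom P X) = X := by
  have h := involution_mul_self P.2 hP
  change P.1 * (P.1 * X * star P.1) * star P.1 = X
  rw [hP, ← mul_assoc, ← mul_assoc, h, one_mul, mul_assoc, h, mul_one]

/-- For Ω = conjugation by the involution P, the twisted conjugate of F P is (g F g*) P, so an
ensemble C P only needs C to be stable under ordinary conjugation by G. What remains for each family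
is `hgen`, the rotation generator inside the -1 eigenspace. -/
theorem symmetricEnsemble_of_involution {G : Subgroup (unitaryGroup n 𝕜)}
    {L : StarSubalgebra ℝ (Matrix n n 𝕜)} {P : unitaryGroup n 𝕜}
    (hL : LinearInvolution G (conjByHom P) L (unitaryConjStarHom P)) (hP : star P.1 = P.1)
    {C : Set (Matrix n n 𝕜)} (hPC : P.1 ∈ C)
    (hCG : ∀ F ∈ C, ∃ h ∈ G, h.1 = F * P.1) (hCstar : ∀ F ∈ C, star F = F)
    (hconj : ∀ g ∈ G, ∀ F ∈ C, g.1 * F * star g.1 ∈ C)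
    (hgen : ∀ F ∈ C, ¬ IsUnit (F * P.1 + 1) → ∃ X ∈ oddSkew L (unitaryConjStarHom P),
      X ≠ 0 ∧ X * (X * X) = -X ∧ F * P.1 * X = -X) :
    SymmetricEnsemble G (conjByHom P) {H | ∃ F ∈ C, H = F * P.1} := by
  have hPP := involution_mul_self P.2 hP
  have h1 : ∀ H ∈ {H | ∃ F ∈ C, H = F * P.1}, ∃ h ∈ G, h.1 = H ∧ conjByHom P h = h⁻¹ := by
    rintro _ ⟨F, hF, rfl⟩
    obtain ⟨h, hG, hh⟩ := hCG F hF
    refine ⟨h, hG, hh, Subtype.ext ?_⟩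
    change P.1 * h.1 * star P.1 = star h.1
    rw [hh, star_mul, hP, hCstar F hF, mul_assoc, mul_assoc, hPP, mul_one]
  have h2 : ∀ g ∈ G, ∀ H ∈ {H | ∃ F ∈ C, H = F * P.1}, g.1 * H * ((conjByHom P g)⁻¹).1 ∈
      {H | ∃ F ∈ C, H = F * P.1} := by
    rintro g hg _ ⟨F, hF, rfl⟩
    refine ⟨_, hconj g hg F hF, ?_⟩
    change g.1 * (F * P.1) * star (P.1 * g.1 * star P.1) = _
    rw [star_mul, star_mul, star_star, hP]
    calc g.1 * (F * P.1) * (P.1 * (star g.1 * P.1))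
        = g.1 * F * (P.1 * P.1) * star g.1 * P.1 := by simp only [mul_assoc]
      _ = _ := by rw [hPP, mul_one]
  refine ⟨⟨P.1, hPC, hPP.symm⟩, h1, h2, ?_⟩
  rintro _ ⟨F, hF, rfl⟩ hu
  obtain ⟨X, hX, hX0, hX3, hHX⟩ := hgen F hF hu
  exact hL.mem_closure_of_generator h1 h2 ⟨F, hF, rfl⟩ hX hX0 hX3 hHX

/-- Hermitian involutions `F`, `P` of the same trace with `-1` an eigenvalue of `F P`: unit
eigenvectors of both signs. -/
theorem exists_orthonormal_eigenvectors {F P : Matrix n n 𝕜} (hF : F * F = 1) (hP : P * P = 1)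
    (hF' : star F = F) (hP' : star P = P) (htr : F.trace = P.trace) (hu : ¬ IsUnit (F * P + 1)) :
    ∃ v w, star v ⬝ᵥ v = 1 ∧ star w ⬝ᵥ w = 1 ∧ star v ⬝ᵥ w = 0 ∧ star w ⬝ᵥ v = 0 ∧
      P *ᵥ v = v ∧ P *ᵥ w = -w ∧ (F * P) *ᵥ v = -v ∧ (F * P) *ᵥ w = -w := by
  obtain ⟨v, w, hv0, hw0, h1, h2, h3, h4⟩ :=
    exists_eigenvectors_of_involutions hF hP hF' hP' htr hu
  obtain ⟨c, hc⟩ := exists_unit_smul hv0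
  obtain ⟨d, hd⟩ := exists_unit_smul hw0
  have h5 : P *ᵥ (c • v) = c • v := by rw [mulVec_smul, h1]
  have h6 : P *ᵥ (d • w) = -(d • w) := by rw [mulVec_smul, h2, smul_neg]
  obtain ⟨h7, h8⟩ := star_dotProduct_eq_zero_of_eigen hP' h5 h6
  exact ⟨_, _, hc, hd, h7, h8, h5, h6, by rw [mulVec_smul, h3, smul_neg],
    by rw [mulVec_smul, h4, smul_neg]⟩

theorem trace_conj_unitary (g : unitaryGroup n 𝕜) (F : Matrix n n 𝕜) :
    (g.1 * F * star g.1).trace = F.trace := by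
  rw [trace_mul_comm, ← mul_assoc, mem_unitaryGroup_iff'.1 g.2, one_mul]

theorem HasSignature.conj {F : Matrix n n 𝕜} (hF : F ∈ unitaryGroup n 𝕜) {p q : ℕ}
    (hpq : p + q = Fintype.card n) (h : HasSignature F p q) (g : unitaryGroup n 𝕜) :
    HasSignature (g.1 * F * star g.1) p q := by
  rw [hasSignature_iff hF hpq] at h
  refine (hasSignature_iff (mul_mem (mul_mem g.2 hF) (g⁻¹).2) hpq).2
    ⟨?_, (trace_conj_unitary g F).trans h.2⟩
  have h1 : star F = F := h.1
  change star (g.1 * F * star g.1) = g.1 * F * star g.1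
  rw [star_mul, star_mul, star_star, h1, mul_assoc]

end InnerInvolution

/-! ### Grassmannians -/

section Grassmann

/-! ### The sign involution and the ensemble of a Grassmannian -/

section Sign

variable {m n : Type} [Fintype m] [DecidableEq m] [Fintype n] [DecidableEq n]
  {𝕜 : Type} [RCLike 𝕜]

theorem coe_signMatrix : (signMatrix m n 𝕜).1 = fromBlocks 1 0 0 (-1) := rfl

theorem star_signMatrix : star (signMatrix m n 𝕜).1 = (signMatrix m n 𝕜).1 := by
  rw [coe_signMatrix, star_eq_conjTranspose, fromBlocks_conjTranspose]
  simp

theorem signMatrix_mul_self : (signMatrix m n 𝕜).1 * (signMatrix m n 𝕜).1 = 1 :=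
  involution_mul_self (signMatrix m n 𝕜).2 star_signMatrix

theorem signConj_fromBlocks (a : Matrix m m 𝕜) (b : Matrix m n 𝕜) (c : Matrix n m 𝕜)
    (d : Matrix n n 𝕜) : unitaryConjStarHom (signMatrix m n 𝕜) (fromBlocks a b c d) =
      fromBlocks a (-b) (-c) d := by
  change (signMatrix m n 𝕜).1 * _ * star (signMatrix m n 𝕜).1 = _
  rw [star_signMatrix, coe_signMatrix, fromBlocks_multiply, fromBlocks_multiply]
  simp

theorem trace_signMatrix :
    (signMatrix m n 𝕜).1.trace = (Fintype.card m : 𝕜) - (Fintype.card n : 𝕜) := by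
  simp [coe_signMatrix, trace, sub_eq_add_neg]

theorem hasSignature_signMatrix :
    HasSignature (signMatrix m n 𝕜).1 (Fintype.card m) (Fintype.card n) :=
  (hasSignature_iff (signMatrix m n 𝕜).2 (Fintype.card_sum).symm).2
    ⟨star_signMatrix, trace_signMatrix⟩

theorem mem_range_blockDiagHom (g : unitaryGroup (m ⊕ n) 𝕜) :
    g ∈ (blockDiagHom m n 𝕜).range ↔ conjByHom (signMatrix m n 𝕜) g = g := by
  rw [Subtype.ext_iff]
  change _ ↔ unitaryConjStarHom (signMatrix m n 𝕜) g.1 = g.1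
  constructor
  · rintro ⟨p, rfl⟩
    change unitaryConjStarHom _ (fromBlocks p.1.1 0 0 p.2.1) = fromBlocks p.1.1 0 0 p.2.1
    rw [signConj_fromBlocks, neg_zero, neg_zero]
  · intro h
    obtain ⟨a, b, c, d, hg⟩ : ∃ a b c d, g.1 = fromBlocks a b c d :=
      ⟨_, _, _, _, (fromBlocks_toBlocks g.1).symm⟩
    rw [hg, signConj_fromBlocks, fromBlocks_inj] at h
    obtain ⟨-, h2, h3, -⟩ := h
    obtain rfl := eq_zero_of_eq_neg h2.symm
    obtain rfl := eq_zero_of_eq_neg h3.symm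
    have h1 := mem_unitaryGroup_iff.1 g.2
    rw [hg, star_eq_conjTranspose, fromBlocks_conjTranspose, fromBlocks_multiply, ← fromBlocks_one,
      fromBlocks_inj] at h1
    simp only [conjTranspose_zero, Matrix.mul_zero, add_zero, zero_add] at h1
    exact ⟨(⟨a, mem_unitaryGroup_iff.2 h1.1⟩, ⟨d, mem_unitaryGroup_iff.2 h1.2.2.2⟩),
      Subtype.ext hg.symm⟩

theorem linearInvolution_signConj : LinearInvolution (⊤ : Subgroup (unitaryGroup (m ⊕ n) 𝕜))
    (conjByHom (signMatrix m n 𝕜)) ⊤ (unitaryConjStarHom (signMatrix m n 𝕜)) :=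
  linearInvolution_top (fun _ => rfl) (unitaryConj_involutive star_signMatrix)

theorem ensembleGrassmann_eq : ensembleGrassmann m n 𝕜 =
    {H | ∃ F ∈ {F | F ∈ unitaryGroup (m ⊕ n) 𝕜 ∧
      HasSignature F (Fintype.card m) (Fintype.card n)}, H = F * (signMatrix m n 𝕜).1} := by
  ext H
  simp only [ensembleGrassmann, Set.mem_ofPred_eq, and_assoc]

/-- The rotation between two eigenvectors of I' with opposite signs is odd under conjugation by I',
and both eigenvectors can be taken in the -1 eigenspace of H. -/
theorem symmetricEnsemble_grassmann :
    SymmetricEnsemble (⊤ : Subgroup (unitaryGroup (m ⊕ n) 𝕜))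
    (conjByHom (signMatrix m n 𝕜)) (ensembleGrassmann m n 𝕜) := by
  rw [ensembleGrassmann_eq]
  refine symmetricEnsemble_of_involution linearInvolution_signConj star_signMatrix
    ⟨(signMatrix m n 𝕜).2, hasSignature_signMatrix⟩ ?_ ?_ ?_ ?_
  · rintro F ⟨hF, -⟩
    exact ⟨⟨F, hF⟩ * signMatrix m n 𝕜, Subgroup.mem_top _, rfl⟩
  · rintro F ⟨-, hF, -⟩
    exact hF
  · rintro g - F ⟨hF, hs⟩
    exact ⟨mul_mem (mul_mem g.2 hF) (g⁻¹).2, hs.conj hF Fintype.card_sum.symm g⟩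
  · rintro F ⟨hF, hs⟩ hu
    rw [hasSignature_iff hF Fintype.card_sum.symm] at hs
    obtain ⟨v, w, hv, hw, hvw, hwv, hPv, hPw, hHv, hHw⟩ := exists_orthonormal_eigenvectors
      (involution_mul_self hF hs.1) signMatrix_mul_self hs.1 star_signMatrix
      (hs.2.trans trace_signMatrix.symm) hu
    refine ⟨skewPair v w, ⟨StarSubalgebra.mem_top, star_skewPair v w, ?_⟩,
      skewPair_ne_zero hv hw hwv, skewPair_cube hv hw hvw hwv, mul_skewPair hHv hHw⟩
    change (signMatrix m n 𝕜).1 * _ * star (signMatrix m n 𝕜).1 = _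
    rw [mul_skewPair_mul_star, hPv, hPw, skewPair_neg_right]

end Sign

/-! ### The torus of a Grassmannian and its Weyl group -/

section Torus

variable {𝕜 : Type} [RCLike 𝕜] {L R : ℕ}

theorem mul_imagColumn_apply {ι : Type} (X : Matrix ι (Fin L ⊕ Fin R) 𝕜) (z : Fin R → ℂ) (i : ι)
    (j : Fin R) : (X * imagColumn 𝕜 L R z) i j = X i (Sum.inr j) * ((z j).im : 𝕜) := by
  simp [mul_apply, imagColumn, diagonal_apply]

theorem imagColumn_transpose_mul_apply {ι : Type} (X : Matrix (Fin L ⊕ Fin R) ι 𝕜)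
    (z : Fin R → ℂ) (i : Fin R) (j : ι) :
    ((imagColumn 𝕜 L R z)ᵀ * X) i j = ((z i).im : 𝕜) * X (Sum.inr i) j := by
  simp [mul_apply, imagColumn, diagonal_apply]

theorem imagColumn_mul_apply_inl {ι : Type} (X : Matrix (Fin R) ι 𝕜) (z : Fin R → ℂ) (i : Fin L)
    (j : ι) : (imagColumn 𝕜 L R z * X) (Sum.inl i) j = 0 := by
  simp [mul_apply, imagColumn]

theorem imagColumn_mul_apply_inr {ι : Type} (X : Matrix (Fin R) ι 𝕜) (z : Fin R → ℂ) (i : Fin R)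
    (j : ι) : (imagColumn 𝕜 L R z * X) (Sum.inr i) j = ((z i).im : 𝕜) * X i j := by
  simp [mul_apply, imagColumn, diagonal_apply]

theorem mul_imagColumn_transpose_apply_inr {ι : Type} (X : Matrix ι (Fin R) 𝕜) (z : Fin R → ℂ)
    (i : ι) (j : Fin R) :
    (X * (imagColumn 𝕜 L R z)ᵀ) i (Sum.inr j) = X i j * ((z j).im : 𝕜) := by
  simp [mul_apply, imagColumn, diagonal_apply]

theorem groupedTorus_imagPoint (s : Fin R → ℝ) : groupedTorus 𝕜 L R (imagPoint s) =
    fromBlocks 0 (-imagColumn 𝕜 L R (imagPoint s).2) (imagColumn 𝕜 L R (imagPoint s).2)ᵀ 0 := by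
  rw [groupedTorus_apply]
  congr 1
  · rw [← fromBlocks_zero]
    congr 1 <;> ext i j <;> simp [imagPoint, diagonal_apply]
  · ext i j
    simp [imagPoint, diagonal_apply]

theorem groupedTorus_star (x : ℝ × (Fin R → ℂ)) :
    unitaryConjStarHom (signMatrix (Fin L ⊕ Fin R) (Fin R) 𝕜) (groupedTorus 𝕜 L R x) =
      groupedTorus 𝕜 L R (star x) := by
  have h : imagColumn 𝕜 L R (star x).2 = -imagColumn 𝕜 L R x.2 := by
    ext (i | i) j <;> simp [imagColumn, diagonal_apply, apply_ite (Neg.neg : 𝕜 → 𝕜)]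
  rw [groupedTorus_apply, groupedTorus_apply, signConj_fromBlocks, h, transpose_neg]
  simp

theorem groupedTorus_eq_zero {z : Fin R → ℂ} (h : groupedTorus 𝕜 L R (0, z) = 0) : z = 0 := by
  rw [groupedTorus_apply, ← fromBlocks_zero, fromBlocks_inj] at h
  funext j
  apply Complex.ext
  · have := congrFun (diagonal_eq_zero.1 h.2.2.2) j
    simpa using this
  · have := congrFun (congrFun h.2.2.1 j) (Sum.inr j)
    simpa [imagColumn] using this

theorem imagPoint_im (s : Fin R → ℝ) (j : Fin R) : (((imagPoint s).2 j).im : ℝ) = s j := by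
  simp [imagPoint]

/-- Eliminating y gives x_ij (t_j² - t_i²) = 0. The parameters are positive as well as distinct, so
their squares are distinct too. -/
theorem eq_zero_of_regular {x y : Fin R → Fin R → 𝕜}
    (h1 : ∀ i j, x i j * (regularParam j : ℝ) = (regularParam i : ℝ) * y i j)
    (h2 : ∀ i j, y i j * (regularParam j : ℝ) = (regularParam i : ℝ) * x i j) {i j : Fin R}
    (hij : i ≠ j) : x i j = 0 := by
  have h3 : x i j *
      ((regularParam j * regularParam j - regularParam i * regularParam i : ℝ) : 𝕜) = 0 := by
    push_cast
    linear_combination (regularParam j : 𝕜) * h1 i j + (regularParam i : 𝕜) * h2 i j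
  refine (mul_eq_zero.1 h3).resolve_right (RCLike.ofReal_ne_zero.2 fun h4 => hij ?_)
  have h5 := (mul_self_inj (regularParam_pos j).le (regularParam_pos i).le).1 (sub_eq_zero.1 h4)
  exact regularParam_injective h5.symm

theorem regularParam_ne_zero (j : Fin R) : ((regularParam j : ℝ) : 𝕜) ≠ 0 :=
  RCLike.ofReal_ne_zero.2 (regularParam_pos j).ne'

theorem ofReal_re_eq_of_regular {x : 𝕜} {j : Fin R}
    (h : x * (regularParam j : ℝ) = (regularParam j : ℝ) * star x) :
    ((RCLike.re x : ℝ) : 𝕜) = x := by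
  rw [mul_comm] at h
  exact RCLike.conj_eq_iff_re.1 (mul_left_cancel₀ (regularParam_ne_zero j) h).symm

/-- Centralizer of a regular element of the torus of a Grassmannian. -/
theorem eq_groupedTorus_of_commute {Z : Matrix ((Fin L ⊕ Fin R) ⊕ Fin R) ((Fin L ⊕ Fin R) ⊕ Fin R) 𝕜}
    (hZ : star Z = -Z) (hθ : unitaryConjStarHom (signMatrix (Fin L ⊕ Fin R) (Fin R) 𝕜) Z = -Z)
    (hc : Commute Z (groupedTorus 𝕜 L R (imagPoint regularParam))) :
    ∃ s : Fin R → ℝ, Z = groupedTorus 𝕜 L R (imagPoint s) := by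
  obtain ⟨a, b, c, d, rfl⟩ : ∃ a b c d, Z = fromBlocks a b c d :=
    ⟨_, _, _, _, (fromBlocks_toBlocks Z).symm⟩
  rw [signConj_fromBlocks, fromBlocks_neg, fromBlocks_inj] at hθ
  obtain ⟨ha, -, -, hd⟩ := hθ
  obtain rfl := eq_zero_of_eq_neg ha
  obtain rfl := eq_zero_of_eq_neg hd
  rw [star_eq_conjTranspose, fromBlocks_conjTranspose, fromBlocks_neg, fromBlocks_inj] at hZ
  obtain ⟨-, -, hbc, -⟩ := hZ
  obtain rfl : c = -bᴴ := by rw [hbc, neg_neg]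
  rw [groupedTorus_imagPoint] at hc
  have hc' : _ * _ = _ * _ := hc
  rw [fromBlocks_multiply, fromBlocks_multiply, fromBlocks_inj] at hc'
  simp only [Matrix.mul_zero, Matrix.zero_mul, add_zero, zero_add, Matrix.mul_neg, Matrix.neg_mul,
    neg_neg] at hc'
  obtain ⟨h1, -, -, h2⟩ := hc'
  -- The padding rows of the torus generator vanish and its parameters are nonzero, which kills the
  -- entries of b joining the padding to the last block.
  have e0 : ∀ i j, b (Sum.inl i) j = 0 := fun i j => by
    have := congrFun (congrFun h1 (Sum.inl i)) (Sum.inr j)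
    rw [mul_imagColumn_transpose_apply_inr, imagColumn_mul_apply_inl, imagPoint_im] at this
    exact (mul_eq_zero.1 this).resolve_right (regularParam_ne_zero j)
  have e1 : ∀ i j, b (Sum.inr i) j * (regularParam j : ℝ) =
      (regularParam i : ℝ) * star (b (Sum.inr j) i) := fun i j => by
    have := congrFun (congrFun h1 (Sum.inr i)) (Sum.inr j)
    rwa [mul_imagColumn_transpose_apply_inr, imagColumn_mul_apply_inr, imagPoint_im,
      imagPoint_im] at this
  have e2 : ∀ i j, star (b (Sum.inr j) i) * (regularParam j : ℝ) =
      (regularParam i : ℝ) * b (Sum.inr i) j := fun i j => by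
    have := congrFun (congrFun h2 i) j
    rwa [mul_imagColumn_apply, imagColumn_transpose_mul_apply, imagPoint_im,
      imagPoint_im] at this
  have e3 : ∀ i j, i ≠ j → b (Sum.inr i) j = 0 := fun i j hij =>
    eq_zero_of_regular (x := fun i j => b (Sum.inr i) j) e1 e2 hij
  have e4 : ∀ i, ((RCLike.re (b (Sum.inr i) i) : ℝ) : 𝕜) = b (Sum.inr i) i := fun i =>
    ofReal_re_eq_of_regular (e1 i i)
  -- The sign comes from the upper right block of the torus, which is minus the imaginary part.
  refine ⟨fun j => -RCLike.re (b (Sum.inr j) j), ?_⟩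
  have hb : b = -imagColumn 𝕜 L R (imagPoint fun j => -RCLike.re (b (Sum.inr j) j)).2 := by
    ext (i | i) j
    · rw [e0]; simp [imagColumn]
    · by_cases hij : i = j
      · subst hij
        simp [imagColumn, imagPoint, e4]
      · simp [imagColumn, hij, e3 i j hij]
  rw [groupedTorus_imagPoint, ← hb]
  congr 1
  rw [hb]
  ext i (j | j)
  · simp [imagColumn]
  · by_cases hij : i = j
    · subst hij
      simp [imagColumn, imagPoint]
    · simp [imagColumn, Ne.symm hij]

theorem regularTorus_grouped :
    RegularTorus ⊤ (unitaryConjStarHom (signMatrix (Fin L ⊕ Fin R) (Fin R) 𝕜))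
      (groupedTorus 𝕜 L R) where
  mem _ := StarSubalgebra.mem_top
  map_star := groupedTorus_star
  eq_zero _ := groupedTorus_eq_zero
  regular := ⟨regularParam, fun _ hZ hc => eq_groupedTorus_of_commute hZ.2.1 hZ.2.2 hc⟩

/-- The signed permutations of the torus of a Grassmannian are realized in the block diagonal
group. -/
theorem groupedTorus_conj {l m : Fin R → Circle} {σ : Equiv.Perm (Fin R)} {ε : Fin R → ℝ}
    (hre : ∀ j, (l (σ j) : ℂ).re = (m j : ℂ).re)
    (him : ∀ j, (m j : ℂ).im = ε j * (l (σ j) : ℂ).im) (hε : ∀ j, ε j * ε j = 1) :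
    fromBlocks (fromBlocks 1 0 0 (monomialMatrix σ fun _ => (1 : 𝕜))) 0 0
        (monomialMatrix σ fun j => (ε j : 𝕜)) * groupedTorus 𝕜 L R (circlePoint l) *
      star (fromBlocks (fromBlocks 1 0 0 (monomialMatrix σ fun _ => (1 : 𝕜))) 0 0
        (monomialMatrix σ fun j => (ε j : 𝕜))) = groupedTorus 𝕜 L R (circlePoint m) := by
  have hε' : ∀ j, ((ε j : ℝ) : 𝕜) * (ε j : ℝ) = 1 := fun j => by
    rw [← RCLike.ofReal_mul, hε, RCLike.ofReal_one]
  have hT : ∀ z : Fin R → ℂ, (imagColumn 𝕜 L R z)ᵀ =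
      fromCols 0 (diagonal fun j => ((z j).im : 𝕜)) := fun z => by
    rw [imagColumn, transpose_fromRows, transpose_zero, diagonal_transpose]
  rw [groupedTorus_apply, groupedTorus_apply, star_eq_conjTranspose]
  simp only [fromBlocks_conjTranspose, fromBlocks_multiply, conjTranspose_zero, Matrix.mul_zero,
    Matrix.zero_mul, add_zero, zero_add, conjTranspose_one, Matrix.one_mul, Matrix.mul_one,
    monomial_conj_diagonal, hT]
  simp only [imagColumn, fromRows_neg, neg_zero, fromBlocks_mul_fromRows, fromRows_mul,
    Matrix.mul_neg, Matrix.neg_mul, mul_fromCols, fromCols_mul_fromBlocks, Matrix.mul_zero,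
    Matrix.zero_mul, add_zero, zero_add, monomial_conj_diagonal, circlePoint]
  congr 1
  · congr 2
    funext j
    simp [hre]
  · congr 4
    funext j
    simp [him, mul_comm]
  · congr 2
    funext j
    simp [him]
  · congr 1
    funext j
    rw [← hre, mul_comm, ← mul_assoc, RCLike.star_def, RCLike.conj_ofReal, hε', one_mul]

variable [Algebra 𝕜 ℂ]

theorem isMatrixRealization_grassmann (h𝕜 : ∀ r : ℝ, algebraMap 𝕜 ℂ (r : 𝕜) = r) (L R : ℕ) :
    IsMatrixRealization (⊤ : Subgroup (unitaryGroup ((Fin L ⊕ Fin R) ⊕ Fin R) 𝕜))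
      (blockDiagHom (Fin L ⊕ Fin R) (Fin R) 𝕜).range
      (conjByHom (signMatrix (Fin L ⊕ Fin R) (Fin R) 𝕜))
      (ensembleGrassmann (Fin L ⊕ Fin R) (Fin R) 𝕜) (torusGrassmann 𝕜 L R) R := by
  refine linearInvolution_signConj.isMatrixRealization regularTorus_grouped
    symmetricEnsemble_grassmann (fun g => ?_) ?_ (fun l m h => ?_)
  · rw [mem_range_blockDiagHom]
    exact ⟨fun h => ⟨Subgroup.mem_top _, h⟩, fun h => h.2⟩
  · simp only [groupedTorus_circlePoint]
    rfl
  -- The real parts suffice: they determine the cosines up to order. The remaining signs of the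
  -- sines are absorbed by ε in the lower block of K.
  · have h1 := congrArg (Multiset.map Complex.re) h
    rw [groupedTorus_circlePoint, groupedTorus_circlePoint, re_complexEigenvalues_grouped h𝕜,
      re_complexEigenvalues_grouped h𝕜] at h1
    obtain ⟨σ, ε, hε, hre, him⟩ := exists_signed_perm (eq_of_add_nsmul_eq two_ne_zero h1)
    have hε1 : ∀ j, ε j * ε j = 1 := fun j => by rcases hε j with h2 | h2 <;> rw [h2] <;> norm_num
    refine ⟨blockDiagHom _ _ 𝕜 (blockDiagHom _ _ 𝕜 (1, ⟨_, monomialMatrix_mem σ (c := fun _ => 1)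
      (by simp)⟩), ⟨_, monomialMatrix_mem σ (c := fun j => (ε j : 𝕜)) fun j => ?_⟩),
      ⟨_, rfl⟩, groupedTorus_conj hre him hε1⟩
    rw [RCLike.star_def, RCLike.conj_ofReal, ← RCLike.ofReal_mul, hε1, RCLike.ofReal_one]

end Torus

end Grassmann
end

noncomputable section

/-! ### Quaternionic structures -/

section Quaternionic

variable {n : Type} [Fintype n] [DecidableEq n]

theorem star_mulVec_eq (X : Matrix n n ℂ) (v : n → ℂ) :
    star (X *ᵥ v) = X.map (starRingEnd ℂ) *ᵥ star v := by
  ext i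
  simp [mulVec, dotProduct]

/-- The antilinear map `v ↦ B conj(v)`. -/
def quatConj (B : Matrix n n ℂ) (v : n → ℂ) : n → ℂ := B *ᵥ star v

/-- Membership in the algebra means commuting with the antilinear structure, so that structure
preserves eigenspaces for real eigenvalues. -/
theorem mulVec_quatConj {B : unitaryGroup n ℂ} {X : Matrix n n ℂ} (hX : X ∈ symplecticAlgebra B)
    (v : n → ℂ) : X *ᵥ quatConj B.1 v = quatConj B.1 (X *ᵥ v) := by
  rw [mem_symplecticAlgebra] at hX
  rw [quatConj, quatConj, mulVec_mulVec, hX, star_mulVec_eq, mulVec_mulVec]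

theorem quatConj_neg (B : Matrix n n ℂ) (v : n → ℂ) : quatConj B (-v) = -quatConj B v := by
  rw [quatConj, star_neg, mulVec_neg, quatConj]

theorem quatConj_quatConj {B : Matrix n n ℂ} (hr : B.map (starRingEnd ℂ) = B) (hB : B * B = -1)
    (v : n → ℂ) : quatConj B (quatConj B v) = -v := by
  rw [quatConj, quatConj, star_mulVec_eq, hr, star_star, mulVec_mulVec, hB, neg_mulVec, one_mulVec]

theorem star_quatConj_dotProduct (B : unitaryGroup n ℂ) (v w : n → ℂ) :
    star (quatConj B.1 v) ⬝ᵥ quatConj B.1 w = star (star v ⬝ᵥ w) := by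
  rw [quatConj, quatConj, star_mulVec, star_star, dotProduct_mulVec, vecMul_vecMul,
    ← star_eq_conjTranspose, mem_unitaryGroup_iff'.1 B.2, vecMul_one, ← star_dotProduct w v,
    dotProduct_comm]

/-- Antisymmetry of B makes this number equal to its negative. -/
theorem star_dotProduct_quatConj_self {B : Matrix n n ℂ} (hB : Bᵀ = -B) (v : n → ℂ) :
    star v ⬝ᵥ quatConj B v = 0 := by
  have h : star v ⬝ᵥ quatConj B v = -(star v ⬝ᵥ quatConj B v) := by
    conv_lhs => rw [quatConj, dotProduct_mulVec, ← mulVec_transpose, hB, neg_mulVec,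
      neg_dotProduct, dotProduct_comm]
    rw [quatConj]
  exact self_eq_neg.1 h

theorem skewPair_map_conj (v w : n → ℂ) :
    (skewPair v w).map (starRingEnd ℂ) = skewPair (star v) (star w) := by
  ext i j
  simp [skewPair, vecMulVec_apply]

theorem mem_symplecticAlgebra_iff {B : unitaryGroup n ℂ} {X : Matrix n n ℂ} :
    X ∈ symplecticAlgebra B ↔ B.1 * X.map (starRingEnd ℂ) * star B.1 = X := by
  rw [mem_symplecticAlgebra]
  constructor
  · intro h
    rw [← h, mul_assoc, mem_unitaryGroup_iff.1 B.2, mul_one]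
  · intro h
    conv_lhs => rw [← h]
    rw [mul_assoc, mem_unitaryGroup_iff'.1 B.2, mul_one]

theorem conj_skewPair (B : unitaryGroup n ℂ) (v w : n → ℂ) :
    B.1 * (skewPair v w).map (starRingEnd ℂ) * star B.1 =
      skewPair (quatConj B.1 v) (quatConj B.1 w) := by
  rw [skewPair_map_conj, mul_skewPair_mul_star]
  rfl

theorem skewPair_symm (v w : n → ℂ) : skewPair w v = -skewPair v w := by
  rw [skewPair, skewPair, neg_sub]

/-- Conjugation by the quaternionic structure exchanges the two summands: applied twice it gives
minus signs on both vectors, and these cancel. -/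
theorem skewPair_add_mem {B : unitaryGroup n ℂ} (hr : B.1.map (starRingEnd ℂ) = B.1)
    (hB : B.1 * B.1 = -1) (v w : n → ℂ) :
    skewPair v w + skewPair (quatConj B.1 v) (quatConj B.1 w) ∈ symplecticAlgebra B := by
  rw [mem_symplecticAlgebra_iff, Matrix.map_add _ (map_add _), mul_add, add_mul, conj_skewPair,
    conj_skewPair, quatConj_quatConj hr hB, quatConj_quatConj hr hB, skewPair_neg_left,
    skewPair_neg_right, neg_neg, add_comm]

/-- The structure sends the pair (v, jv) to (jv, -v), and the sign cancels against the antisymmetry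
of `skewPair`. -/
theorem skewPair_quatConj_mem {B : unitaryGroup n ℂ} (hr : B.1.map (starRingEnd ℂ) = B.1)
    (hB : B.1 * B.1 = -1) (v : n → ℂ) :
    skewPair v (quatConj B.1 v) ∈ symplecticAlgebra B := by
  rw [mem_symplecticAlgebra_iff, conj_skewPair, quatConj_quatConj hr hB, skewPair_neg_right,
    skewPair_symm, neg_neg]

/-- Conjugation by a real involution that commutes with `B` up to sign preserves the symplectic
algebra. -/
theorem unitaryConj_mem_symplecticAlgebra {B P : unitaryGroup n ℂ} {ε : ℂ} (hε : ε * ε = 1)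
    (hP : star P.1 = P.1) (hr : P.1.map (starRingEnd ℂ) = P.1) (h : P.1 * B.1 = ε • (B.1 * P.1))
    (X : Matrix n n ℂ) (hX : X ∈ symplecticAlgebra B) :
    unitaryConjStarHom P X ∈ symplecticAlgebra B := by
  rw [mem_symplecticAlgebra] at hX ⊢
  change P.1 * X * star P.1 * B.1 = B.1 * (P.1 * X * star P.1).map (starRingEnd ℂ)
  rw [hP, map_conj_mul, map_conj_mul, hr]
  calc P.1 * X * P.1 * B.1 = P.1 * X * (P.1 * B.1) := by rw [mul_assoc]
    _ = ε • (P.1 * (X * B.1) * P.1) := by rw [h, mul_smul_comm]; simp only [mul_assoc]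
    _ = ε • ((P.1 * B.1) * (X.map (starRingEnd ℂ) * P.1)) := by rw [hX]; simp only [mul_assoc]
    _ = _ := by rw [h, smul_mul_assoc, smul_smul, hε, one_smul]; simp only [mul_assoc]

end Quaternionic

theorem map_conj_signMatrix (m n : Type) [Fintype m] [DecidableEq m] [Fintype n] [DecidableEq n] :
    (signMatrix m n ℂ).1.map (starRingEnd ℂ) = (signMatrix m n ℂ).1 := by
  rw [coe_signMatrix, fromBlocks_map]
  congr 1 <;> ext i j <;> simp [one_apply, apply_ite (starRingEnd ℂ)]

/-! ### The symmetric spaces of the unitary groups in the compact symplectic groups -/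

section CI

variable {n : Type} [Fintype n] [DecidableEq n]

theorem signMatrix_mul_J :
    (signMatrix n n ℂ).1 * J n ℂ = -(J n ℂ * (signMatrix n n ℂ).1) := by
  rw [coe_signMatrix, J_eq, fromBlocks_multiply, fromBlocks_multiply, fromBlocks_neg]
  simp

theorem linearInvolution_CI : LinearInvolution (compactSymplectic (J n ℂ))
    (conjByHom (signMatrix n n ℂ)) (symplecticAlgebra (unitaryJ n ℂ))
    (unitaryConjStarHom (signMatrix n n ℂ)) :=
  linearInvolution_symplectic (B := unitaryJ n ℂ) (fun _ => rfl)
    (unitaryConj_involutive star_signMatrix)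
    (unitaryConj_mem_symplecticAlgebra (ε := -1) (by norm_num) star_signMatrix
      (map_conj_signMatrix n n) (by rw [neg_one_smul]; exact signMatrix_mul_J))

theorem ensembleCI_eq : ensembleCI n = {H | ∃ F ∈ {F | F ∈ unitaryGroup (n ⊕ n) ℂ ∧
    F.IsHermitian ∧ J n ℂ * F = -(F.map (starRingEnd ℂ)) * J n ℂ},
      H = F * (signMatrix n n ℂ).1} := by
  ext H
  simp only [ensembleCI, Set.mem_ofPred_eq, and_assoc]

/-- I' anticommutes with J, and so does F up to complex conjugation; the two signs cancel in F I'.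
-/
theorem mul_signMatrix_mem_CI {F : Matrix (n ⊕ n) (n ⊕ n) ℂ}
    (hJ : J n ℂ * F = -(F.map (starRingEnd ℂ)) * J n ℂ) :
    F * (signMatrix n n ℂ).1 * J n ℂ =
      J n ℂ * (F * (signMatrix n n ℂ).1).map (starRingEnd ℂ) := by
  have h1 : J n ℂ * F.map (starRingEnd ℂ) = -F * J n ℂ := by
    have h2 := congrArg (mapConjStarHom (n ⊕ n)) hJ
    rw [map_mul, map_mul, map_neg] at h2
    change (J n ℂ).map (starRingEnd ℂ) * F.map (starRingEnd ℂ) =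
      -((F.map (starRingEnd ℂ)).map (starRingEnd ℂ)) * (J n ℂ).map (starRingEnd ℂ) at h2
    rwa [map_conj_J, map_conj_map_conj] at h2
  rw [map_conj_mul, map_conj_signMatrix, mul_assoc, signMatrix_mul_J, mul_neg, ← mul_assoc,
    ← mul_assoc, h1, neg_mul, neg_mul]

theorem symmetricEnsemble_CI : SymmetricEnsemble (compactSymplectic (J n ℂ))
    (conjByHom (signMatrix n n ℂ)) (ensembleCI n) := by
  rw [ensembleCI_eq]
  refine symmetricEnsemble_of_involution linearInvolution_CI star_signMatrix
    ⟨(signMatrix n n ℂ).2, star_signMatrix, ?_⟩ ?_ ?_ ?_ ?_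
  · rw [map_conj_signMatrix, neg_mul, signMatrix_mul_J, neg_neg]
  · rintro F ⟨hF, -, hJ⟩
    exact ⟨⟨F, hF⟩ * signMatrix n n ℂ, mem_compactSymplectic.2 (mul_signMatrix_mem_CI hJ), rfl⟩
  · rintro F ⟨-, hF, -⟩
    exact hF
  · rintro g hg F ⟨hF, hs, hJ⟩
    have hs' : star F = F := hs
    refine ⟨mul_mem (mul_mem g.2 hF) (g⁻¹).2, ?_, ?_⟩
    · change star _ = _
      rw [star_mul, star_mul, star_star, hs', mul_assoc]
    · have key : ∀ h ∈ compactSymplectic (J n ℂ),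
          J n ℂ * h.1 = h.1.map (starRingEnd ℂ) * J n ℂ := by
        intro h hh
        have h2 := congrArg (fun X : Matrix (n ⊕ n) (n ⊕ n) ℂ => X.map (starRingEnd ℂ))
          (mem_compactSymplectic.1 hh)
        simp only [map_conj_mul, map_conj_J, map_conj_map_conj] at h2
        exact h2.symm
      have h1 := key g hg
      have h2 : J n ℂ * star g.1 = (star g.1).map (starRingEnd ℂ) * J n ℂ := key _ (inv_mem hg)
      rw [map_conj_mul, map_conj_mul]
      calc J n ℂ * (g.1 * F * star g.1) = (J n ℂ * g.1) * F * star g.1 := by simp only [mul_assoc]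
        _ = g.1.map (starRingEnd ℂ) * (J n ℂ * F) * star g.1 := by rw [h1]; simp only [mul_assoc]
        _ = -(g.1.map (starRingEnd ℂ) * F.map (starRingEnd ℂ) * (J n ℂ * star g.1)) := by
          rw [hJ]; noncomm_ring
        _ = _ := by rw [h2]; noncomm_ring
  · rintro F ⟨hF, hs, hJ⟩ hu
    have hs' : star F = F := hs
    -- No signature is imposed here. Conjugation by J takes F to -Fᵀ, which forces the trace to be
    -- 0, the trace of I'.
    have htr : F.trace = (signMatrix n n ℂ).1.trace := by
      rw [trace_signMatrix, sub_self]
      have h1 : F.map (starRingEnd ℂ) = Fᵀ := by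
        rw [← star_map_conj, hs']
      have h2 : F.trace = -F.trace := by
        calc F.trace = (J n ℂ * F * star (J n ℂ)).trace :=
              (trace_conj_unitary (unitaryJ n ℂ) F).symm
          _ = (-(Fᵀ * (J n ℂ * star (J n ℂ)))).trace := by
            rw [hJ, h1, neg_mul, neg_mul, mul_assoc]
          _ = _ := by
            have h3 : J n ℂ * star (J n ℂ) = 1 := mem_unitaryGroup_iff.1 (unitaryJ n ℂ).2
            rw [h3, mul_one, trace_neg, trace_transpose]
      exact self_eq_neg.1 h2
    obtain ⟨v, w, hv, -, -, -, hPv, -, hHv, -⟩ := exists_orthonormal_eigenvectors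
      (involution_mul_self hF hs) signMatrix_mul_self hs star_signMatrix htr hu
    have hB : (unitaryJ n ℂ).1 * (unitaryJ n ℂ).1 = -1 := J_squared n ℂ
    have hr : (unitaryJ n ℂ).1.map (starRingEnd ℂ) = (unitaryJ n ℂ).1 := map_conj_J n
    -- The quaternionic structure exchanges the two eigenspaces of I' and preserves the -1
    -- eigenspace of H. So v and jv form the required pair of opposite signs, and their rotation is
    -- symplectic.
    have hPj : (signMatrix n n ℂ).1 *ᵥ quatConj (unitaryJ n ℂ).1 v =
        -quatConj (unitaryJ n ℂ).1 v := by
      conv_rhs => rw [← hPv]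
      rw [quatConj, quatConj, mulVec_mulVec, star_mulVec_eq, map_conj_signMatrix, mulVec_mulVec,
        ← neg_mulVec]
      congr 1
      exact signMatrix_mul_J
    have hHj : (F * (signMatrix n n ℂ).1) *ᵥ quatConj (unitaryJ n ℂ).1 v =
        -quatConj (unitaryJ n ℂ).1 v := by
      rw [mulVec_quatConj (mem_symplecticAlgebra.2 (mul_signMatrix_mem_CI hJ)), hHv, quatConj_neg]
    obtain ⟨hvj, hjv⟩ := star_dotProduct_eq_zero_of_eigen star_signMatrix hPv hPj
    have hj : star (quatConj (unitaryJ n ℂ).1 v) ⬝ᵥ quatConj (unitaryJ n ℂ).1 v = 1 := by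
      rw [star_quatConj_dotProduct, hv, star_one]
    refine ⟨skewPair v (quatConj (unitaryJ n ℂ).1 v),
      ⟨skewPair_quatConj_mem hr hB v, star_skewPair _ _, ?_⟩,
      skewPair_ne_zero hv hj hjv, skewPair_cube hv hj hvj hjv, mul_skewPair hHv hHj⟩
    change (signMatrix n n ℂ).1 * _ * star (signMatrix n n ℂ).1 = _
    rw [mul_skewPair_mul_star, hPv, hPj, skewPair_neg_right]

theorem rotationTorus_star {𝕜 : Type} [RCLike 𝕜] {R : ℕ} (x : ℝ × (Fin R → ℂ)) :
    unitaryConjStarHom (signMatrix (Fin R) (Fin R) 𝕜) (rotationTorus 𝕜 R x) =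
      rotationTorus 𝕜 R (star x) := by
  rw [rotationTorus_apply, rotationTorus_apply, signConj_fromBlocks]
  congr 1 <;> ext i j <;> by_cases h : i = j <;> simp [h]

theorem rotationTorus_imagPoint {𝕜 : Type} [RCLike 𝕜] {R : ℕ} (s : Fin R → ℝ) :
    rotationTorus 𝕜 R (imagPoint s) =
      fromBlocks 0 (-diagonal fun j => (s j : 𝕜)) (diagonal fun j => (s j : 𝕜)) 0 := by
  rw [rotationTorus_apply]
  congr 1 <;> ext i j <;> by_cases h : i = j <;> simp [h, imagPoint]

theorem rotationTorus_eq_zero {𝕜 : Type} [RCLike 𝕜] {R : ℕ} {z : Fin R → ℂ}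
    (h : rotationTorus 𝕜 R (0, z) = 0) : z = 0 := by
  rw [rotationTorus_apply, ← fromBlocks_zero, fromBlocks_inj] at h
  funext j
  apply Complex.ext
  · simpa using congrFun (diagonal_eq_zero.1 h.1) j
  · simpa using congrFun (diagonal_eq_zero.1 h.2.2.1) j

theorem rotationTorus_mem {R : ℕ} (x : ℝ × (Fin R → ℂ)) :
    rotationTorus ℂ R x ∈ symplecticAlgebra (unitaryJ (Fin R) ℂ) := by
  rw [mem_symplecticAlgebra]
  change _ * J (Fin R) ℂ = J (Fin R) ℂ * _
  rw [rotationTorus_apply, J_eq, fromBlocks_map, fromBlocks_multiply, fromBlocks_multiply]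
  congr 1 <;> ext i j <;> by_cases h : i = j <;> simp [h]

theorem regularTorus_CI (N : ℕ) : RegularTorus (symplecticAlgebra (unitaryJ (Fin N) ℂ))
    (unitaryConjStarHom (signMatrix (Fin N) (Fin N) ℂ)) (rotationTorus ℂ N) where
  mem := rotationTorus_mem
  map_star := rotationTorus_star
  eq_zero _ := rotationTorus_eq_zero
  regular := by
    refine ⟨regularParam, fun Z ⟨_, hZ, hθ⟩ hc => ?_⟩
    obtain ⟨a, b, c, d, rfl⟩ : ∃ a b c d, Z = fromBlocks a b c d :=
      ⟨_, _, _, _, (fromBlocks_toBlocks Z).symm⟩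
    rw [signConj_fromBlocks, fromBlocks_neg, fromBlocks_inj] at hθ
    obtain ⟨ha, -, -, hd⟩ := hθ
    obtain rfl := eq_zero_of_eq_neg ha
    obtain rfl := eq_zero_of_eq_neg hd
    rw [star_eq_conjTranspose, fromBlocks_conjTranspose, fromBlocks_neg, fromBlocks_inj] at hZ
    obtain ⟨-, -, hbc, -⟩ := hZ
    obtain rfl : c = -bᴴ := by rw [hbc, neg_neg]
    rw [rotationTorus_imagPoint] at hc
    have hc' : _ * _ = _ * _ := hc
    rw [fromBlocks_multiply, fromBlocks_multiply, fromBlocks_inj] at hc'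
    simp only [Matrix.mul_zero, Matrix.zero_mul, add_zero, zero_add, Matrix.mul_neg,
      Matrix.neg_mul, neg_neg] at hc'
    obtain ⟨h1, -, -, h2⟩ := hc'
    have e1 : ∀ i j, b i j * (regularParam j : ℝ) = (regularParam i : ℝ) * star (b j i) :=
      fun i j => by
        have := congrFun (congrFun h1 i) j
        rwa [mul_diagonal, diagonal_mul] at this
    have e2 : ∀ i j, star (b j i) * (regularParam j : ℝ) = (regularParam i : ℝ) * b i j :=
      fun i j => by
        have := congrFun (congrFun h2 i) j
        rwa [mul_diagonal, diagonal_mul] at this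
    have hb : b = -diagonal fun j => ((-(b j j).re : ℝ) : ℂ) := by
      ext i j
      by_cases hij : i = j
      · subst hij
        have := ofReal_re_eq_of_regular (e1 i i)
        simpa using this.symm
      · simpa [hij] using eq_zero_of_regular (x := b) e1 e2 hij
    refine ⟨fun j => -(b j j).re, ?_⟩
    rw [rotationTorus_imagPoint]
    congr 1
    rw [hb]
    ext i j
    by_cases hij : i = j
    · subst hij; simp
    · simp [hij]

/-- Being fixed by I' means being block diagonal; the symplectic condition on diag(a, d) then says
that d is the conjugate of a. -/
theorem mem_range_CI (g : unitaryGroup (n ⊕ n) ℂ) :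
    g ∈ ((blockDiagHom n n ℂ).comp ((MonoidHom.id _).prod (transposeInvHom n))).range ↔
      g ∈ compactSymplectic (J n ℂ) ∧ conjByHom (signMatrix n n ℂ) g = g := by
  rw [← mem_range_blockDiagHom, mem_compactSymplectic]
  have key : ∀ a d : Matrix n n ℂ, fromBlocks a 0 0 d * J n ℂ =
      J n ℂ * (fromBlocks a 0 0 d).map (starRingEnd ℂ) ↔ d = a.map (starRingEnd ℂ) := by
    intro a d
    rw [J_eq, fromBlocks_map, fromBlocks_multiply, fromBlocks_multiply, fromBlocks_inj]
    simp only [mul_neg, mul_one, neg_mul, one_mul, Matrix.mul_zero, Matrix.zero_mul, add_zero,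
      zero_add]
    constructor
    · rintro ⟨-, -, h, -⟩
      exact h
    · rintro rfl
      refine ⟨?_, ?_, rfl, ?_⟩ <;> ext i j <;> simp
  constructor
  · rintro ⟨h, rfl⟩
    exact ⟨(key _ _).2 (coe_transposeInvHom h), ⟨_, rfl⟩⟩
  · rintro ⟨h, ⟨⟨a, d⟩, rfl⟩⟩
    have h1 := (key _ _).1 h
    have h2 : d = transposeInvHom n a := Subtype.ext (h1.trans (coe_transposeInvHom a).symm)
    exact ⟨a, by rw [h2]; rfl⟩

theorem isMatrixRealization_CI (N : ℕ) : IsMatrixRealization (compactSymplectic (J (Fin N) ℂ))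
    ((blockDiagHom (Fin N) (Fin N) ℂ).comp
      ((MonoidHom.id _).prod (transposeInvHom (Fin N)))).range
    (conjByHom (signMatrix (Fin N) (Fin N) ℂ)) (ensembleCI (Fin N)) (torusCI N) N := by
  refine linearInvolution_CI.isMatrixRealization (regularTorus_CI N) symmetricEnsemble_CI
    mem_range_CI rfl (fun l m h => ?_)
  have h1 := congrArg (Multiset.map Complex.re) h
  rw [rotationTorus_circlePoint, rotationTorus_circlePoint,
    re_complexEigenvalues_rotation (fun _ => rfl),
    re_complexEigenvalues_rotation (fun _ => rfl)] at h1
  obtain ⟨σ, ε, hε, hre, him⟩ := exists_signed_perm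
    (eq_of_add_nsmul_eq two_ne_zero (congrArg (0 + ·) h1))
  -- Conjugation by diag(c, conj c) multiplies the upper right block by c², so a sign ε is realized
  -- by a square root of ε on the circle: c = i for ε = -1.
  have hc : ∀ j, ∃ c : ℂ, c * star c = 1 ∧ c * c = (ε j : ℂ) := fun j => by
    rcases hε j with h2 | h2
    · exact ⟨1, by simp, by simp [h2]⟩
    · exact ⟨Complex.I, by simp, by simp [h2]⟩
  choose c hc1 hc2 using hc
  have hc3 : ∀ j, star (c j) * star (c j) = (ε j : ℂ) := fun j => by
    rw [← star_mul, hc2, RCLike.star_def, Complex.conj_ofReal]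
  refine ⟨_, ⟨⟨monomialMatrix σ c, monomialMatrix_mem σ hc1⟩, rfl⟩, ?_⟩
  have h3 : (transposeInvHom (Fin N) ⟨monomialMatrix σ c, monomialMatrix_mem σ hc1⟩).1 =
      monomialMatrix σ fun j => star (c j) := by
    rw [coe_transposeInvHom]
    ext i j
    simp [mapConjStarHom, monomialMatrix, apply_ite (starRingEnd ℂ)]
  change fromBlocks (monomialMatrix σ c) 0 0 (transposeInvHom (Fin N) _).1 * _ *
    star (fromBlocks (monomialMatrix σ c) 0 0 (transposeInvHom (Fin N) _).1) = _
  rw [h3, rotationTorus_apply, rotationTorus_apply, star_eq_conjTranspose]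
  simp only [fromBlocks_conjTranspose, fromBlocks_multiply, conjTranspose_zero, Matrix.mul_zero,
    Matrix.zero_mul, add_zero, zero_add, monomial_conj_diagonal, monomial_conj_neg_diagonal,
    star_star, circlePoint]
  congr 1
  · congr 1
    funext j
    rw [← hre, mul_right_comm, hc1, one_mul]
  · congr 2
    funext j
    rw [him, mul_right_comm, hc2]
    push_cast
    rfl
  · congr 1
    funext j
    rw [him, mul_right_comm, hc3]
    push_cast
    rfl
  · congr 1
    funext j
    rw [← hre, mul_right_comm, mul_comm (star (c j)), hc1, one_mul]

end CI
end

noncomputable section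

/-! ### Quaternionic Grassmannians -/

section CII

variable {m n : Type} [Fintype m] [DecidableEq m] [Fintype n] [DecidableEq n]

theorem coe_doubleSignMatrix : (doubleSignMatrix m n).1 =
    fromBlocks (signMatrix m n ℂ).1 0 0 (signMatrix m n ℂ).1 := rfl

theorem star_doubleSignMatrix : star (doubleSignMatrix m n).1 = (doubleSignMatrix m n).1 := by
  have h : (signMatrix m n ℂ).1ᴴ = (signMatrix m n ℂ).1 := star_signMatrix
  rw [coe_doubleSignMatrix, star_eq_conjTranspose, fromBlocks_conjTranspose, h]
  simp

theorem map_conj_doubleSignMatrix :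
    (doubleSignMatrix m n).1.map (starRingEnd ℂ) = (doubleSignMatrix m n).1 := by
  rw [coe_doubleSignMatrix, fromBlocks_map, map_conj_signMatrix,
    Matrix.map_zero _ (map_zero _)]

variable (m n) in
/-- The quaternionic structure matrix as a unitary matrix. -/
def unitaryTwistedJ : unitaryGroup ((m ⊕ n) ⊕ (m ⊕ n)) ℂ :=
  doubleSignMatrix m n * unitaryJ (m ⊕ n) ℂ

theorem coe_unitaryTwistedJ : (unitaryTwistedJ m n).1 = twistedJ m n := by
  change (doubleSignMatrix m n).1 * J (m ⊕ n) ℂ = _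
  rw [coe_doubleSignMatrix, J_eq, fromBlocks_multiply, twistedJ]
  simp

theorem twistedJ_mul_self : twistedJ m n * twistedJ m n = -1 := by
  rw [twistedJ, fromBlocks_multiply, ← fromBlocks_one, fromBlocks_neg]
  simp [signMatrix_mul_self]

theorem map_conj_twistedJ : (twistedJ m n).map (starRingEnd ℂ) = twistedJ m n := by
  have h : (-(signMatrix m n ℂ).1).map (starRingEnd ℂ) = -(signMatrix m n ℂ).1 :=
    (map_neg (mapConjStarHom (m ⊕ n)) _).trans (congrArg Neg.neg (map_conj_signMatrix m n))
  rw [twistedJ, fromBlocks_map, map_conj_signMatrix, Matrix.map_zero _ (map_zero _), h]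

theorem transpose_signMatrix : (signMatrix m n ℂ).1ᵀ = (signMatrix m n ℂ).1 := by
  rw [coe_signMatrix, fromBlocks_transpose]
  simp

theorem transpose_twistedJ : (twistedJ m n)ᵀ = -twistedJ m n := by
  rw [twistedJ, fromBlocks_transpose, transpose_neg, transpose_signMatrix, fromBlocks_neg]
  simp

theorem doubleSignMatrix_mul_twistedJ :
    (doubleSignMatrix m n).1 * twistedJ m n = twistedJ m n * (doubleSignMatrix m n).1 := by
  rw [coe_doubleSignMatrix, twistedJ, fromBlocks_multiply, fromBlocks_multiply]
  simp

theorem trace_doubleSignMatrix : (doubleSignMatrix m n).1.trace =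
    ((2 * Fintype.card m : ℕ) : ℂ) - ((2 * Fintype.card n : ℕ) : ℂ) := by
  have h : (doubleSignMatrix m n).1.trace =
      (signMatrix m n ℂ).1.trace + (signMatrix m n ℂ).1.trace := by
    simp only [coe_doubleSignMatrix, trace, Fintype.sum_sum_type, diag_apply, fromBlocks_apply₁₁,
      fromBlocks_apply₂₂]
  rw [h, trace_signMatrix]
  push_cast
  ring

theorem card_quaternionic : 2 * Fintype.card m + 2 * Fintype.card n =
    Fintype.card ((m ⊕ n) ⊕ (m ⊕ n)) := by
  rw [Fintype.card_sum, Fintype.card_sum]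
  ring

theorem linearInvolution_CII : LinearInvolution (compactSymplectic (twistedJ m n))
    (conjByHom (doubleSignMatrix m n)) (symplecticAlgebra (unitaryTwistedJ m n))
    (unitaryConjStarHom (doubleSignMatrix m n)) := by
  rw [← coe_unitaryTwistedJ]
  exact linearInvolution_symplectic (fun _ => rfl)
    (unitaryConj_involutive star_doubleSignMatrix)
    (unitaryConj_mem_symplecticAlgebra (ε := 1) (by norm_num) star_doubleSignMatrix
      map_conj_doubleSignMatrix
      (by rw [one_smul, coe_unitaryTwistedJ]; exact doubleSignMatrix_mul_twistedJ))

theorem doubleSignMatrix_mem : doubleSignMatrix m n ∈ compactSymplectic (twistedJ m n) := by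
  rw [mem_compactSymplectic, map_conj_doubleSignMatrix, doubleSignMatrix_mul_twistedJ]

theorem ensembleCII_eq : ensembleCII m n = {H | ∃ F ∈ {F | ∃ G ∈ compactSymplectic (twistedJ m n),
    G.1 = F ∧ HasSignature F (2 * Fintype.card m) (2 * Fintype.card n)},
      H = F * (doubleSignMatrix m n).1} := by
  ext H
  constructor
  · rintro ⟨G, hG, hs, rfl⟩
    exact ⟨G.1, ⟨G, hG, rfl, hs⟩, rfl⟩
  · rintro ⟨_, ⟨G, hG, rfl, hs⟩, rfl⟩
    exact ⟨G, hG, hs, rfl⟩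

theorem symmetricEnsemble_CII : SymmetricEnsemble (compactSymplectic (twistedJ m n))
    (conjByHom (doubleSignMatrix m n)) (ensembleCII m n) := by
  rw [ensembleCII_eq]
  refine symmetricEnsemble_of_involution linearInvolution_CII star_doubleSignMatrix
    ⟨_, doubleSignMatrix_mem, rfl, ?_⟩ ?_ ?_ ?_ ?_
  · exact (hasSignature_iff (doubleSignMatrix m n).2 card_quaternionic).2
      ⟨star_doubleSignMatrix, trace_doubleSignMatrix⟩
  · rintro _ ⟨F, hF, rfl, -⟩
    exact ⟨F * doubleSignMatrix m n, mul_mem hF doubleSignMatrix_mem, rfl⟩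
  · rintro _ ⟨F, -, rfl, hF, -⟩
    exact hF
  · rintro g hg _ ⟨F, hF, rfl, hs⟩
    exact ⟨g * F * g⁻¹, mul_mem (mul_mem hg hF) (inv_mem hg), rfl,
      hs.conj F.2 card_quaternionic g⟩
  · rintro _ ⟨F, hF, rfl, hs⟩ hu
    rw [hasSignature_iff F.2 card_quaternionic] at hs
    obtain ⟨v, w, hv, hw, hvw, hwv, hPv, hPw, hHv, hHw⟩ := exists_orthonormal_eigenvectors
      (involution_mul_self F.2 hs.1) (involution_mul_self (doubleSignMatrix m n).2
        star_doubleSignMatrix) hs.1 star_doubleSignMatrix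
      (hs.2.trans trace_doubleSignMatrix.symm) hu
    have hr : (unitaryTwistedJ m n).1.map (starRingEnd ℂ) = (unitaryTwistedJ m n).1 := by
      rw [coe_unitaryTwistedJ, map_conj_twistedJ]
    have hB : (unitaryTwistedJ m n).1 * (unitaryTwistedJ m n).1 = -1 := by
      rw [coe_unitaryTwistedJ, twistedJ_mul_self]
    have hBt : (unitaryTwistedJ m n).1ᵀ = -(unitaryTwistedJ m n).1 := by
      rw [coe_unitaryTwistedJ, transpose_twistedJ]
    have hP : (doubleSignMatrix m n).1 ∈ symplecticAlgebra (unitaryTwistedJ m n) :=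
      linearInvolution_CII.coe_mem _ doubleSignMatrix_mem
    have hH : F.1 * (doubleSignMatrix m n).1 ∈ symplecticAlgebra (unitaryTwistedJ m n) :=
      mul_mem (linearInvolution_CII.coe_mem _ hF) hP
    -- The structure j commutes with both diag(I', I') and H, so jv and jw have the same eigenvalues
    -- as v and w, and v, w, jv, jw are orthonormal.
    obtain ⟨j, hj⟩ : ∃ j, j = quatConj (unitaryTwistedJ m n).1 := ⟨_, rfl⟩
    have hPjv : (doubleSignMatrix m n).1 *ᵥ j v = j v := by
      rw [hj, mulVec_quatConj hP, hPv]
    have hPjw : (doubleSignMatrix m n).1 *ᵥ j w = -j w := by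
      rw [hj, mulVec_quatConj hP, hPw, quatConj_neg]
    have hHjv : (F.1 * (doubleSignMatrix m n).1) *ᵥ j v = -j v := by
      rw [hj, mulVec_quatConj hH, hHv, quatConj_neg]
    have hHjw : (F.1 * (doubleSignMatrix m n).1) *ᵥ j w = -j w := by
      rw [hj, mulVec_quatConj hH, hHw, quatConj_neg]
    have hjv : star (j v) ⬝ᵥ j v = 1 := by rw [hj, star_quatConj_dotProduct, hv, star_one]
    have hjw : star (j w) ⬝ᵥ j w = 1 := by rw [hj, star_quatConj_dotProduct, hw, star_one]
    have hvjv : star v ⬝ᵥ j v = 0 := by rw [hj, star_dotProduct_quatConj_self hBt]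
    have hwjw : star w ⬝ᵥ j w = 0 := by rw [hj, star_dotProduct_quatConj_self hBt]
    have hsymm : ∀ {x y : (m ⊕ n) ⊕ (m ⊕ n) → ℂ}, star x ⬝ᵥ y = 0 → star y ⬝ᵥ x = 0 :=
      fun h => by rw [star_dotProduct, h, star_zero]
    obtain ⟨hjvjw, hjwjv⟩ := star_dotProduct_eq_zero_of_eigen star_doubleSignMatrix hPjv hPjw
    obtain ⟨hvjw, hjwv⟩ := star_dotProduct_eq_zero_of_eigen star_doubleSignMatrix hPv hPjw
    obtain ⟨hjvw, hwjv⟩ := star_dotProduct_eq_zero_of_eigen star_doubleSignMatrix hPjv hPw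
    -- Adding the j-image makes the generator symplectic. The two summands act in orthogonal planes,
    -- so the cubic relation persists.
    refine ⟨skewPair v w + skewPair (j v) (j w), ⟨?_, ?_, ?_⟩, ?_, ?_, ?_⟩
    · rw [hj]
      exact skewPair_add_mem hr hB v w
    · rw [star_add, star_skewPair, star_skewPair, neg_add]
    · change (doubleSignMatrix m n).1 * _ * star (doubleSignMatrix m n).1 = _
      rw [mul_add, add_mul, mul_skewPair_mul_star, mul_skewPair_mul_star, hPv, hPw, hPjv, hPjw,
        skewPair_neg_right, skewPair_neg_right, neg_add]
    · intro h0
      have h1 := congrArg (· *ᵥ v) h0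
      simp only [add_mulVec, zero_mulVec] at h1
      rw [skewPair_mulVec_left hv hwv, skewPair_mulVec_of_orthogonal (hsymm hvjv) hjwv,
        add_zero] at h1
      rw [h1] at hw
      simp at hw
    · exact add_cube_of_mul_eq_zero (skewPair_cube hv hw hvw hwv)
        (skewPair_cube hjv hjw hjvjw hjwjv)
        (skewPair_mul_eq_zero hvjv hwjv hvjw hwjw)
        (skewPair_mul_eq_zero (hsymm hvjv) hjwv hjvw (hsymm hwjw))
    · rw [mul_add, mul_skewPair hHv hHw, mul_skewPair hHjv hHjw, neg_add]

theorem doubleSignConj_fromBlocks (a b c d : Matrix (m ⊕ n) (m ⊕ n) ℂ) :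
    unitaryConjStarHom (doubleSignMatrix m n) (fromBlocks a b c d) =
      fromBlocks (unitaryConjStarHom (signMatrix m n ℂ) a)
        (unitaryConjStarHom (signMatrix m n ℂ) b) (unitaryConjStarHom (signMatrix m n ℂ) c)
        (unitaryConjStarHom (signMatrix m n ℂ) d) := by
  change (doubleSignMatrix m n).1 * _ * star (doubleSignMatrix m n).1 = fromBlocks
    ((signMatrix m n ℂ).1 * a * star (signMatrix m n ℂ).1)
    ((signMatrix m n ℂ).1 * b * star (signMatrix m n ℂ).1)
    ((signMatrix m n ℂ).1 * c * star (signMatrix m n ℂ).1)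
    ((signMatrix m n ℂ).1 * d * star (signMatrix m n ℂ).1)
  rw [star_doubleSignMatrix, star_signMatrix, coe_doubleSignMatrix, fromBlocks_multiply,
    fromBlocks_multiply]
  simp

/-- The four block equations come in two equivalent pairs, so the upper blocks are free and
determine the lower ones. -/
theorem fromBlocks_mem_symplecticAlgebra {a b c d : Matrix (m ⊕ n) (m ⊕ n) ℂ} :
    fromBlocks a b c d ∈ symplecticAlgebra (unitaryTwistedJ m n) ↔
      d = unitaryConjStarHom (signMatrix m n ℂ) (a.map (starRingEnd ℂ)) ∧
      c = -unitaryConjStarHom (signMatrix m n ℂ) (b.map (starRingEnd ℂ)) := by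
  obtain ⟨s, hs⟩ : ∃ s, s = (signMatrix m n ℂ).1 := ⟨_, rfl⟩
  have hss : s * s = 1 := by rw [hs, signMatrix_mul_self]
  have hsr : s.map (starRingEnd ℂ) = s := by rw [hs, map_conj_signMatrix]
  have e1 : ∀ x y : Matrix (m ⊕ n) (m ⊕ n) ℂ, x * s = s * y ↔ x = s * y * s := fun x y => by
    constructor
    · intro h
      rw [← h, mul_assoc, hss, mul_one]
    · rintro rfl
      rw [mul_assoc, hss, mul_one]
  have e2 : ∀ x y : Matrix (m ⊕ n) (m ⊕ n) ℂ, x = s * y.map (starRingEnd ℂ) * s ↔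
      y = s * x.map (starRingEnd ℂ) * s := by
    have : ∀ x y : Matrix (m ⊕ n) (m ⊕ n) ℂ, x = s * y.map (starRingEnd ℂ) * s →
        y = s * x.map (starRingEnd ℂ) * s := by
      rintro _ y rfl
      rw [map_conj_mul, map_conj_mul, hsr, map_conj_map_conj, ← mul_assoc, ← mul_assoc, hss,
        one_mul, mul_assoc, hss, mul_one]
    exact fun x y => ⟨this x y, this y x⟩
  change _ ↔ d = (signMatrix m n ℂ).1 * _ * star (signMatrix m n ℂ).1 ∧
    c = -((signMatrix m n ℂ).1 * _ * star (signMatrix m n ℂ).1)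
  rw [star_signMatrix, mem_symplecticAlgebra, coe_unitaryTwistedJ, twistedJ, fromBlocks_map,
    fromBlocks_multiply, fromBlocks_multiply, fromBlocks_inj, ← hs]
  simp only [Matrix.mul_zero, Matrix.zero_mul, add_zero, zero_add, mul_neg, neg_mul, neg_inj]
  have e3 : ∀ x y : Matrix (m ⊕ n) (m ⊕ n) ℂ, x * s = -(s * y) ↔ x = -(s * y * s) := fun x y => by
    rw [← mul_neg, e1, mul_neg, neg_mul]
  have e4 : -(c * s) = s * b.map (starRingEnd ℂ) ↔ c * s = -(s * b.map (starRingEnd ℂ)) :=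
    neg_eq_iff_eq_neg
  have e5 : b = -(s * c.map (starRingEnd ℂ) * s) ↔ c = -(s * b.map (starRingEnd ℂ) * s) := by
    have h1 : ∀ x : Matrix (m ⊕ n) (m ⊕ n) ℂ, -(s * x.map (starRingEnd ℂ) * s) =
        s * (-x).map (starRingEnd ℂ) * s := fun x => by
      have h2 : (-x).map (starRingEnd ℂ) = -x.map (starRingEnd ℂ) :=
        map_neg (mapConjStarHom (m ⊕ n)) x
      rw [h2, mul_neg, neg_mul]
    rw [h1, e2]
    exact neg_eq_iff_eq_neg
  rw [e3, e1, e1, e4, e3, e2 a d, e5]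
  tauto

/-! ### The torus of a quaternionic Grassmannian -/

section Torus

variable {L R : ℕ}

theorem map_conj_groupedTorus (x : ℝ × (Fin R → ℂ)) :
    (groupedTorus ℂ L R x).map (starRingEnd ℂ) = groupedTorus ℂ L R x := by
  rw [groupedTorus_apply, fromBlocks_map, fromBlocks_map, imagColumn]
  congr 1
  · congr 1 <;> ext i j <;> simp [diagonal_apply, apply_ite (starRingEnd ℂ)]
  · ext (i | i) j
    · simp
    · by_cases h : i = j <;> simp [h]
  · ext i (j | j)
    · simp
    · by_cases h : j = i <;> simp [h]
  · ext i j
    by_cases h : i = j <;> simp [h]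

theorem regularTorus_CII (L R : ℕ) :
    RegularTorus (symplecticAlgebra (unitaryTwistedJ (Fin L ⊕ Fin R) (Fin R)))
    (unitaryConjStarHom (doubleSignMatrix (Fin L ⊕ Fin R) (Fin R)))
    (doubleTorus (groupedTorus ℂ L R)) where
  mem x := by
    rw [doubleTorus_apply, fromBlocks_mem_symplecticAlgebra, map_conj_groupedTorus,
      groupedTorus_star, Matrix.map_zero _ (map_zero _), map_zero, neg_zero]
    exact ⟨rfl, rfl⟩
  map_star x := by
    rw [doubleTorus_apply, doubleTorus_apply, doubleSignConj_fromBlocks, groupedTorus_star,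
      groupedTorus_star, map_zero]
  eq_zero z h := by
    rw [doubleTorus_apply] at h
    exact groupedTorus_eq_zero (congrArg toBlocks₁₁ h)
  regular := by
    refine ⟨regularParam, fun Z ⟨hL, hZ, hθ⟩ hc => ?_⟩
    obtain ⟨P, Q, c, d, rfl⟩ : ∃ a b c d, Z = fromBlocks a b c d :=
      ⟨_, _, _, _, (fromBlocks_toBlocks Z).symm⟩
    rw [doubleSignConj_fromBlocks, fromBlocks_neg, fromBlocks_inj] at hθ
    obtain ⟨hP, hQ, hc', -⟩ := hθ
    rw [fromBlocks_mem_symplecticAlgebra] at hL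
    obtain ⟨rfl, rfl⟩ := hL
    rw [doubleTorus_apply, star_imagPoint, map_neg] at hc
    have hc' : _ * _ = _ * _ := hc
    rw [fromBlocks_multiply, fromBlocks_multiply, fromBlocks_inj] at hc'
    simp only [Matrix.mul_zero, Matrix.zero_mul, add_zero, zero_add] at hc'
    obtain ⟨hPc, hQc, -, -⟩ := hc'
    rw [star_eq_conjTranspose, fromBlocks_conjTranspose, fromBlocks_neg, fromBlocks_inj] at hZ
    obtain ⟨hPs, hQs, -, -⟩ := hZ
    obtain ⟨s, rfl⟩ := eq_groupedTorus_of_commute hPs hP hPc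
    -- Commuting with diag(D, -D) makes Q anticommute with D, and Q is antisymmetric with vanishing
    -- diagonal blocks. The relations are those of the Grassmannian with star b replaced by -b, so
    -- the diagonal entries, real there, satisfy b = -b and vanish.
    have hQ0 : Q = 0 := by
      have hQ1 : Qᵀ = -Q := by
        have h1 : unitaryConjStarHom (signMatrix (Fin L ⊕ Fin R) (Fin R) ℂ)
            (Q.map (starRingEnd ℂ)) = -Q.map (starRingEnd ℂ) := by
          have h2 := congrArg (mapConjStarHom _) hQ
          rw [map_neg] at h2
          change ((signMatrix (Fin L ⊕ Fin R) (Fin R) ℂ).1 * Q * star (signMatrix (Fin L ⊕ Fin R) (Fin R) ℂ).1).map (starRingEnd ℂ) =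
            -Q.map (starRingEnd ℂ) at h2
          rw [map_conj_mul, map_conj_mul, star_signMatrix, map_conj_signMatrix] at h2
          change (signMatrix (Fin L ⊕ Fin R) (Fin R) ℂ).1 * _ * star (signMatrix (Fin L ⊕ Fin R) (Fin R) ℂ).1 = _
          rw [star_signMatrix, h2]
        rw [h1, neg_neg] at hQs
        have h3 := congrArg star hQs
        rw [star_neg] at h3
        have h4 : star ((Q.map (starRingEnd ℂ))ᴴ) = Q.map (starRingEnd ℂ) :=
          star_star (Q.map (starRingEnd ℂ))
        rw [h4] at h3
        ext i j
        have h5 := congrFun (congrFun h3 j) i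
        simp only [map_apply, Matrix.neg_apply, star_apply, RCLike.star_def] at h5
        have h6 := congrArg (starRingEnd ℂ) h5
        simp only [map_neg, Complex.conj_conj] at h6
        rw [transpose_apply, Matrix.neg_apply, h6]
      obtain ⟨a, b, c, d, rfl⟩ : ∃ a b c d, Q = fromBlocks a b c d :=
        ⟨_, _, _, _, (fromBlocks_toBlocks Q).symm⟩
      rw [signConj_fromBlocks, fromBlocks_neg, fromBlocks_inj] at hQ
      obtain rfl := eq_zero_of_eq_neg hQ.1
      obtain rfl := eq_zero_of_eq_neg hQ.2.2.2
      rw [fromBlocks_transpose, fromBlocks_neg, fromBlocks_inj] at hQ1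
      obtain rfl : c = -bᵀ := by rw [hQ1.2.2.1, neg_neg]
      rw [groupedTorus_imagPoint, fromBlocks_neg, fromBlocks_multiply, fromBlocks_multiply,
        fromBlocks_inj] at hQc
      simp only [Matrix.mul_zero, Matrix.zero_mul, add_zero, zero_add, Matrix.mul_neg,
        Matrix.neg_mul, neg_neg, neg_zero] at hQc
      obtain ⟨h1, -, -, h2⟩ := hQc
      have e0 : ∀ i j, b (Sum.inl i) j = 0 := fun i j => by
        have := congrFun (congrFun h1 (Sum.inl i)) (Sum.inr j)
        rw [Matrix.neg_apply, mul_imagColumn_transpose_apply_inr, imagColumn_mul_apply_inl,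
          imagPoint_im, neg_eq_zero] at this
        exact (mul_eq_zero.1 this).resolve_right (regularParam_ne_zero j)
      have e1 : ∀ i j, b (Sum.inr i) j * (regularParam j : ℝ) =
          (regularParam i : ℝ) * -b (Sum.inr j) i := fun i j => by
        have := congrFun (congrFun h1 (Sum.inr i)) (Sum.inr j)
        rw [Matrix.neg_apply, mul_imagColumn_transpose_apply_inr, imagColumn_mul_apply_inr,
          imagPoint_im, imagPoint_im, transpose_apply] at this
        linear_combination -this
      have e2 : ∀ i j, -b (Sum.inr j) i * (regularParam j : ℝ) =
          (regularParam i : ℝ) * b (Sum.inr i) j := fun i j => by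
        have := congrFun (congrFun h2 i) j
        rw [Matrix.neg_apply, mul_imagColumn_apply, imagColumn_transpose_mul_apply, imagPoint_im,
          imagPoint_im, transpose_apply] at this
        rw [neg_mul]
        exact this
      have hb : b = 0 := by
        ext (i | i) j
        · exact e0 i j
        · by_cases hij : i = j
          · subst hij
            have h3 := e1 i i
            rw [mul_comm] at h3
            exact self_eq_neg.1 (mul_left_cancel₀ (regularParam_ne_zero i) h3)
          · exact eq_zero_of_regular (x := fun i j => b (Sum.inr i) j) e1 e2 hij
      rw [hb]
      simp
    subst hQ0
    refine ⟨s, ?_⟩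
    rw [doubleTorus_apply, map_conj_groupedTorus, groupedTorus_star,
      Matrix.map_zero _ (map_zero _), map_zero, neg_zero]

end Torus

/-- Regrouping the coordinates as M, M, R, R turns diag(I', I') into diag(1, -1) and the form into
diag(J, -J). Fixed elements are then block diagonal, and -J defines the same group as J. -/
theorem mem_symplecticProduct (g : unitaryGroup ((m ⊕ n) ⊕ (m ⊕ n)) ℂ) :
    g ∈ symplecticProduct m n ↔
      g ∈ compactSymplectic (twistedJ m n) ∧ conjByHom (doubleSignMatrix m n) g = g := by
  obtain ⟨e, he⟩ : ∃ e, e = Equiv.sumSumSumComm m m n n := ⟨_, rfl⟩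
  have hinj : Function.Injective (reindexStarHom ℂ e) := (reindex e e).injective
  have hP : (doubleSignMatrix m n).1 = reindexStarHom ℂ e (signMatrix (m ⊕ m) (n ⊕ n) ℂ).1 := by
    subst he
    change _ = reindex _ _ _
    rw [coe_doubleSignMatrix, coe_signMatrix, coe_signMatrix]
    ext ((i | i) | (i | i)) ((j | j) | (j | j)) <;> simp [one_apply]
  have hB : twistedJ m n = reindexStarHom ℂ e (fromBlocks (J m ℂ) 0 0 (-J n ℂ)) := by
    subst he
    change _ = reindex _ _ _
    rw [twistedJ, coe_signMatrix, J_eq, J_eq]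
    ext ((i | i) | (i | i)) ((j | j) | (j | j)) <;> simp
  have hmap : ∀ X : Matrix ((m ⊕ m) ⊕ (n ⊕ n)) ((m ⊕ m) ⊕ (n ⊕ n)) ℂ,
      (reindexStarHom ℂ e X).map (starRingEnd ℂ) = reindexStarHom ℂ e (X.map (starRingEnd ℂ)) :=
    fun _ => rfl
  have key : ∀ h : unitaryGroup ((m ⊕ m) ⊕ (n ⊕ n)) ℂ,
      reindexHom ℂ e h ∈ compactSymplectic (twistedJ m n) ↔
        h.1 * fromBlocks (J m ℂ) 0 0 (-J n ℂ) =
          fromBlocks (J m ℂ) 0 0 (-J n ℂ) * h.1.map (starRingEnd ℂ) := fun h => by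
    rw [mem_compactSymplectic, hB]
    change reindexStarHom ℂ e h.1 * _ = _ * (reindexStarHom ℂ e h.1).map (starRingEnd ℂ) ↔ _
    rw [hmap, ← map_mul, ← map_mul, hinj.eq_iff]
  have key2 : ∀ h : unitaryGroup ((m ⊕ m) ⊕ (n ⊕ n)) ℂ,
      conjByHom (doubleSignMatrix m n) (reindexHom ℂ e h) = reindexHom ℂ e h ↔
        conjByHom (signMatrix (m ⊕ m) (n ⊕ n) ℂ) h = h := fun h => by
    rw [Subtype.ext_iff, Subtype.ext_iff]
    change (doubleSignMatrix m n).1 * reindexStarHom ℂ e h.1 * star (doubleSignMatrix m n).1 =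
      reindexStarHom ℂ e h.1 ↔
      (signMatrix (m ⊕ m) (n ⊕ n) ℂ).1 * h.1 * star (signMatrix (m ⊕ m) (n ⊕ n) ℂ).1 = h.1
    rw [hP, ← StarHomClass.map_star, ← map_mul, ← map_mul, hinj.eq_iff]
  have key3 : ∀ p : unitaryGroup (m ⊕ m) ℂ × unitaryGroup (n ⊕ n) ℂ,
      (blockDiagHom _ _ ℂ p).1 * fromBlocks (J m ℂ) 0 0 (-J n ℂ) =
          fromBlocks (J m ℂ) 0 0 (-J n ℂ) * (blockDiagHom _ _ ℂ p).1.map (starRingEnd ℂ) ↔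
        p.1 ∈ compactSymplectic (J m ℂ) ∧ p.2 ∈ compactSymplectic (J n ℂ) := fun p => by
    rw [mem_compactSymplectic, mem_compactSymplectic]
    change fromBlocks p.1.1 0 0 p.2.1 * _ = _ * (fromBlocks p.1.1 0 0 p.2.1).map _ ↔ _
    rw [fromBlocks_map, fromBlocks_multiply, fromBlocks_multiply, fromBlocks_inj]
    simp
  constructor
  · rintro ⟨p, hp, rfl⟩
    change reindexHom ℂ (Equiv.sumSumSumComm m m n n) (blockDiagHom _ _ ℂ p) ∈ _ ∧
      conjByHom _ (reindexHom ℂ (Equiv.sumSumSumComm m m n n) (blockDiagHom _ _ ℂ p)) =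
        reindexHom ℂ (Equiv.sumSumSumComm m m n n) (blockDiagHom _ _ ℂ p)
    rw [← he, key, key2, key3, ← mem_range_blockDiagHom]
    exact ⟨hp, _, rfl⟩
  · rintro ⟨h1, h2⟩
    obtain ⟨h, rfl⟩ : ∃ h, reindexHom ℂ e h = g := by
      refine ⟨reindexHom ℂ e.symm g, Subtype.ext ?_⟩
      change reindex e e (reindex e.symm e.symm g.1) = g.1
      ext i j
      simp
    rw [key2, ← mem_range_blockDiagHom] at h2
    obtain ⟨p, rfl⟩ := h2
    rw [key, key3] at h1
    exact ⟨p, h1, by rw [he]; rfl⟩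

theorem isMatrixRealization_CII (L R : ℕ) :
    IsMatrixRealization (compactSymplectic (twistedJ (Fin L ⊕ Fin R) (Fin R)))
      (symplecticProduct (Fin L ⊕ Fin R) (Fin R))
      (conjByHom (doubleSignMatrix (Fin L ⊕ Fin R) (Fin R)))
      (ensembleCII (Fin L ⊕ Fin R) (Fin R)) (torusCII L R) R := by
  refine linearInvolution_CII.isMatrixRealization (regularTorus_CII L R) symmetricEnsemble_CII
    mem_symplecticProduct ?_ (fun l m h => ?_)
  · simp only [doubleTorus_apply, star_circlePoint, groupedTorus_circlePoint]
    rfl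
  · have hinv : ∀ x : Fin R → Circle, (fun j => ((x⁻¹ j : Circle) : ℂ).re) =
        fun j => (x j : ℂ).re := fun x => by
      funext j
      rw [Pi.inv_apply, Circle.coe_inv_eq_conj, Complex.conj_re]
    have hinv' : ∀ (x : Fin R → Circle) j, ((x⁻¹ j : Circle) : ℂ).im = -(x j : ℂ).im := fun x j => by
      rw [Pi.inv_apply, Circle.coe_inv_eq_conj, Complex.conj_im]
    have hev : ∀ x : Fin R → Circle, (complexEigenvalues (doubleTorus (groupedTorus ℂ L R)
        (circlePoint x))).map Complex.re = (Multiset.replicate L 1 + Multiset.replicate L 1) +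
          4 • Finset.univ.val.map fun j => (x j : ℂ).re := fun x => by
      rw [doubleTorus_apply, star_circlePoint, groupedTorus_circlePoint, groupedTorus_circlePoint,
        complexEigenvalues_fromBlocks, Multiset.map_add,
        re_complexEigenvalues_grouped (fun _ => rfl), re_complexEigenvalues_grouped (fun _ => rfl),
        hinv, add_add_add_comm, ← add_nsmul]
    have h1 := congrArg (Multiset.map Complex.re) h
    rw [hev, hev] at h1
    obtain ⟨σ, ε, hε, hre, him⟩ := exists_signed_perm (eq_of_add_nsmul_eq four_ne_zero h1)
    have hε1 : ∀ j, ε j * ε j = 1 := fun j => by rcases hε j with h2 | h2 <;> rw [h2] <;> norm_num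
    have hmem : monomialMatrix σ (fun j => (ε j : ℂ)) ∈ unitaryGroup (Fin R) ℂ :=
      monomialMatrix_mem σ fun j => by
        rw [RCLike.star_def, Complex.conj_ofReal, ← Complex.ofReal_mul, hε1, Complex.ofReal_one]
    have hmem1 : monomialMatrix σ (fun _ => (1 : ℂ)) ∈ unitaryGroup (Fin R) ℂ :=
      monomialMatrix_mem σ (by simp)
    obtain ⟨k, hk⟩ : ∃ k : unitaryGroup ((Fin L ⊕ Fin R) ⊕ Fin R) ℂ, k =
      blockDiagHom _ _ ℂ (blockDiagHom _ _ ℂ (1, ⟨_, hmem1⟩), ⟨_, hmem⟩) := ⟨_, rfl⟩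
    have hk1 : k.1 = fromBlocks (fromBlocks 1 0 0 (monomialMatrix σ fun _ => (1 : ℂ))) 0 0
        (monomialMatrix σ fun j => ((ε j : ℝ) : ℂ)) := by rw [hk]; rfl
    have hkr : k.1.map (starRingEnd ℂ) = k.1 := by
      rw [hk1, fromBlocks_map, fromBlocks_map]
      congr 1
      · congr 1 <;> ext i j <;> simp [monomialMatrix, one_apply, apply_ite (starRingEnd ℂ)]
      · ext i j; simp
      · ext i j; simp
      · ext i j; simp [monomialMatrix, apply_ite (starRingEnd ℂ)]
    have hks : unitaryConjStarHom (signMatrix (Fin L ⊕ Fin R) (Fin R) ℂ) k.1 = k.1 :=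
      congrArg Subtype.val ((mem_range_blockDiagHom k).1 ⟨_, hk.symm⟩)
    refine ⟨blockDiagHom _ _ ℂ (k, k), (mem_symplecticProduct _).2 ⟨?_, Subtype.ext ?_⟩, ?_⟩
    · rw [mem_compactSymplectic, ← coe_unitaryTwistedJ]
      refine mem_symplecticAlgebra.1 (fromBlocks_mem_symplecticAlgebra.2 ⟨?_, ?_⟩)
      · rw [hkr, hks]
      · rw [Matrix.map_zero _ (map_zero _), map_zero, neg_zero]
    · refine (doubleSignConj_fromBlocks k.1 0 0 k.1).trans ?_
      rw [hks, map_zero]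
      rfl
    · have hc := groupedTorus_conj (𝕜 := ℂ) (L := L) hre him hε1
      -- Inversion keeps cosines and negates sines, so the same σ and ε, and hence diag(k, k), work
      -- for the second block.
      have hc' := groupedTorus_conj (𝕜 := ℂ) (L := L) (l := l⁻¹) (m := m⁻¹) (σ := σ) (ε := ε)
        (fun j => (congrFun (hinv l) (σ j)).trans ((hre j).trans (congrFun (hinv m) j).symm))
        (fun j => by rw [hinv', hinv', him, mul_neg]) hε1
      change fromBlocks k.1 0 0 k.1 * _ * star (fromBlocks k.1 0 0 k.1) = _
      rw [doubleTorus_apply, doubleTorus_apply, star_circlePoint, star_circlePoint,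
        star_eq_conjTranspose, fromBlocks_conjTranspose, fromBlocks_multiply, fromBlocks_multiply]
      simp only [conjTranspose_zero, Matrix.mul_zero, Matrix.zero_mul, add_zero, zero_add]
      rw [hk1]
      exact congrArg₂ (fun x y => fromBlocks x 0 0 y) hc hc'

end CII
end

noncomputable section

/-! ### Determinants -/

section Determinants

variable {n : Type} [Fintype n] [DecidableEq n]

/-- A real matrix with positive definite symmetric part has positive determinant. -/
theorem det_pos_of_forall_dotProduct_pos {M : Matrix n n ℝ}
    (h : ∀ x : n → ℝ, x ≠ 0 → 0 < x ⬝ᵥ M *ᵥ x) : 0 < M.det := by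
  by_contra! hle
  -- Along the segment from 1 to M the determinant would have to vanish somewhere, but the quadratic
  -- form of every matrix on it is positive.
  have hcont : Continuous fun t : ℝ => ((1 - t) • (1 : Matrix n n ℝ) + t • M).det :=
    Continuous.matrix_det (by fun_prop)
  have h01 : (0 : ℝ) ∈ Set.Icc (((1 - (1 : ℝ)) • (1 : Matrix n n ℝ) + (1 : ℝ) • M).det)
      (((1 - (0 : ℝ)) • (1 : Matrix n n ℝ) + (0 : ℝ) • M).det) := by
    simpa using hle
  obtain ⟨t, ht, hdet⟩ := intermediate_value_Icc' (zero_le_one' ℝ) hcont.continuousOn h01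
  obtain ⟨x, hx, hx0⟩ := exists_mulVec_eq_zero_iff.2 hdet
  have h1 : (1 - t) * (x ⬝ᵥ x) + t * (x ⬝ᵥ M *ᵥ x) = 0 := by
    have := congrArg (x ⬝ᵥ ·) hx0
    simpa [add_mulVec, smul_mulVec] using this
  have h2 : 0 < x ⬝ᵥ x := lt_of_le_of_ne (Finset.sum_nonneg fun i _ => mul_self_nonneg _)
    fun h3 => hx (dotProduct_self_eq_zero.1 h3.symm)
  have h3 := h x hx
  rcases eq_or_lt_of_le ht.1 with h4 | h4
  · rw [← h4] at h1
    linarith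
  · have := mul_pos h4 h3
    have := mul_nonneg (sub_nonneg.2 ht.2) h2.le
    linarith

/-- The determinant of the realification of a complex matrix. -/
theorem det_realification (a c : Matrix n n ℝ) : (fromBlocks a (-c) c a).det =
    Complex.normSq (a.map Complex.ofRealHom + Complex.I • c.map Complex.ofRealHom).det := by
  obtain ⟨A, hA⟩ : ∃ A, A = a.map Complex.ofRealHom := ⟨_, rfl⟩
  obtain ⟨C, hC⟩ : ∃ C, C = c.map Complex.ofRealHom := ⟨_, rfl⟩
  have hz : A - Complex.I • C = (starRingEnd ℂ).mapMatrix (A + Complex.I • C) := by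
    rw [hA, hC]
    ext i j
    simp [sub_eq_add_neg]
  have hn : (-c).map Complex.ofRealHom = -C := by
    rw [hC]; ext i j; simp
  have h1 : (fromBlocks A (-C) C A).det = (A + Complex.I • C).det * (A - Complex.I • C).det := by
    -- A unipotent change of basis makes the matrix block triangular, with diagonal blocks A + iC
    -- and A - iC.
    have h2 : fromBlocks 1 (Complex.I • 1) 0 1 * fromBlocks A (-C) C A *
        fromBlocks 1 (-(Complex.I • 1)) 0 1 =
          fromBlocks (A + Complex.I • C) 0 C (A - Complex.I • C) := by
      rw [fromBlocks_multiply, fromBlocks_multiply]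
      congr 1
      · simp
      · simp only [one_mul, mul_one, smul_mul_assoc, mul_neg, mul_smul_comm, smul_add, smul_smul,
          Complex.I_mul_I, neg_smul, one_smul]
        abel
      · simp
      · simp only [zero_mul, one_mul, mul_one, mul_neg, mul_smul_comm, zero_add]
        abel
    have h3 := congrArg det h2
    rwa [det_mul, det_mul, det_fromBlocks_zero₂₁, det_fromBlocks_zero₂₁, det_fromBlocks_zero₁₂,
      det_one, mul_one, one_mul, mul_one] at h3
  apply Complex.ofReal_injective
  rw [Complex.normSq_eq_conj_mul_self, ← hA, ← hC, RingHom.map_det, ← hz, mul_comm, ← h1]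
  change Complex.ofRealHom _ = _
  rw [RingHom.map_det]
  congr 1
  change (fromBlocks a (-c) c a).map Complex.ofRealHom = _
  rw [fromBlocks_map, hn, hA, hC]

/-- The rank-one determinant formula gives 1 - 2 u·u; the matrix is a reflection. -/
theorem det_one_sub_two_smul_vecMulVec {u : n → ℝ} (hu : u ⬝ᵥ u = 1) :
    (1 - (2 : ℝ) • vecMulVec u u).det = -1 := by
  have h : (1 : Matrix n n ℝ) - (2 : ℝ) • vecMulVec u u =
      1 + replicateCol Unit ((-2 : ℝ) • u) * replicateRow Unit u := by
    rw [← vecMulVec_eq, smul_vecMulVec, neg_smul, sub_eq_add_neg]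
  rw [h, det_one_add_replicateCol_mul_replicateRow, dotProduct_smul, hu]
  norm_num

end Determinants

/-! ### Complex structures on Euclidean space -/

section DIII

variable {n : Type} [Fintype n] [DecidableEq n]

theorem fromBlocks_commute_J {𝕜 : Type} [RCLike 𝕜] {a b c d : Matrix n n 𝕜} :
    fromBlocks a b c d * J n 𝕜 = J n 𝕜 * fromBlocks a b c d ↔ d = a ∧ b = -c := by
  rw [J_eq, fromBlocks_multiply, fromBlocks_multiply, fromBlocks_inj]
  simp only [Matrix.mul_zero, Matrix.zero_mul, mul_one, one_mul, mul_neg, neg_mul, add_zero,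
    zero_add, neg_inj]
  constructor
  · rintro ⟨h1, h2, -, -⟩
    exact ⟨h2.symm, h1⟩
  · rintro ⟨rfl, rfl⟩
    exact ⟨rfl, rfl, rfl, rfl⟩

/-- Such a matrix is complex linear, and its real determinant is the squared modulus of the complex
one. -/
theorem det_nonneg_of_commute_J {Y : Matrix (n ⊕ n) (n ⊕ n) ℝ}
    (h : Y * J n ℝ = J n ℝ * Y) : 0 ≤ Y.det := by
  obtain ⟨a, b, c, d, rfl⟩ : ∃ a b c d, Y = fromBlocks a b c d :=
    ⟨_, _, _, _, (fromBlocks_toBlocks Y).symm⟩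
  obtain ⟨rfl, rfl⟩ := fromBlocks_commute_J.1 h
  rw [det_realification]
  exact Complex.normSq_nonneg _

theorem mem_properRotations {g : unitaryGroup n ℝ} : g ∈ properRotations n ↔ g.1.det = 1 := Iff.rfl

theorem coe_conjByHom_J_inv (g : unitaryGroup (n ⊕ n) ℝ) :
    (conjByHom (unitaryJ n ℝ)⁻¹ g).1 = -J n ℝ * g.1 * J n ℝ := by
  change star (J n ℝ) * g.1 * star (star (J n ℝ)) = _
  rw [star_star, star_J]

theorem coe_unitaryConj_J_inv (X : Matrix (n ⊕ n) (n ⊕ n) ℝ) :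
    unitaryConjStarHom (unitaryJ n ℝ)⁻¹ X = -J n ℝ * X * J n ℝ := by
  change star (J n ℝ) * X * star (star (J n ℝ)) = _
  rw [star_star, star_J]

theorem unitaryConj_J_inv_fromBlocks (a b c d : Matrix n n ℝ) :
    unitaryConjStarHom (unitaryJ n ℝ)⁻¹ (fromBlocks a b c d) = fromBlocks d (-c) (-b) a := by
  rw [coe_unitaryConj_J_inv, J_eq, fromBlocks_neg, fromBlocks_multiply, fromBlocks_multiply]
  simp

theorem linearInvolution_DIII : LinearInvolution (properRotations (n ⊕ n))
    (conjByHom (unitaryJ n ℝ)⁻¹) ⊤ (unitaryConjStarHom (unitaryJ n ℝ)⁻¹) where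
  coe_map _ := rfl
  involutive X := by
    rw [coe_unitaryConj_J_inv, coe_unitaryConj_J_inv]
    calc -J n ℝ * (-J n ℝ * X * J n ℝ) * J n ℝ
        = (J n ℝ * J n ℝ) * X * (J n ℝ * J n ℝ) := by noncomm_ring
      _ = X := by rw [J_squared]; noncomm_ring
  algebra_map_mem _ _ := StarSubalgebra.mem_top
  inv_mem _ _ := StarSubalgebra.mem_top
  coe_mem _ _ := StarSubalgebra.mem_top
  isClosed := by
    have : (properRotations (n ⊕ n) : Set (unitaryGroup (n ⊕ n) ℝ)) = {g | g.1.det = 1} := rfl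
    rw [this]
    exact isClosed_eq (Continuous.matrix_det continuous_subtype_val) continuous_const
  nhds_one := by
    -- The algebra is the full matrix algebra, whose unitary group is O(2N); positivity of the
    -- determinant is the open condition that singles out SO(2N).
    refine ⟨{X | 0 < X.det}, isOpen_lt continuous_const (Continuous.matrix_det continuous_id),
      by simp, fun g hg _ => ?_⟩
    have h1 : 0 < g.1.det := hg
    have h2 := congrArg det (mem_unitaryGroup_iff.1 g.2)
    rw [det_mul, star_eq_conjTranspose, det_conjTranspose, star_trivial g.1.det, det_one] at h2
    rw [mem_properRotations]
    rcases mul_self_eq_one_iff.1 h2 with h3 | h3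
    · exact h3
    · rw [h3] at h1; norm_num at h1
  map_mem g hg := by
    rw [mem_properRotations] at hg ⊢
    change ((unitaryJ n ℝ)⁻¹.1 * g.1 * star (unitaryJ n ℝ)⁻¹.1).det = 1
    rw [det_mul_comm, ← mul_assoc, mem_unitaryGroup_iff'.1 (unitaryJ n ℝ)⁻¹.2, one_mul, hg]

/-- Being fixed by Ω means commuting with J, that is, being complex linear. The determinant is then
|det|² = 1 for the underlying unitary matrix. -/
theorem mem_range_realifyHom (g : unitaryGroup (n ⊕ n) ℝ) :
    g ∈ (realifyHom n).range ↔
      g ∈ properRotations (n ⊕ n) ∧ conjByHom (unitaryJ n ℝ)⁻¹ g = g := by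
  have hcomm : conjByHom (unitaryJ n ℝ)⁻¹ g = g ↔ g.1 * J n ℝ = J n ℝ * g.1 := by
    rw [Subtype.ext_iff, coe_conjByHom_J_inv]
    constructor
    · intro h
      calc g.1 * J n ℝ = -(J n ℝ * J n ℝ) * g.1 * J n ℝ := by rw [J_squared, neg_neg, one_mul]
        _ = J n ℝ * (-J n ℝ * g.1 * J n ℝ) := by noncomm_ring
        _ = _ := by rw [h]
    · intro h
      rw [mul_assoc, h, ← mul_assoc, neg_mul, J_squared, neg_neg, one_mul]
  rw [hcomm]
  constructor
  · rintro ⟨h, rfl⟩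
    have h1 : (realifyHom n h).1 = fromBlocks (h.1.map Complex.re) (-(h.1.map Complex.im))
      (h.1.map Complex.im) (h.1.map Complex.re) := rfl
    refine ⟨?_, ?_⟩
    · rw [mem_properRotations, h1, det_realification]
      have h2 : (h.1.map Complex.re).map Complex.ofRealHom +
          Complex.I • (h.1.map Complex.im).map Complex.ofRealHom = h.1 := by
        ext i j
        simp only [Matrix.add_apply, Matrix.smul_apply, map_apply, smul_eq_mul, Complex.ofRealHom_eq_coe]
        rw [mul_comm]
        exact Complex.re_add_im _
      have h3 := congrArg det (mem_unitaryGroup_iff.1 h.2)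
      rw [det_mul, star_eq_conjTranspose, det_conjTranspose, det_one, RCLike.star_def,
        Complex.mul_conj] at h3
      rw [h2]
      exact_mod_cast h3
    · rw [h1]
      exact fromBlocks_commute_J.2 ⟨rfl, rfl⟩
  · rintro ⟨-, h⟩
    obtain ⟨a, b, c, d, hg⟩ : ∃ a b c d, g.1 = fromBlocks a b c d :=
      ⟨_, _, _, _, (fromBlocks_toBlocks g.1).symm⟩
    rw [hg] at h
    obtain ⟨rfl, rfl⟩ := fromBlocks_commute_J.1 h
    have h1 := mem_unitaryGroup_iff.1 g.2
    rw [hg, star_eq_conjTranspose, fromBlocks_conjTranspose, fromBlocks_multiply, ← fromBlocks_one,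
      fromBlocks_inj] at h1
    obtain ⟨h2, -, h3, -⟩ := h1
    obtain ⟨z, hz⟩ : ∃ z : Matrix n n ℂ, z = of fun i j => (⟨d i j, c i j⟩ : ℂ) := ⟨_, rfl⟩
    have hzu : z ∈ unitaryGroup n ℂ := by
      rw [mem_unitaryGroup_iff]
      ext i j
      have h4 := congrFun (congrFun h2 i) j
      have h5 := congrFun (congrFun h3 i) j
      simp only [mul_apply, Matrix.add_apply, conjTranspose_apply, Matrix.neg_apply,
        star_trivial, ← Finset.sum_add_distrib] at h4 h5
      rw [mul_apply, hz]
      apply Complex.ext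
      · rw [Complex.re_sum]
        have h6 : ((1 : Matrix n n ℂ) i j).re = (1 : Matrix n n ℝ) i j := by
          by_cases hij : i = j <;> simp [one_apply, hij]
        rw [h6, ← h4]
        refine Finset.sum_congr rfl fun k _ => ?_
        simp
      · rw [Complex.im_sum]
        have h6 : ((1 : Matrix n n ℂ) i j).im = (0 : Matrix n n ℝ) i j := by
          by_cases hij : i = j <;> simp [one_apply, hij]
        rw [h6, ← h5]
        refine Finset.sum_congr rfl fun k _ => ?_
        simp
        ring
    refine ⟨⟨z, hzu⟩, Subtype.ext ?_⟩
    rw [hg]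
    change fromBlocks (z.map Complex.re) (-(z.map Complex.im)) (z.map Complex.im)
      (z.map Complex.re) = _
    have h7 : z.map Complex.re = d := by rw [hz]; rfl
    have h8 : z.map Complex.im = c := by rw [hz]; rfl
    rw [h7, h8]

theorem J_mulVec_dotProduct_self (v : n ⊕ n → ℝ) : v ⬝ᵥ (J n ℝ *ᵥ v) = 0 := by
  have h1 : v ⬝ᵥ (J n ℝ *ᵥ v) = -(v ⬝ᵥ (J n ℝ *ᵥ v)) := by
    conv_lhs => rw [dotProduct_mulVec, ← mulVec_transpose, J_transpose, neg_mulVec,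
      neg_dotProduct, dotProduct_comm]
  exact self_eq_neg.1 h1

theorem J_mulVec_dotProduct (v w : n ⊕ n → ℝ) : (J n ℝ *ᵥ v) ⬝ᵥ w = -(v ⬝ᵥ (J n ℝ *ᵥ w)) := by
  rw [dotProduct_mulVec v, ← mulVec_transpose, J_transpose, neg_mulVec, neg_dotProduct, neg_neg]

theorem J_mulVec_J_mulVec (v : n ⊕ n → ℝ) : J n ℝ *ᵥ (J n ℝ *ᵥ v) = -v := by
  rw [mulVec_mulVec, J_squared, neg_mulVec, one_mulVec]

/-- The eigenvalue `-1` of an element of the ensemble cannot have multiplicity two. -/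
theorem exists_orthogonal_eigenvector_DIII {H : Matrix (n ⊕ n) (n ⊕ n) ℝ} (hH : H ∈ ensembleDIII n)
    {v : n ⊕ n → ℝ} (hv1 : v ⬝ᵥ v = 1) (hHv : H *ᵥ v = -v)
    (hHJv : H *ᵥ (J n ℝ *ᵥ v) = -(J n ℝ *ᵥ v)) :
    ∃ w, w ≠ 0 ∧ H *ᵥ w = -w ∧ v ⬝ᵥ w = 0 ∧ (J n ℝ *ᵥ v) ⬝ᵥ w = 0 := by
  by_contra! hno
  obtain ⟨hSO, hskew, p, hp, hpJ⟩ := hH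
  obtain ⟨hO, hdet⟩ := mem_specialOrthogonalGroup_iff.1 hSO
  have hHT : H * Hᵀ = 1 := mem_unitaryGroup_iff.1 hO
  have hTH : Hᵀ * H = 1 := mem_unitaryGroup_iff'.1 hO
  have hHJ : H * J n ℝ = J n ℝ * Hᵀ := by
    rw [transpose_mul, J_transpose, neg_mul, neg_inj] at hskew
    exact hskew.symm
  obtain ⟨u, hu⟩ : ∃ u, u = J n ℝ *ᵥ v := ⟨_, rfl⟩
  rw [← hu] at hHJv hno
  have hJu : J n ℝ *ᵥ u = -v := by rw [hu, J_mulVec_J_mulVec]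
  have hvu : v ⬝ᵥ u = 0 := by rw [hu, J_mulVec_dotProduct_self]
  have huu : u ⬝ᵥ u = 1 := by
    conv_lhs => rw [hu, J_mulVec_dotProduct, ← hu, hJu, dotProduct_neg, neg_neg]
    exact hv1
  -- By assumption the -1 eigenspace of H contains nothing orthogonal to v and u = Jv. Adding the
  -- projections onto v and u therefore makes the quadratic form of H + 1 positive.
  obtain ⟨M, hM⟩ : ∃ M, M = H + 1 + vecMulVec v v + vecMulVec u u := ⟨_, rfl⟩
  have hMpos : 0 < M.det := by
    apply det_pos_of_forall_dotProduct_pos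
    intro x hx
    have h1 : x ⬝ᵥ M *ᵥ x = x ⬝ᵥ ((H + 1) *ᵥ x) + (v ⬝ᵥ x) * (v ⬝ᵥ x) + (u ⬝ᵥ x) * (u ⬝ᵥ x) := by
      rw [hM, add_mulVec, add_mulVec, vecMulVec_mulVec, vecMulVec_mulVec, dotProduct_add,
        dotProduct_add]
      simp only [dotProduct_smul, op_smul_eq_smul, smul_eq_mul]
      rw [dotProduct_comm x v, dotProduct_comm x u]
    -- Orthogonality of H shows that its quadratic form plus the identity is nonnegative, with zeros
    -- only on the kernel of H + 1.
    have h2 : ((H + 1) *ᵥ x) ⬝ᵥ ((H + 1) *ᵥ x) = 2 * (x ⬝ᵥ ((H + 1) *ᵥ x)) := by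
      have h3 : (H *ᵥ x) ⬝ᵥ (H *ᵥ x) = x ⬝ᵥ x := by
        rw [dotProduct_mulVec, vecMul_mulVec, hTH, vecMul_one]
      rw [add_mulVec, one_mulVec, dotProduct_add, add_dotProduct, add_dotProduct, h3,
        dotProduct_add, dotProduct_comm (H *ᵥ x) x]
      ring
    have h3 : 0 ≤ ((H + 1) *ᵥ x) ⬝ᵥ ((H + 1) *ᵥ x) :=
      Finset.sum_nonneg fun i _ => mul_self_nonneg _
    have h4 := mul_self_nonneg (v ⬝ᵥ x)
    have h5 := mul_self_nonneg (u ⬝ᵥ x)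
    rw [h1]
    refine lt_of_le_of_ne (by linarith) fun h6 => ?_
    have h7 : ((H + 1) *ᵥ x) ⬝ᵥ ((H + 1) *ᵥ x) = 0 := by linarith
    have h8 : (v ⬝ᵥ x) * (v ⬝ᵥ x) = 0 := by linarith
    have h9 : (u ⬝ᵥ x) * (u ⬝ᵥ x) = 0 := by linarith
    have h10 := dotProduct_self_eq_zero.1 h7
    rw [add_mulVec, one_mulVec] at h10
    exact hno x hx (eq_neg_of_add_eq_zero_left h10) (mul_self_eq_zero.1 h8)
      (mul_self_eq_zero.1 h9)
  -- Changing the sign at u composes M with the reflection in u, since M u = u, and makes the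
  -- determinant negative. The sign is needed for intertwining: on span(v, u) the complex structure
  -- H J is -J, and T acts there as a reflection.
  obtain ⟨T, hT⟩ : ∃ T, T = H + 1 + vecMulVec v v - vecMulVec u u := ⟨_, rfl⟩
  have hTdet : T.det < 0 := by
    have h1 : M *ᵥ u = u := by
      rw [hM, add_mulVec, add_mulVec, add_mulVec, one_mulVec, vecMulVec_mulVec, vecMulVec_mulVec,
        hHJv, hvu, huu]
      simp
    have h2 : T = M * (1 - (2 : ℝ) • vecMulVec u u) := by
      rw [mul_sub, mul_one, mul_smul_comm, mul_vecMulVec, h1, hM, hT, two_smul]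
      abel
    rw [h2, det_mul, det_one_sub_two_smul_vecMulVec huu]
    linarith
  have hvJ : v ᵥ* J n ℝ = -u := by
    rw [← mulVec_transpose, J_transpose, neg_mulVec, hu]
  have huJ : u ᵥ* J n ℝ = v := by
    rw [← mulVec_transpose, J_transpose, neg_mulVec, hJu, neg_neg]
  have hTJ : H * J n ℝ * T = T * J n ℝ := by
    have h1 : H * J n ℝ * H = J n ℝ := by rw [hHJ, mul_assoc, hTH, mul_one]
    rw [hT, mul_sub, mul_add, mul_add, h1, mul_one, sub_mul, add_mul, add_mul, one_mul,
      mul_vecMulVec, mul_vecMulVec, vecMulVec_mul, vecMulVec_mul, ← mulVec_mulVec, ← mulVec_mulVec,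
      ← hu, hJu, hHJv, mulVec_neg, hHv, neg_neg, hvJ, huJ, neg_vecMulVec, vecMulVec_neg]
    abel
  have hpp : (p⁻¹).1 * p.1 = 1 := mem_unitaryGroup_iff'.1 p.2
  -- T carries J to H J and the proper rotation p carries H J back to J, so p T commutes with J. Its
  -- determinant cannot be negative, a contradiction.
  have hcomm : (p.1 * T) * J n ℝ = J n ℝ * (p.1 * T) := by
    calc (p.1 * T) * J n ℝ = p.1 * (H * J n ℝ) * ((p⁻¹).1 * p.1) * T := by
          rw [hpp, mul_one, mul_assoc, mul_assoc, hTJ]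
      _ = (p.1 * (H * J n ℝ) * (p⁻¹).1) * (p.1 * T) := by simp only [mul_assoc]
      _ = _ := by rw [hpJ]
  have h0 := det_nonneg_of_commute_J hcomm
  rw [det_mul, mem_properRotations.1 hp, one_mul] at h0
  linarith

theorem symmetricEnsemble_DIII : SymmetricEnsemble (properRotations (n ⊕ n))
    (conjByHom (unitaryJ n ℝ)⁻¹) (ensembleDIII n) := by
  have hadj : ∀ {H : Matrix (n ⊕ n) (n ⊕ n) ℝ}, H ∈ ensembleDIII n →
      J n ℝ * Hᵀ = H * J n ℝ := by
    rintro H ⟨-, hskew, -⟩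
    rw [transpose_mul, J_transpose, neg_mul, neg_inj] at hskew
    exact hskew
  have h1 : ∀ H ∈ ensembleDIII n, ∃ h ∈ properRotations (n ⊕ n), h.1 = H ∧
      conjByHom (unitaryJ n ℝ)⁻¹ h = h⁻¹ := by
    intro H hH
    obtain ⟨hO, hdet⟩ := mem_specialOrthogonalGroup_iff.1 hH.1
    refine ⟨⟨H, hO⟩, hdet, rfl, Subtype.ext ?_⟩
    rw [coe_conjByHom_J_inv]
    change -J n ℝ * H * J n ℝ = star H
    rw [mul_assoc, ← hadj hH, ← mul_assoc, neg_mul, J_squared, neg_neg, one_mul]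
    ext i j
    simp
  have h2 : ∀ g ∈ properRotations (n ⊕ n), ∀ H ∈ ensembleDIII n,
      g.1 * H * ((conjByHom (unitaryJ n ℝ)⁻¹ g)⁻¹).1 ∈ ensembleDIII n := by
    intro g hg H hH
    obtain ⟨hO, hdet⟩ := mem_specialOrthogonalGroup_iff.1 hH.1
    have hgO := mem_properRotations.1 hg
    have hinv := mem_properRotations.1
      (inv_mem (linearInvolution_DIII.map_mem g hg))
    have hgg : star g.1 * g.1 = 1 := mem_unitaryGroup_iff'.1 g.2
    have hgt : star g.1 = g.1ᵀ := by ext i j; simp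
    have hJ : ((conjByHom (unitaryJ n ℝ)⁻¹ g)⁻¹).1 * J n ℝ = J n ℝ * star g.1 := by
      change star (conjByHom (unitaryJ n ℝ)⁻¹ g).1 * J n ℝ = _
      rw [coe_conjByHom_J_inv, star_mul, star_mul, star_neg, star_J, neg_neg]
      calc -J n ℝ * (star g.1 * J n ℝ) * J n ℝ = -(J n ℝ * star g.1 * (J n ℝ * J n ℝ)) := by
            noncomm_ring
        _ = _ := by rw [J_squared]; noncomm_ring
    have hF : g.1 * H * ((conjByHom (unitaryJ n ℝ)⁻¹ g)⁻¹).1 * J n ℝ =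
        g.1 * (H * J n ℝ) * star g.1 := by
      rw [mul_assoc, hJ]
      simp only [mul_assoc]
    refine ⟨mem_specialOrthogonalGroup_iff.2
      ⟨mul_mem (mul_mem g.2 hO) (Subtype.property _), ?_⟩, ?_, ?_⟩
    · rw [det_mul, det_mul, hgO, hdet, hinv, one_mul, one_mul]
    · rw [hF, hgt, transpose_mul, transpose_mul, transpose_transpose, hH.2.1]
      noncomm_ring
    · obtain ⟨p, hp, hpJ⟩ := hH.2.2
      refine ⟨p * g⁻¹, mul_mem hp (inv_mem hg), ?_⟩
      rw [hF, _root_.mul_inv_rev, inv_inv]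
      change p.1 * star g.1 * (g.1 * (H * J n ℝ) * star g.1) * (g.1 * (p⁻¹).1) = _
      calc _ = p.1 * (star g.1 * g.1) * (H * J n ℝ) * (star g.1 * g.1) * (p⁻¹).1 := by
            simp only [mul_assoc]
        _ = _ := by rw [hgg, mul_one, mul_one, hpJ]
  refine ⟨⟨one_mem _, ?_, 1, one_mem _, ?_⟩, h1, h2, ?_⟩
  · rw [one_mul, J_transpose]
  · simp
  · intro H hH hu
    obtain ⟨hO, hdet⟩ := mem_specialOrthogonalGroup_iff.1 hH.1
    have hTH : Hᵀ * H = 1 := mem_unitaryGroup_iff'.1 hO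
    -- The -1 eigenspace is stable under J because H J = J Hᵀ and Hᵀ has the same -1 eigenvectors as
    -- H.
    have hjv : ∀ v : n ⊕ n → ℝ, H *ᵥ v = -v → H *ᵥ (J n ℝ *ᵥ v) = -(J n ℝ *ᵥ v) := by
      intro v hv
      have h3 : Hᵀ *ᵥ v = -v := by
        have := congrArg (Hᵀ *ᵥ ·) hv
        simp only [mulVec_mulVec, hTH, one_mulVec, mulVec_neg] at this
        exact (neg_eq_iff_eq_neg.2 this).symm
      rw [mulVec_mulVec, ← hadj hH, ← mulVec_mulVec, h3, mulVec_neg]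
    obtain ⟨v, hv1, hHv⟩ : ∃ v, v ⬝ᵥ v = 1 ∧ H *ᵥ v = -v := by
      have h3 : (H + 1).det = 0 := by
        by_contra h4
        exact hu ((isUnit_iff_isUnit_det _).2 (isUnit_iff_ne_zero.2 h4))
      obtain ⟨x, hx, hx0⟩ := exists_mulVec_eq_zero_iff.2 h3
      rw [add_mulVec, one_mulVec] at hx0
      obtain ⟨c, hc⟩ := exists_unit_smul hx
      exact ⟨c • x, hc, by rw [mulVec_smul, eq_neg_of_add_eq_zero_left hx0, smul_neg]⟩
    obtain ⟨w, hw1, hHw, hvw, hjvw⟩ : ∃ w, w ⬝ᵥ w = 1 ∧ H *ᵥ w = -w ∧ v ⬝ᵥ w = 0 ∧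
        (J n ℝ *ᵥ v) ⬝ᵥ w = 0 := by
      obtain ⟨w, hw0, h3, h4, h5⟩ := exists_orthogonal_eigenvector_DIII hH hv1 hHv (hjv v hHv)
      obtain ⟨c, hc⟩ := exists_unit_smul hw0
      exact ⟨c • w, hc, by rw [mulVec_smul, h3, smul_neg], by rw [dotProduct_smul, h4, smul_zero],
        by rw [dotProduct_smul, h5, smul_zero]⟩
    obtain ⟨j, hj⟩ : ∃ j, j = fun x : n ⊕ n → ℝ => J n ℝ *ᵥ x := ⟨_, rfl⟩
    have hj' : ∀ x, J n ℝ *ᵥ x = j x := fun x => by rw [hj]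
    have hjj : ∀ x, J n ℝ *ᵥ j x = -x := fun x => by rw [← hj', J_mulVec_J_mulVec]
    have hanti : ∀ x y, j x ⬝ᵥ y = -(x ⬝ᵥ j y) := fun x y => by
      rw [← hj', ← hj', J_mulVec_dotProduct]
    have hself : ∀ x, x ⬝ᵥ j x = 0 := fun x => by rw [← hj', J_mulVec_dotProduct_self]
    have hiso : ∀ x y, j x ⬝ᵥ j y = x ⬝ᵥ y := fun x y => by
      rw [hanti, ← hj' (j y), hjj, dotProduct_neg, neg_neg]
    rw [hj'] at hjvw
    have hHjv : H *ᵥ j v = -j v := by rw [← hj', hjv v hHv]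
    have hHjw : H *ᵥ j w = -j w := by rw [← hj', hjv w hHw]
    have hwv : w ⬝ᵥ v = 0 := by rw [dotProduct_comm, hvw]
    have hwjv : w ⬝ᵥ j v = 0 := by rw [dotProduct_comm, hjvw]
    have hjwv : j w ⬝ᵥ v = 0 := by rw [hanti, hwjv, neg_zero]
    have hvjw : v ⬝ᵥ j w = 0 := by rw [dotProduct_comm, hjwv]
    have hjvv : j v ⬝ᵥ v = 0 := by rw [dotProduct_comm, hself]
    have hjww : j w ⬝ᵥ w = 0 := by rw [dotProduct_comm, hself]
    have hc1 := skewPair_cube (v := v) (w := w) hv1 hw1 hvw hwv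
    have hc2 := skewPair_cube (v := j v) (w := j w) ((hiso v v).trans hv1) ((hiso w w).trans hw1)
      ((hiso v w).trans hvw) ((hiso w v).trans hwv)
    -- Conjugation by J⁻¹ exchanges the rotations in the planes (v, w) and (jv, jw); their
    -- difference is odd.
    refine linearInvolution_DIII.mem_closure_of_generator h1 h2 hH
      (X := skewPair v w + -skewPair (j v) (j w)) ⟨StarSubalgebra.mem_top, ?_, ?_⟩ ?_ ?_ ?_
    · rw [star_add, star_neg, star_skewPair, star_skewPair, neg_add]
    · have h3 : (unitaryJ n ℝ)⁻¹.1 = -J n ℝ := star_J n ℝ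
      change (unitaryJ n ℝ)⁻¹.1 * _ * star (unitaryJ n ℝ)⁻¹.1 = _
      rw [mul_add, mul_neg, add_mul, neg_mul, mul_skewPair_mul_star, mul_skewPair_mul_star, h3,
        neg_mulVec, neg_mulVec, neg_mulVec, neg_mulVec, hj', hj', hjj, hjj, neg_neg, neg_neg,
        skewPair_neg_left, skewPair_neg_right, neg_neg]
      abel
    · intro h0
      have h3 := congrArg (· *ᵥ v) h0
      simp only [add_mulVec, zero_mulVec, neg_mulVec] at h3
      rw [skewPair_mulVec_left hv1 hwv, skewPair_mulVec_of_orthogonal (v := j v) hjvv hjwv,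
        neg_zero, add_zero] at h3
      rw [h3] at hw1
      simp at hw1
    · refine add_cube_of_mul_eq_zero hc1 ?_ ?_ ?_
      · rw [neg_mul_neg, neg_mul, hc2]
      · rw [mul_neg, skewPair_mul_eq_zero (v := v) (w := w) (hself v) hwjv hvjw (hself w), neg_zero]
      · rw [neg_mul, skewPair_mul_eq_zero (v := j v) (w := j w) hjvv hjwv hjvw hjww, neg_zero]
    · rw [mul_add, mul_neg, mul_skewPair hHv hHw, mul_skewPair hHjv hHjw, neg_add, neg_neg]

end DIII
end

noncomputable section

/-! ### The torus of the space of complex structures -/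

section TorusDIII

variable {R : ℕ}

/-- The generator is invertible because all parameters are nonzero. This removes the blocks joining
the padding to the rotations. -/
theorem rotationTorus_imagPoint_mul_eq_zero {ι : Type} {X : Matrix ι (Fin R ⊕ Fin R) ℝ}
    (h : X * rotationTorus ℝ R (imagPoint regularParam) = 0) : X = 0 := by
  obtain ⟨a, b, rfl⟩ : ∃ a b, X = fromCols a b := ⟨_, _, (fromCols_toCols X).symm⟩
  rw [rotationTorus_imagPoint, fromCols_mul_fromBlocks] at h
  have ha : ∀ i j, a i j = 0 := fun i j => by
    have h1 := congrFun (congrFun h i) (Sum.inr j)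
    simp only [fromCols_apply_inr, Matrix.mul_zero, add_zero, Matrix.mul_neg, Matrix.neg_apply,
      mul_diagonal, Matrix.zero_apply, neg_eq_zero] at h1
    exact (mul_eq_zero.1 h1).resolve_right (regularParam_ne_zero j)
  have hb : ∀ i j, b i j = 0 := fun i j => by
    have h1 := congrFun (congrFun h i) (Sum.inl j)
    simp only [fromCols_apply_inl, Matrix.mul_zero, zero_add, mul_diagonal,
      Matrix.zero_apply] at h1
    exact (mul_eq_zero.1 h1).resolve_right (regularParam_ne_zero j)
  ext i (j | j)
  · exact ha i j
  · exact hb i j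

theorem star_rotationTorus_imagPoint (s : Fin R → ℝ) :
    star (rotationTorus ℝ R (imagPoint s)) = -rotationTorus ℝ R (imagPoint s) := by
  rw [← StarHomClass.map_star, star_imagPoint, map_neg]

theorem mul_rotationTorus_imagPoint_eq_zero {ι : Type} [Fintype ι]
    {X : Matrix (Fin R ⊕ Fin R) ι ℝ}
    (h : rotationTorus ℝ R (imagPoint regularParam) * X = 0) : X = 0 := by
  have h1 := congrArg conjTranspose h
  rw [conjTranspose_mul, conjTranspose_zero, ← star_eq_conjTranspose (M := rotationTorus ℝ R _),
    star_rotationTorus_imagPoint, Matrix.mul_neg, neg_eq_zero] at h1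
  rw [← conjTranspose_conjTranspose X, rotationTorus_imagPoint_mul_eq_zero h1,
    conjTranspose_zero]

theorem diag_eq_zero_of_transpose_eq_neg {ι : Type} {X : Matrix ι ι ℝ} (h : Xᵀ = -X) (i : ι) :
    X i i = 0 :=
  self_eq_neg.1 (congrFun (congrFun h i) i)

theorem eq_rotationTorus_of_commute {Z : Matrix (Fin R ⊕ Fin R) (Fin R ⊕ Fin R) ℝ}
    (hZ : Zᵀ = -Z) (hc : Commute Z (rotationTorus ℝ R (imagPoint regularParam))) :
    ∃ s : Fin R → ℝ, Z = rotationTorus ℝ R (imagPoint s) := by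
  obtain ⟨a, b, c, d, rfl⟩ : ∃ a b c d, Z = fromBlocks a b c d :=
    ⟨_, _, _, _, (fromBlocks_toBlocks Z).symm⟩
  have hc' : _ * _ = _ * _ := hc
  rw [rotationTorus_imagPoint, fromBlocks_multiply, fromBlocks_multiply, fromBlocks_inj] at hc'
  simp only [Matrix.mul_zero, Matrix.zero_mul, add_zero, zero_add, mul_neg, neg_mul,
    neg_inj] at hc'
  obtain ⟨h1, h2, h3, h4⟩ := hc'
  rw [fromBlocks_transpose, fromBlocks_neg, fromBlocks_inj] at hZ
  have e1 : ∀ i j, b i j * (regularParam j : ℝ) = (regularParam i : ℝ) * -c i j := fun i j => by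
    have := congrFun (congrFun h1 i) j
    rwa [mul_diagonal, Matrix.neg_apply, diagonal_mul, ← mul_neg] at this
  have e2 : ∀ i j, a i j * (regularParam j : ℝ) = (regularParam i : ℝ) * d i j := fun i j => by
    have := congrFun (congrFun h2 i) j
    rwa [mul_diagonal, diagonal_mul] at this
  have e3 : ∀ i j, d i j * (regularParam j : ℝ) = (regularParam i : ℝ) * a i j := fun i j => by
    have := congrFun (congrFun h3 i) j
    rwa [mul_diagonal, diagonal_mul] at this
  have e4 : ∀ i j, -c i j * (regularParam j : ℝ) = (regularParam i : ℝ) * b i j := fun i j => by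
    have := congrFun (congrFun h4 i) j
    rwa [Matrix.neg_apply, mul_diagonal, diagonal_mul, ← neg_mul] at this
  refine ⟨fun j => -b j j, ?_⟩
  rw [rotationTorus_imagPoint]
  congr 1 <;> ext i j <;> rcases eq_or_ne i j with rfl | hij
  · exact diag_eq_zero_of_transpose_eq_neg hZ.1 i
  · exact eq_zero_of_regular (𝕜 := ℝ) (x := a) e2 e3 hij
  · simp
  · simpa [hij] using eq_zero_of_regular (𝕜 := ℝ) (x := b) e1 e4 hij
  · have := e1 i i
    rw [mul_comm] at this
    have h5 := mul_left_cancel₀ (regularParam_ne_zero (𝕜 := ℝ) i) this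
    rw [diagonal_apply_eq, h5]
    simp
  · have := eq_zero_of_regular (𝕜 := ℝ) (x := fun i j => -c i j) e4 e1 hij
    rw [diagonal_apply_ne _ hij]
    exact neg_eq_zero.1 this
  · exact diag_eq_zero_of_transpose_eq_neg hZ.2.2.2 i
  · exact eq_zero_of_regular (𝕜 := ℝ) (x := d) e3 e2 hij

/-- Off the diagonal the squared parameters differ. On it, anticommutation gives b i i = c i i while
antisymmetry gives c i i = -b i i. -/
theorem eq_zero_of_anticommute_rotationTorus {Z : Matrix (Fin R ⊕ Fin R) (Fin R ⊕ Fin R) ℝ}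
    (hZ : Zᵀ = -Z) (hc : Z * rotationTorus ℝ R (imagPoint regularParam) =
      -(rotationTorus ℝ R (imagPoint regularParam) * Z)) : Z = 0 := by
  obtain ⟨a, b, c, d, rfl⟩ : ∃ a b c d, Z = fromBlocks a b c d :=
    ⟨_, _, _, _, (fromBlocks_toBlocks Z).symm⟩
  rw [rotationTorus_imagPoint, fromBlocks_multiply, fromBlocks_multiply, fromBlocks_neg,
    fromBlocks_inj] at hc
  simp only [Matrix.mul_zero, Matrix.zero_mul, add_zero, zero_add, mul_neg, neg_mul,
    neg_inj, neg_neg] at hc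
  obtain ⟨h1, h2, h3, h4⟩ := hc
  rw [fromBlocks_transpose, fromBlocks_neg, fromBlocks_inj] at hZ
  have e1 : ∀ i j, b i j * (regularParam j : ℝ) = (regularParam i : ℝ) * c i j := fun i j => by
    have := congrFun (congrFun h1 i) j
    rwa [mul_diagonal, diagonal_mul] at this
  have e2 : ∀ i j, a i j * (regularParam j : ℝ) = (regularParam i : ℝ) * -d i j := fun i j => by
    have := congrFun (congrFun h2 i) j
    rw [Matrix.neg_apply, mul_diagonal, diagonal_mul] at this
    linear_combination -this
  have e3 : ∀ i j, -d i j * (regularParam j : ℝ) = (regularParam i : ℝ) * a i j := fun i j => by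
    have := congrFun (congrFun h3 i) j
    rw [Matrix.neg_apply, mul_diagonal, diagonal_mul] at this
    linear_combination -this
  have e4 : ∀ i j, c i j * (regularParam j : ℝ) = (regularParam i : ℝ) * b i j := fun i j => by
    have := congrFun (congrFun h4 i) j
    rwa [mul_diagonal, diagonal_mul] at this
  have hdiag : ∀ i, b i i = c i i := fun i => by
    have := e1 i i
    rw [mul_comm] at this
    exact mul_left_cancel₀ (regularParam_ne_zero (𝕜 := ℝ) i) this
  have hb : ∀ i, b i i = 0 := fun i => by
    have h5 := congrFun (congrFun hZ.2.1 i) i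
    rw [transpose_apply, Matrix.neg_apply, ← hdiag] at h5
    exact self_eq_neg.1 h5
  rw [← fromBlocks_zero]
  congr 1 <;> ext i j <;> rcases eq_or_ne i j with rfl | hij
  · exact diag_eq_zero_of_transpose_eq_neg hZ.1 i
  · exact eq_zero_of_regular (𝕜 := ℝ) (x := a) e2 e3 hij
  · exact hb i
  · exact eq_zero_of_regular (𝕜 := ℝ) (x := b) e1 e4 hij
  · rw [← hdiag]
    exact hb i
  · exact eq_zero_of_regular (𝕜 := ℝ) (x := c) e4 e1 hij
  · exact diag_eq_zero_of_transpose_eq_neg hZ.2.2.2 i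
  · exact neg_eq_zero.1 (eq_zero_of_regular (𝕜 := ℝ) (x := fun i j => -d i j) e3 e2 hij)

theorem paddedTorus_imagPoint {e : ℕ} (s : Fin R → ℝ) : paddedTorus ℝ e R (imagPoint s) =
    fromBlocks 0 0 0 (rotationTorus ℝ R (imagPoint s)) := by
  rw [paddedTorus_apply]
  congr 1
  ext i j
  simp [imagPoint, diagonal_apply]

/-- This is where the padding is limited to one coordinate: a larger block would contain nonzero
antisymmetric matrices commuting with the torus. -/
theorem eq_zero_of_transpose_eq_neg_of_le_one {e : ℕ} (he : e ≤ 1) {X : Matrix (Fin e) (Fin e) ℝ}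
    (h : Xᵀ = -X) : X = 0 := by
  have : Subsingleton (Fin e) := Fin.subsingleton_iff_le_one.2 he
  ext i j
  rw [Subsingleton.elim j i]
  exact diag_eq_zero_of_transpose_eq_neg h i

theorem eq_paddedTorus_of_commute {e : ℕ} (he : e ≤ 1)
    {Z : Matrix (Fin e ⊕ (Fin R ⊕ Fin R)) (Fin e ⊕ (Fin R ⊕ Fin R)) ℝ} (hZ : Zᵀ = -Z)
    (hc : Commute Z (paddedTorus ℝ e R (imagPoint regularParam))) :
    ∃ s : Fin R → ℝ, Z = paddedTorus ℝ e R (imagPoint s) := by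
  obtain ⟨a, b, c, d, rfl⟩ : ∃ a b c d, Z = fromBlocks a b c d :=
    ⟨_, _, _, _, (fromBlocks_toBlocks Z).symm⟩
  have hc' : _ * _ = _ * _ := hc
  rw [paddedTorus_imagPoint, fromBlocks_multiply, fromBlocks_multiply, fromBlocks_inj] at hc'
  simp only [Matrix.mul_zero, Matrix.zero_mul, add_zero, zero_add] at hc'
  rw [fromBlocks_transpose, fromBlocks_neg, fromBlocks_inj] at hZ
  obtain rfl := eq_zero_of_transpose_eq_neg_of_le_one he hZ.1
  obtain rfl := rotationTorus_imagPoint_mul_eq_zero hc'.2.1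
  obtain rfl := mul_rotationTorus_imagPoint_eq_zero hc'.2.2.1.symm
  obtain ⟨s, rfl⟩ := eq_rotationTorus_of_commute hZ.2.2.2 hc'.2.2.2
  exact ⟨s, (paddedTorus_imagPoint s).symm⟩

theorem eq_zero_of_anticommute_paddedTorus {e : ℕ} (he : e ≤ 1)
    {Z : Matrix (Fin e ⊕ (Fin R ⊕ Fin R)) (Fin e ⊕ (Fin R ⊕ Fin R)) ℝ} (hZ : Zᵀ = -Z)
    (hc : Z * paddedTorus ℝ e R (imagPoint regularParam) =
      -(paddedTorus ℝ e R (imagPoint regularParam) * Z)) : Z = 0 := by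
  obtain ⟨a, b, c, d, rfl⟩ : ∃ a b c d, Z = fromBlocks a b c d :=
    ⟨_, _, _, _, (fromBlocks_toBlocks Z).symm⟩
  rw [paddedTorus_imagPoint, fromBlocks_multiply, fromBlocks_multiply, fromBlocks_neg,
    fromBlocks_inj] at hc
  simp only [Matrix.mul_zero, Matrix.zero_mul, add_zero, zero_add, neg_zero] at hc
  rw [fromBlocks_transpose, fromBlocks_neg, fromBlocks_inj] at hZ
  obtain rfl := eq_zero_of_transpose_eq_neg_of_le_one he hZ.1
  obtain rfl := rotationTorus_imagPoint_mul_eq_zero hc.2.1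
  obtain rfl := mul_rotationTorus_imagPoint_eq_zero (neg_eq_zero.1 hc.2.2.1.symm)
  obtain rfl := eq_zero_of_anticommute_rotationTorus hZ.2.2.2 hc.2.2.2
  exact fromBlocks_zero

theorem regularTorus_DIII {e : ℕ} (he : e ≤ 1) (R : ℕ) :
    RegularTorus ⊤ (unitaryConjStarHom (unitaryJ (Fin e ⊕ (Fin R ⊕ Fin R)) ℝ)⁻¹)
      (doubleTorus (paddedTorus ℝ e R)) where
  mem _ := StarSubalgebra.mem_top
  map_star x := by
    rw [doubleTorus_apply, doubleTorus_apply, unitaryConj_J_inv_fromBlocks, neg_zero, star_star]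
  eq_zero z h := by
    rw [doubleTorus_apply] at h
    have h1 : paddedTorus ℝ e R (0, z) = 0 := congrArg toBlocks₁₁ h
    rw [paddedTorus_apply] at h1
    exact rotationTorus_eq_zero (congrArg toBlocks₂₂ h1)
  regular := by
    refine ⟨regularParam, fun Z ⟨_, hZ, hθ⟩ hc => ?_⟩
    obtain ⟨P, Q, c, d, rfl⟩ : ∃ a b c d, Z = fromBlocks a b c d :=
      ⟨_, _, _, _, (fromBlocks_toBlocks Z).symm⟩
    rw [unitaryConj_J_inv_fromBlocks, fromBlocks_neg, fromBlocks_inj] at hθ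
    obtain ⟨rfl, h1, -, -⟩ := hθ
    rw [neg_inj] at h1
    subst h1
    have hZ' : (fromBlocks P c c (-P))ᵀ = -fromBlocks P c c (-P) := by
      rw [← hZ]
      ext i j
      simp
    rw [fromBlocks_transpose, fromBlocks_neg, fromBlocks_inj] at hZ'
    rw [doubleTorus_apply, star_imagPoint, map_neg] at hc
    have hc' : _ * _ = _ * _ := hc
    rw [fromBlocks_multiply, fromBlocks_multiply, fromBlocks_inj] at hc'
    simp only [Matrix.mul_zero, Matrix.zero_mul, add_zero, zero_add] at hc'
    obtain ⟨s, rfl⟩ := eq_paddedTorus_of_commute he hZ'.1 hc'.1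
    -- The generator is diag(D, -D), so the off-diagonal block anticommutes with D and vanishes.
    obtain rfl := eq_zero_of_anticommute_paddedTorus he hZ'.2.1
      (neg_eq_iff_eq_neg.1 ((mul_neg _ _).symm.trans hc'.2.1))
    exact ⟨s, by rw [doubleTorus_apply, star_imagPoint, map_neg]⟩

theorem paddedTorus_conj {e : ℕ} {l m : Fin R → Circle} {σ : Equiv.Perm (Fin R)} {ε : Fin R → ℝ}
    (hre : ∀ j, (l (σ j) : ℂ).re = (m j : ℂ).re)
    (him : ∀ j, (m j : ℂ).im = ε j * (l (σ j) : ℂ).im) (hε : ∀ j, ε j * ε j = 1) :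
    fromBlocks 1 0 0 (fromBlocks (monomialMatrix σ fun _ => (1 : ℝ)) 0 0 (monomialMatrix σ ε)) *
        paddedTorus ℝ e R (circlePoint l) *
      (fromBlocks 1 0 0 (fromBlocks (monomialMatrix σ fun _ => (1 : ℝ)) 0 0
        (monomialMatrix σ ε)))ᴴ = paddedTorus ℝ e R (circlePoint m) := by
  rw [paddedTorus_apply, paddedTorus_apply, rotationTorus_apply, rotationTorus_apply]
  simp only [fromBlocks_conjTranspose, fromBlocks_multiply, conjTranspose_zero, Matrix.mul_zero,
    Matrix.zero_mul, add_zero, zero_add, conjTranspose_one, Matrix.one_mul, Matrix.mul_one,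
    monomial_conj_diagonal, monomial_conj_neg_diagonal, circlePoint]
  congr 2
  · congr 1
    funext j
    simp [hre]
  · congr 2
    funext j
    simp [him, mul_comm]
  · congr 1
    funext j
    simp [him]
  · congr 1
    funext j
    rw [← hre, mul_comm, ← mul_assoc, star_trivial (ε j), hε, one_mul]

theorem isMatrixRealization_DIII (e R : ℕ) (he : e ≤ 1) : IsMatrixRealization
    (properRotations ((Fin e ⊕ (Fin R ⊕ Fin R)) ⊕ (Fin e ⊕ (Fin R ⊕ Fin R))))
    (realifyHom (Fin e ⊕ (Fin R ⊕ Fin R))).range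
    (conjByHom (unitaryJ (Fin e ⊕ (Fin R ⊕ Fin R)) ℝ)⁻¹)
    (ensembleDIII (Fin e ⊕ (Fin R ⊕ Fin R))) (torusDIII e R) R := by
  refine linearInvolution_DIII.isMatrixRealization (regularTorus_DIII he R) symmetricEnsemble_DIII
    mem_range_realifyHom ?_ (fun l m h => ?_)
  · simp only [doubleTorus_apply, star_circlePoint, paddedTorus_circlePoint]
    rfl
  · have hinv : ∀ (x : Fin R → Circle) j, ((x⁻¹ j : Circle) : ℂ).re = (x j : ℂ).re := fun x j => by
      rw [Pi.inv_apply, Circle.coe_inv_eq_conj, Complex.conj_re]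
    have hinv' : ∀ (x : Fin R → Circle) j, ((x⁻¹ j : Circle) : ℂ).im = -(x j : ℂ).im := fun x j => by
      rw [Pi.inv_apply, Circle.coe_inv_eq_conj, Complex.conj_im]
    have hev : ∀ x : Fin R → Circle, (complexEigenvalues (doubleTorus (paddedTorus ℝ e R)
        (circlePoint x))).map Complex.re = (Multiset.replicate e 1 + Multiset.replicate e 1) +
          4 • Finset.univ.val.map fun j => (x j : ℂ).re := fun x => by
      rw [doubleTorus_apply, star_circlePoint, paddedTorus_circlePoint, paddedTorus_circlePoint,
        complexEigenvalues_fromBlocks, Multiset.map_add,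
        re_complexEigenvalues_padded (fun _ => rfl), re_complexEigenvalues_padded (fun _ => rfl),
        funext (hinv x), add_add_add_comm, ← add_nsmul]
    have h1 := congrArg (Multiset.map Complex.re) h
    rw [hev, hev] at h1
    obtain ⟨σ, ε, hε, hre, him⟩ := exists_signed_perm (eq_of_add_nsmul_eq four_ne_zero h1)
    have hε1 : ∀ j, ε j * ε j = 1 := fun j => by rcases hε j with h2 | h2 <;> rw [h2] <;> norm_num
    have hmem : monomialMatrix σ ε ∈ unitaryGroup (Fin R) ℝ :=
      monomialMatrix_mem σ fun j => by rw [star_trivial (ε j), hε1]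
    have hmem1 : monomialMatrix σ (fun _ => (1 : ℝ)) ∈ unitaryGroup (Fin R) ℝ :=
      monomialMatrix_mem σ (by simp)
    obtain ⟨k, hk⟩ : ∃ k : unitaryGroup (Fin e ⊕ (Fin R ⊕ Fin R)) ℝ, k =
      blockDiagHom _ _ ℝ (1, blockDiagHom _ _ ℝ (⟨_, hmem1⟩, ⟨_, hmem⟩)) := ⟨_, rfl⟩
    have hk1 : k.1 = fromBlocks 1 0 0 (fromBlocks (monomialMatrix σ fun _ => (1 : ℝ)) 0 0
        (monomialMatrix σ ε)) := by rw [hk]; rfl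
    -- A real orthogonal k, viewed as a unitary matrix, embeds as diag(k, k).
    refine ⟨realifyHom _ (complexifyHom _ k), ⟨_, rfl⟩, ?_⟩
    have hk2 : (realifyHom _ (complexifyHom _ k)).1 = fromBlocks k.1 0 0 k.1 := by
      change fromBlocks ((k.1.map Complex.ofRealHom).map Complex.re)
        (-((k.1.map Complex.ofRealHom).map Complex.im))
        ((k.1.map Complex.ofRealHom).map Complex.im)
        ((k.1.map Complex.ofRealHom).map Complex.re) = _
      congr 1 <;> ext i j <;> simp
    have hc := paddedTorus_conj (e := e) hre him hε1
    have hc' := paddedTorus_conj (e := e) (l := l⁻¹) (m := m⁻¹) (σ := σ) (ε := ε)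
      (fun j => (hinv l (σ j)).trans ((hre j).trans (hinv m j).symm))
      (fun j => by rw [hinv', hinv', him, mul_neg]) hε1
    rw [hk2, doubleTorus_apply, doubleTorus_apply, star_circlePoint, star_circlePoint,
      star_eq_conjTranspose, fromBlocks_conjTranspose, fromBlocks_multiply, fromBlocks_multiply]
    simp only [conjTranspose_zero, Matrix.mul_zero, Matrix.zero_mul, add_zero, zero_add]
    rw [hk1, hc, hc']

end TorusDIII
end

/-! ### The seven families -/

theorem mainTheorem1 :
    -- A I: `U(N)/O(N)`, with `Ω(g) = (gᵀ)⁻¹`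
    (∀ N : ℕ, IsMatrixRealization (⊤ : Subgroup (Matrix.unitaryGroup (Fin N) ℂ))
      (complexifyHom (Fin N)).range (transposeInvHom (Fin N))
      (ensembleAI (Fin N)) (torusAI N) N) ∧
    -- A II: `U(2N)/USp(2N)`, with `Ω(g) = (J gᵀ Jᵀ)⁻¹ = J (gᵀ)⁻¹ J⁻¹`
    (∀ N : ℕ, IsMatrixRealization (⊤ : Subgroup (Matrix.unitaryGroup (Fin N ⊕ Fin N) ℂ))
      (compactSymplectic (Matrix.J (Fin N) ℂ))
      ((conjByHom (unitaryJ (Fin N) ℂ)).comp (transposeInvHom (Fin N ⊕ Fin N)))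
      (ensembleAII (Fin N)) (torusAII N) N) ∧
    -- A III: `U(M+R)/(U(M) × U(R))` for `M = L + R`, with `Ω(g) = I' g I'`
    (∀ L R : ℕ, IsMatrixRealization
      (⊤ : Subgroup (Matrix.unitaryGroup ((Fin L ⊕ Fin R) ⊕ Fin R) ℂ))
      (blockDiagHom (Fin L ⊕ Fin R) (Fin R) ℂ).range
      (conjByHom (signMatrix (Fin L ⊕ Fin R) (Fin R) ℂ))
      (ensembleGrassmann (Fin L ⊕ Fin R) (Fin R) ℂ) (torusGrassmann ℂ L R) R) ∧
    -- BD I: `O(M+R)/(O(M) × O(R))` for `M = L + R`, with `Ω(g) = I' g I'`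
    (∀ L R : ℕ, IsMatrixRealization
      (⊤ : Subgroup (Matrix.unitaryGroup ((Fin L ⊕ Fin R) ⊕ Fin R) ℝ))
      (blockDiagHom (Fin L ⊕ Fin R) (Fin R) ℝ).range
      (conjByHom (signMatrix (Fin L ⊕ Fin R) (Fin R) ℝ))
      (ensembleGrassmann (Fin L ⊕ Fin R) (Fin R) ℝ) (torusGrassmann ℝ L R) R) ∧
    -- D III: `SO(2N)/U(N)` for `N = e + 2R`, `e ∈ {0, 1}`, with `Ω(g) = Jᵀ g J = J⁻¹ g J`
    (∀ e R : ℕ, e ≤ 1 → IsMatrixRealization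
      (properRotations ((Fin e ⊕ (Fin R ⊕ Fin R)) ⊕ (Fin e ⊕ (Fin R ⊕ Fin R))))
      (realifyHom (Fin e ⊕ (Fin R ⊕ Fin R))).range
      (conjByHom (unitaryJ (Fin e ⊕ (Fin R ⊕ Fin R)) ℝ)⁻¹)
      (ensembleDIII (Fin e ⊕ (Fin R ⊕ Fin R))) (torusDIII e R) R) ∧
    -- C I: `USp(2N)/U(N)`, `U(N)` embedded by `g ↦ diag(g, (gᵀ)⁻¹)`, with `Ω(g) = I' g I'`
    (∀ N : ℕ, IsMatrixRealization (compactSymplectic (Matrix.J (Fin N) ℂ))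
      ((blockDiagHom (Fin N) (Fin N) ℂ).comp
        ((MonoidHom.id _).prod (transposeInvHom (Fin N)))).range
      (conjByHom (signMatrix (Fin N) (Fin N) ℂ))
      (ensembleCI (Fin N)) (torusCI N) N) ∧
    -- C II: `USp(2M+2R)/(USp(2M) × USp(2R))` for `M = L + R`, with `Ω(g) = I' g I'`
    (∀ L R : ℕ, IsMatrixRealization (compactSymplectic (twistedJ (Fin L ⊕ Fin R) (Fin R)))
      (symplecticProduct (Fin L ⊕ Fin R) (Fin R))
      (conjByHom (doubleSignMatrix (Fin L ⊕ Fin R) (Fin R)))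
      (ensembleCII (Fin L ⊕ Fin R) (Fin R)) (torusCII L R) R) := by
  exact ⟨isMatrixRealization_AI, isMatrixRealization_AII,
    isMatrixRealization_grassmann fun _ => rfl, isMatrixRealization_grassmann fun _ => rfl,
    isMatrixRealization_DIII, isMatrixRealization_CI, isMatrixRealization_CII⟩
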